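/- **Setting.** Types are $T ::= \alpha \mid b \mid d\,\vec T \mid T_1\to T_2$ ($b$ a base type, $d$ a datatype identifier). A datatype environment $\Delta$ maps each declared $d$ to finitely many constructors $k$ of types $\forall\vec\alpha.\,U_1\to\dots\to U_m\to d\,\vec\alpha$; the *slice* of $d$ is the set of datatypes on which $d$ transitively depends (including $d$). Expressions are constants (whose types contain no datatypes), constructors and top-level names applied to type arguments, local variables, applications, annotated abstractions and one-level matches. A module is a sequence of $N$ top-level definitions $x:\forall\vec\alpha.T=\Lambda\vec\alpha.e$, each of which may refer to itself (monomorphically) and to earlier names. It is assumed to be well typed in the underlying (unrefined) type system. An extended type labels each datatype occurrence with a refinement variable, $\mathrm{inj}_X\,d\,\vec T$; $\mathrm{inj}_X$ is distributed over the datatypes in a type. Atomic constraints are $\phi\,?\,b$, where the guard $\phi$ is a finite set of atoms $k\in X(d)$ and the body $b$ is $X(d)\subseteq Y(d)$, $X(d)\subseteq\{k_1,\dots,k_m\}$, $k\in X(d)$ or $\bot$ (which stands for $k\in\emptyset$, whatever $k$ is). $\mathrm{Sat}(C)$ is the closure of $C$ under *transitivity* (from $\phi?S_1\subseteq S_2$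 and $\psi?S_2\subseteq S_3$ infer $\phi\cup\psi?S_1\subseteq S_3$, where a resulting $k\in\{k_1,\dots,k_m\}$ is dropped if true and replaced by $\bot$ if false), *satisfaction* (from $\phi?k\in X(d)$ and $\psi?b$ with $k\in X(d)$ in $\psi$ infer $\phi\cup(\psi\setminus\{k\in X(d)\})?b$) and *weakening* (from $\phi?X(d)\subseteq Y(d)$ and $\psi?b$ with $k\in Y(d)$ in $\psi$ infer $\phi\cup(\psi\setminus\{k\in Y(d)\})\cup\{k\in X(d)\}?b$). The restriction $C|_I$ keeps the constraints all of whose refinement variables lie in $I$. Inference $\Gamma\vdash e\Rightarrow T,C$ is given by the following rules, where at every step the displayed constraint set $C$ is replaced by $\mathrm{Sat}(C)|_I$ with $I$ the set of free refinement variables of $\Gamma$ and $T$. *Constant*: its type, and $\emptyset$. *Local variable*: its type in $\Gamma$, and $\emptyset$. *Constructor* $k$ of $d$: $\mathrm{inj}_X$ of its type, with its type arguments replaced by freshly labelled copies, and $\{k\in X(d)\}$, $X$ fresh. *Top-level name* with scheme $\forall\vec\alpha\vec X.\,C\Rightarrow U$: a fresh instance of $U$ and $C$. *Abstraction* $\lambda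 x{:}\underline{T_1}.e$: $T_1\to T_2$ with the constraints of $e$, where $T_1$ is freshly labelled. *Application*: if $e_1\Rightarrow T_1\to T_2,C_1$ and $e_2\Rightarrow T_3,C_2$, then $T_2$ and $C_1\cup C_2$ together with the constraints of $T_3\sqsubseteq T_1$. *Match*: if the scrutinee has type $\mathrm{inj}_X d\,\vec T$ and constraints $C_0$, the match is given a freshly labelled type $T$, the $i$-th branch is inferred with its variables of types $\mathrm{inj}_X(A_j)[\vec T/\vec\alpha]$ ($A_j$ the argument types of $k_i$), giving $T_i,C_i$, and the constraints are $C_0\cup\{X(d)\subseteq\{k_1,\dots,k_m\}\}\cup\bigcup_i(k_i\in X(d)\,?\,(C_i\cup C_i'))$ with $C_i'$ the constraints of $T_i\sqsubseteq T$. The constraints of $T\sqsubseteq T'$ (types of equal shape) are the least solution of: contravariance/covariance for arrows; and for $\mathrm{inj}_Xd\,\vec T\sqsubseteq\mathrm{inj}_Yd\,\vec T'$ the constraint $X(d)\subseteq Y(d)$ together with, for each constructor $k$ of $d$ and argument type $U$ of $k$, the constraints of $\mathrm{inj}_X(U)[\vec T/\vec\alpha]\sqsubseteq\mathrm{inj}_Y(U)[\vec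 T'/\vec\alpha]$ guarded by $k\in X(d)$. A definition $x:\forall\vec\alpha.\underline T=\Lambda\vec\alpha.e$ is inferred with $x:T$ for a freshly labelled $T$; if $e\Rightarrow T',C_1$ and $C_2$ are the constraints of $T'\sqsubseteq T$, it receives the scheme $\forall\vec\alpha\,\vec X.\,\mathrm{Sat}(C_1\cup C_2)|_{\vec X}\Rightarrow T$, where $\vec X$ are the refinement variables of $T$. This yields $\Gamma\vdash m\Rightarrow\Gamma'$ for modules. The inference algorithm reads these rules as a recursive procedure on a unit-cost random access machine (sets are stored as lists; every call, and every step of a list, type or expression traversal, costs one step); subtype constraints and saturation are computed by naive fixed point iteration. **Theorem.** For all $Q,K,D,S$ there is a constant $c=c(Q,K,D,S)$ such that the following holds. Let $\Delta$ be a datatype environment with constructor types of size at most $Q$, at most $K$ constructors per datatype and at most $D$ datatypes per slice. Let the types of constants have size at most $Q$. Let $\Gamma$ be a well-formed closed environment of constrained type schemes with types of size at most $Q$ (each scheme quantifying exactly the refinement variables of its type, with atomic constraints over them). Let $m$ be a module of $N$ top-level definitions that is well typed over $\Delta$ and the underlying environment of $\Gamma$, with each declared type of size at most $Q$ and each body (including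 its type annotations and type arguments) of size at most $S$ (so that the nesting depth of matches is bounded as well). Then the algorithm, run on $\Gamma$ and $m$, terminates with an environment $\Gamma'$ such that $\Gamma\vdash m\Rightarrow\Gamma'$, with saturation and restriction to the interface variables at every step; and if $N\ge 1$ it takes at most $c\cdot N$ steps. Thus type inference runs in time $O(N)$. -/

import Mathlib

/-! Intensional datatype refinement: the language, constructor set constraints, saturation and
restriction, the inference rules, and the inference algorithm with an explicit step count. -/

namespace Refinement

/-! ## Types and datatype environments -/

/-- Monotypes over datatypes whose identifiers carry a label in `L`.
`Ty Unit` are the underlying types, `Ty ℕ` the extended types (`data X d ts` is `inj_X d ts`, the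
label `X` being a refinement variable) and `Ty Empty` the types in which no datatype occurs.
Type variables are numbered; schemes `∀ α₀ … αₙ₋₁. T` are given by the number `n` and the type `T`. -/
inductive Ty (L : Type) : Type where
  | var (a : ℕ)
  | base (b : ℕ)
  | data (l : L) (d : ℕ) (ts : List (Ty L))
  | arr (t u : Ty L)

abbrev UTy := Ty Unit
abbrev XTy := Ty ℕ

namespace Ty

mutual
/-- Number of nodes. -/
def size {L : Type} : Ty L → ℕ
  | .var _ => 1
  | .base _ => 1
  | .data _ _ ts => 1 + sizes ts
  | .arr t u => 1 + size t + size u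
def sizes {L : Type} : List (Ty L) → ℕ
  | [] => 0
  | t :: ts => size t + sizes ts
end

mutual
/-- Relabelling. For `f` constant it is the injection `inj_X T`, for `f` into `Unit` it is the
underlying type of `T`, and for `f : ℕ → ℕ` it is a renaming of refinement variables. -/
def relabel {L L' : Type} (f : L → L') : Ty L → Ty L'
  | .var a => .var a
  | .base b => .base b
  | .data l d ts => .data (f l) d (relabels f ts)
  | .arr t u => .arr (relabel f t) (relabel f u)
def relabels {L L' : Type} (f : L → L') : List (Ty L) → List (Ty L')
  | [] => []
  | t :: ts => relabel f t :: relabels f ts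
end

mutual
/-- Simultaneous substitution of `σ[i]` for the `i`-th type variable. -/
def subst {L : Type} (σ : List (Ty L)) : Ty L → Ty L
  | .var a => (σ[a]?).getD (.var a)
  | .base b => .base b
  | .data l d ts => .data l d (substs σ ts)
  | .arr t u => .arr (subst σ t) (subst σ u)
def substs {L : Type} (σ : List (Ty L)) : List (Ty L) → List (Ty L)
  | [] => []
  | t :: ts => subst σ t :: substs σ ts
end

mutual
/-- The labelled datatype identifiers that occur in a type, from left to right. -/
def labels {L : Type} : Ty L → List (L × ℕ)
  | .var _ => []
  | .base _ => []
  | .data l d ts => (l, d) :: labelss ts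
  | .arr t u => labels t ++ labels u
def labelss {L : Type} : List (Ty L) → List (L × ℕ)
  | [] => []
  | t :: ts => labels t ++ labelss ts
end

mutual
/-- `fresh T n` is the type of underlying shape `T` that is everywhere parametrised by its own
fresh refinement variable, taken from `n, n+1, …`, together with the next unused variable. -/
def fresh : UTy → ℕ → XTy × ℕ
  | .var a, n => (.var a, n)
  | .base b, n => (.base b, n)
  | .data _ d ts, n => (.data n d (freshs ts (n + 1)).1, (freshs ts (n + 1)).2)
  | .arr t u, n => (.arr (fresh t n).1 (fresh u (fresh t n).2).1, (fresh u (fresh t n).2).2)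
def freshs : List UTy → ℕ → List XTy × ℕ
  | [], n => ([], n)
  | t :: ts, n => ((fresh t n).1 :: (freshs ts (fresh t n).2).1, (freshs ts (fresh t n).2).2)
end

/-- The underlying type. -/
def under {L : Type} (t : Ty L) : UTy := t.relabel (fun _ => ())

/-- The injection of a refinement variable into an underlying type. -/
def inj (X : ℕ) (t : UTy) : XTy := t.relabel (fun _ => X)

/-- The refinement variables of an extended type, from left to right. -/
def frv (t : XTy) : List ℕ := t.labels.map Prod.fst

end Ty

/-- A datatype definition: the number of type parameters and, for each constructor, the list of
its argument types, in which the parameters are the type variables `0, …, arity - 1`. -/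
structure Decl where
  arity : ℕ
  ctors : List (ℕ × List UTy)

/-- A datatype environment, as a partial function on datatype identifiers. -/
abbrev DataEnv := ℕ → Option Decl

namespace DataEnv

def arity (Δ : DataEnv) (d : ℕ) : ℕ := ((Δ d).map Decl.arity).getD 0

def ctors (Δ : DataEnv) (d : ℕ) : List (ℕ × List UTy) := ((Δ d).map Decl.ctors).getD []

/-- `k` is a constructor of `d`. -/
def IsCtor (Δ : DataEnv) (k d : ℕ) : Prop := ∃ Us, (k, Us) ∈ Δ.ctors d

end DataEnv

mutual
/-- Well-formed types over the environment `Δ` with type variables `0, …, n - 1`. -/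
def Ty.Wf {L : Type} (Δ : DataEnv) (n : ℕ) : Ty L → Prop
  | .var a => a < n
  | .base _ => True
  | .data _ d ts => (Δ d).isSome ∧ ts.length = Δ.arity d ∧ Ty.Wfs Δ n ts
  | .arr t u => Ty.Wf Δ n t ∧ Ty.Wf Δ n u
def Ty.Wfs {L : Type} (Δ : DataEnv) (n : ℕ) : List (Ty L) → Prop
  | [] => True
  | t :: ts => Ty.Wf Δ n t ∧ Ty.Wfs Δ n ts
end

/-- The type `U₁ → ⋯ → Uₘ → d α₀ … αₙ₋₁` of a constructor of `d` with argument types `Us`. -/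
def ctorTy (Δ : DataEnv) (d : ℕ) (Us : List UTy) : UTy :=
  Us.foldr Ty.arr (.data () d ((List.range (Δ.arity d)).map Ty.var))

/-- `d'` belongs to the slice of `d` through `Δ`, the least subenvironment that contains `d`. -/
inductive InSlice (Δ : DataEnv) (d : ℕ) : ℕ → Prop
  | refl : InSlice Δ d d
  | step {d₁ d₂ k : ℕ} {Us : List UTy} {U : UTy} :
      InSlice Δ d d₁ → (k, Us) ∈ Δ.ctors d₁ → U ∈ Us → ((), d₂) ∈ U.labels → InSlice Δ d d₂

/-- Each definition is a finite map from constructors to well-formed argument types. -/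
def DataEnv.Wf (Δ : DataEnv) : Prop :=
  ∀ d, ((Δ.ctors d).map Prod.fst).Nodup ∧
    ∀ k Us, (k, Us) ∈ Δ.ctors d → ∀ U ∈ Us, U.Wf Δ (Δ.arity d)

/-- Constructor types have size at most `Q`, datatypes have at most `K` constructors, and slices
contain at most `D` datatypes. -/
def DataEnv.Bounded (Δ : DataEnv) (Q K D : ℕ) : Prop :=
  ∀ d, (Δ d).isSome →
    (∀ k Us, (k, Us) ∈ Δ.ctors d → (ctorTy Δ d Us).size ≤ Q) ∧
    (Δ.ctors d).length ≤ K ∧ {d' | InSlice Δ d d'}.encard ≤ D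

/-! ## Expressions, modules and their underlying typing -/

mutual
/-- Expressions, with the underlying types that inference consults. Variables bound inside a
definition (by the definition itself, by an abstraction or by a match) are monomorphic and are de
Bruijn indices; `gvar x Ts` is the `x`-th top-level name, applied to its type arguments. -/
inductive Exp : Type where
  | cst (c : ℕ)
  | con (d k : ℕ) (Ts : List UTy)
  | lvar (i : ℕ)
  | gvar (x : ℕ) (Ts : List UTy)
  | app (e₁ e₂ : Exp)
  | lam (T : UTy) (e : Exp)
  | case (e : Exp) (T : UTy) (bs : Branches)
/-- The branches `k x⃗ ↦ e` of a match; a branch binds as many variables as `k` has arguments,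
the first argument having index `0`. -/
inductive Branches : Type where
  | nil
  | cons (k : ℕ) (e : Exp) (bs : Branches)
end

mutual
/-- Number of nodes, including those of the type arguments and annotations. -/
def Exp.size : Exp → ℕ
  | .cst _ => 1
  | .con _ _ Ts => 1 + Ty.sizes Ts
  | .lvar _ => 1
  | .gvar _ Ts => 1 + Ty.sizes Ts
  | .app e₁ e₂ => 1 + e₁.size + e₂.size
  | .lam T e => 1 + T.size + e.size
  | .case e T bs => 1 + e.size + T.size + bs.size
def Branches.size : Branches → ℕ
  | .nil => 0
  | .cons _ e bs => 1 + e.size + bs.size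
end

/-- A top-level definition `⟨x : ∀ α₀ … αₙ₋₁. T = Λ α₀ … αₙ₋₁. e⟩` with `n = nty`. In `body`, the
de Bruijn index that points past all inner binders is `x` itself, which may be used recursively. -/
structure Defn where
  nty : ℕ
  ty : UTy
  body : Exp

mutual
/-- The underlying typing of expressions: `Sg` lists the type schemes of the top-level names, `n`
is the number of type variables in scope and `cstTy c` is the type of the constant `c`. -/
inductive HasTy (Δ : DataEnv) (cstTy : ℕ → Ty Empty) (Sg : List (ℕ × UTy)) (n : ℕ) :
    List UTy → Exp → UTy → Prop
  | cst {Γ : List UTy} {c : ℕ} : HasTy Δ cstTy Sg n Γ (.cst c) (cstTy c).under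
  | con {Γ Ts Us : List UTy} {d k : ℕ} : (k, Us) ∈ Δ.ctors d → Ts.length = Δ.arity d →
      Ty.Wfs Δ n Ts → HasTy Δ cstTy Sg n Γ (.con d k Ts) ((ctorTy Δ d Us).subst Ts)
  | lvar {Γ : List UTy} {i : ℕ} {T : UTy} : Γ[i]? = some T → HasTy Δ cstTy Sg n Γ (.lvar i) T
  | gvar {Γ Ts : List UTy} {x m : ℕ} {T : UTy} : Sg[x]? = some (m, T) → Ts.length = m →
      Ty.Wfs Δ n Ts → HasTy Δ cstTy Sg n Γ (.gvar x Ts) (T.subst Ts)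
  | app {Γ : List UTy} {e₁ e₂ : Exp} {T₁ T₂ : UTy} : HasTy Δ cstTy Sg n Γ e₁ (.arr T₁ T₂) →
      HasTy Δ cstTy Sg n Γ e₂ T₁ → HasTy Δ cstTy Sg n Γ (.app e₁ e₂) T₂
  | lam {Γ : List UTy} {e : Exp} {T₁ T₂ : UTy} : T₁.Wf Δ n →
      HasTy Δ cstTy Sg n (T₁ :: Γ) e T₂ → HasTy Δ cstTy Sg n Γ (.lam T₁ e) (.arr T₁ T₂)
  | case {Γ Ts : List UTy} {e : Exp} {d : ℕ} {T : UTy} {bs : Branches} : T.Wf Δ n →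
      HasTy Δ cstTy Sg n Γ e (.data () d Ts) → BranchesHaveTy Δ cstTy Sg n Γ d Ts T bs →
      HasTy Δ cstTy Sg n Γ (.case e T bs) T
/-- All branches of a match on a scrutinee of type `d Ts` have type `T`. -/
inductive BranchesHaveTy (Δ : DataEnv) (cstTy : ℕ → Ty Empty) (Sg : List (ℕ × UTy)) (n : ℕ) :
    List UTy → ℕ → List UTy → UTy → Branches → Prop
  | nil {Γ Ts : List UTy} {d : ℕ} {T : UTy} : BranchesHaveTy Δ cstTy Sg n Γ d Ts T .nil
  | cons {Γ Ts Us : List UTy} {d k : ℕ} {T : UTy} {e : Exp} {bs : Branches} :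
      (k, Us) ∈ Δ.ctors d → HasTy Δ cstTy Sg n (Ty.substs Ts Us ++ Γ) e T →
      BranchesHaveTy Δ cstTy Sg n Γ d Ts T bs →
      BranchesHaveTy Δ cstTy Sg n Γ d Ts T (.cons k e bs)
end

/-- The underlying typing of modules, in which each definition may use itself and all top-level
names that precede it. -/
def ModTyped (Δ : DataEnv) (cstTy : ℕ → Ty Empty) : List (ℕ × UTy) → List Defn → Prop
  | _, [] => True
  | Sg, f :: m => f.ty.Wf Δ f.nty ∧ HasTy Δ cstTy Sg f.nty [f.ty] f.body f.ty ∧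
      ModTyped Δ cstTy (Sg ++ [(f.nty, f.ty)]) m

/-! ## Constraints, saturation and restriction -/

/-- The guard atom `k ∈ X(d)`. -/
structure Atom where
  k : ℕ
  X : ℕ
  d : ℕ
  deriving DecidableEq

/-- Bodies of atomic constraints: `X(d) ⊆ Y(d)`, `X(d) ⊆ {k₁, …, kₘ}`, `k ∈ X(d)` and `k ∈ ∅`.
The last one is unsatisfiable whatever `k` is, so it is a single body, `bot`.
`S` represents finite sets of constructors. -/
inductive Body (S : Type) : Type where
  | sub (X Y d : ℕ)
  | subset (X d : ℕ) (ks : S)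
  | mem (k X d : ℕ)
  | bot

/-- Atomic constraints `guard ? body`; `A` represents finite sets of atoms. -/
structure Constr (A S : Type) : Type where
  guard : A
  body : Body S

/-- Constraints with genuine finite sets. -/
abbrev CC := Constr (Finset Atom) (Finset ℕ)

def Body.map {S S' : Type} (f : S → S') : Body S → Body S'
  | .sub X Y d => .sub X Y d
  | .subset X d ks => .subset X d (f ks)
  | .mem k X d => .mem k X d
  | .bot => .bot

/-- Renaming of refinement variables. -/
def Body.rename {S : Type} (ρ : ℕ → ℕ) : Body S → Body S
  | .sub X Y d => .sub (ρ X) (ρ Y) d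
  | .subset X d ks => .subset (ρ X) d ks
  | .mem k X d => .mem k (ρ X) d
  | .bot => .bot

def Atom.rename (ρ : ℕ → ℕ) (a : Atom) : Atom := ⟨a.k, ρ a.X, a.d⟩

def Constr.rename (ρ : ℕ → ℕ) (c : CC) : CC := ⟨c.guard.image (Atom.rename ρ), c.body.rename ρ⟩

/-- The pairs of a refinement variable and a datatype that occur in a body. -/
def Body.pairs {S : Type} : Body S → List (ℕ × ℕ)
  | .sub X Y d => [(X, d), (Y, d)]
  | .subset X d _ => [(X, d)]
  | .mem _ X d => [(X, d)]
  | .bot => []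

def Body.frv {S : Type} (b : Body S) : List ℕ := b.pairs.map Prod.fst

def Constr.frv (c : CC) : Set ℕ := {X | (∃ a ∈ c.guard, a.X = X) ∨ X ∈ c.body.frv}

/-- Restriction to the interface `I`. -/
def restrict (C : Set CC) (I : Set ℕ) : Set CC := {c | c ∈ C ∧ c.frv ⊆ I}

/-- The guarded constraint set `φ ? C`. -/
def guardBy (φ : Finset Atom) (C : Set CC) : Set CC := {c | ∃ c' ∈ C, c = ⟨φ ∪ c'.guard, c'.body⟩}

/-- `Trans b₁ b₂ b₃`: from `S₁ ⊆ S₂` and `S₂ ⊆ S₃` we get `S₁ ⊆ S₃` as an atomic body. An inclusion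
`k ∈ {k₁, …, kₘ}` is dropped if it is true, and is `bot` if it is false. -/
inductive Trans : Body (Finset ℕ) → Body (Finset ℕ) → Body (Finset ℕ) → Prop
  | sub_sub {X Y Z d : ℕ} : Trans (.sub X Y d) (.sub Y Z d) (.sub X Z d)
  | sub_subset {X Y d : ℕ} {ks : Finset ℕ} :
      Trans (.sub X Y d) (.subset Y d ks) (.subset X d ks)
  | mem_sub {k X Y d : ℕ} : Trans (.mem k X d) (.sub X Y d) (.mem k Y d)
  | mem_subset {k X d : ℕ} {ks : Finset ℕ} : k ∉ ks → Trans (.mem k X d) (.subset X d ks) .bot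
  | subset_mem {k X Y d : ℕ} : Trans (.subset X d {k}) (.mem k Y d) (.sub X Y d)

/-- `Sat C`: the closure of `C` under transitivity, satisfaction and weakening. -/
inductive Sat (C : Set CC) : Set CC
  | base {c : CC} : c ∈ C → Sat C c
  | transitivity {φ ψ : Finset Atom} {b₁ b₂ b₃ : Body (Finset ℕ)} :
      Sat C ⟨φ, b₁⟩ → Sat C ⟨ψ, b₂⟩ → Trans b₁ b₂ b₃ → Sat C ⟨φ ∪ ψ, b₃⟩
  | satisfaction {φ ψ : Finset Atom} {k X d : ℕ} {b : Body (Finset ℕ)} :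
      Sat C ⟨φ, .mem k X d⟩ → Sat C ⟨ψ, b⟩ → ⟨k, X, d⟩ ∈ ψ → Sat C ⟨φ ∪ ψ.erase ⟨k, X, d⟩, b⟩
  | weakening {φ ψ : Finset Atom} {k X Y d : ℕ} {b : Body (Finset ℕ)} :
      Sat C ⟨φ, .sub X Y d⟩ → Sat C ⟨ψ, b⟩ → ⟨k, Y, d⟩ ∈ ψ →
      Sat C ⟨insert ⟨k, X, d⟩ (φ ∪ ψ.erase ⟨k, Y, d⟩), b⟩

/-! ## The inference rules -/

/-- `SubGen Δ T₁ T₂ c`: the constraint `c` is generated by the subtype inequality `T₁ ⊑ T₂`, as the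
least fixed point of the rules for base types, type variables, arrows and datatypes. -/
inductive SubGen (Δ : DataEnv) : XTy → XTy → CC → Prop
  | arrL {T₁ T₂ U₁ U₂ : XTy} {c : CC} : SubGen Δ U₁ T₁ c → SubGen Δ (.arr T₁ T₂) (.arr U₁ U₂) c
  | arrR {T₁ T₂ U₁ U₂ : XTy} {c : CC} : SubGen Δ T₂ U₂ c → SubGen Δ (.arr T₁ T₂) (.arr U₁ U₂) c
  | incl {X Y d : ℕ} {Ts Ts' : List XTy} :
      SubGen Δ (.data X d Ts) (.data Y d Ts') ⟨∅, .sub X Y d⟩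
  | arg {X Y d k : ℕ} {Ts Ts' : List XTy} {Us : List UTy} {U : UTy} {c : CC} :
      (k, Us) ∈ Δ.ctors d → U ∈ Us → SubGen Δ ((U.inj X).subst Ts) ((U.inj Y).subst Ts') c →
      SubGen Δ (.data X d Ts) (.data Y d Ts') ⟨{⟨k, X, d⟩} ∪ c.guard, c.body⟩

/-- The judgement `⊢ T₁ ⊑ T₂ ⟹ C`. -/
def SubInfers (Δ : DataEnv) (T₁ T₂ : XTy) (C : Set CC) : Prop :=
  T₁.under = T₂.under ∧ C = {c | SubGen Δ T₁ T₂ c}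

/-- A constrained type scheme `∀ α₀ … αₙ₋₁. ∀ X⃗. C ⟹ T` with `n = nty` and `X⃗ = qs`. -/
structure Scheme (C : Type) where
  nty : ℕ
  qs : List ℕ
  cs : C
  ty : XTy

/-- Saturation of `C` and restriction to the context: the interface consists of the refinement
variables of the monomorphic part `Γ` of the environment (top-level schemes are closed) and of the
inferred type `T`. -/
def close (Γ : List XTy) (T : XTy) (C : Set CC) : Set CC :=
  restrict (Sat C) {X | (∃ U ∈ Γ, X ∈ U.frv) ∨ X ∈ T.frv}

/-- The constructors handled by a match. -/
def Branches.keys : Branches → Finset ℕ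
  | .nil => ∅
  | .cons k _ bs => insert k bs.keys

mutual
/-- `Infers Δ cstTy G Γ e n T C nf` is the judgement `G, Γ ⊢ e ⟹ T, C`, with saturation and
restriction to the context in every step. `G` lists the schemes of the top-level names, `Γ` the types
of the local variables; the fresh refinement variables are taken from `n, …, nf - 1`. -/
inductive Infers (Δ : DataEnv) (cstTy : ℕ → Ty Empty) (G : List (Scheme (Set CC))) :
    List XTy → Exp → ℕ → XTy → Set CC → ℕ → Prop
  | cst {Γ : List XTy} {c n : ℕ} {T : XTy} : T = (cstTy c).relabel Empty.elim →
      Infers Δ cstTy G Γ (.cst c) n T (close Γ T ∅) n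
  | con {Γ Ts' : List XTy} {d k n nf : ℕ} {Ts Us : List UTy} {T : XTy} :
      (k, Us) ∈ Δ.ctors d → (Ts', nf) = Ty.freshs Ts (n + 1) →
      T = ((ctorTy Δ d Us).inj n).subst Ts' →
      Infers Δ cstTy G Γ (.con d k Ts) n T (close Γ T {⟨∅, .mem k n d⟩}) nf
  | lvar {Γ : List XTy} {i n : ℕ} {T : XTy} : Γ[i]? = some T →
      Infers Δ cstTy G Γ (.lvar i) n T (close Γ T ∅) n
  | gvar {Γ Ts' : List XTy} {x n nf : ℕ} {Ts : List UTy} {s : Scheme (Set CC)} {ρ : ℕ → ℕ}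
      {T : XTy} :
      G[x]? = some s → ρ = (fun X => n + s.qs.idxOf X) →
      (Ts', nf) = Ty.freshs Ts (n + s.qs.length) → T = (s.ty.relabel ρ).subst Ts' →
      Infers Δ cstTy G Γ (.gvar x Ts) n T (close Γ T (Constr.rename ρ '' s.cs)) nf
  | lam {Γ : List XTy} {e : Exp} {n n₁ nf : ℕ} {T₁ : UTy} {T₁' T₂ : XTy} {C : Set CC} :
      (T₁', n₁) = T₁.fresh n → Infers Δ cstTy G (T₁' :: Γ) e n₁ T₂ C nf →
      Infers Δ cstTy G Γ (.lam T₁ e) n (.arr T₁' T₂) (close Γ (.arr T₁' T₂) C) nf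
  | app {Γ : List XTy} {e₁ e₂ : Exp} {n n₁ nf : ℕ} {T₁ T₂ T₃ : XTy} {C₁ C₂ C₃ : Set CC} :
      Infers Δ cstTy G Γ e₁ n (.arr T₁ T₂) C₁ n₁ → Infers Δ cstTy G Γ e₂ n₁ T₃ C₂ nf →
      SubInfers Δ T₃ T₁ C₃ →
      Infers Δ cstTy G Γ (.app e₁ e₂) n T₂ (close Γ T₂ (C₁ ∪ C₂ ∪ C₃)) nf
  | case {Γ Ts : List XTy} {e : Exp} {bs : Branches} {n n₀ n₁ nf X d : ℕ} {T : UTy} {T' : XTy}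
      {C₀ Cb : Set CC} :
      Infers Δ cstTy G Γ e n (.data X d Ts) C₀ n₀ → (T', n₁) = T.fresh n₀ →
      InfersBranches Δ cstTy G Γ X d Ts T' bs n₁ Cb nf →
      Infers Δ cstTy G Γ (.case e T bs) n T'
        (close Γ T' (C₀ ∪ {⟨∅, .subset X d bs.keys⟩} ∪ Cb)) nf
/-- The contribution `⋃ᵢ (kᵢ ∈ X(d) ? (Cᵢ ∪ Cᵢ'))` of the branches of a match on a scrutinee of
type `inj_X d Ts`, where `T` is the fresh type of the match. -/
inductive InfersBranches (Δ : DataEnv) (cstTy : ℕ → Ty Empty) (G : List (Scheme (Set CC))) :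
    List XTy → ℕ → ℕ → List XTy → XTy → Branches → ℕ → Set CC → ℕ → Prop
  | nil {Γ Ts : List XTy} {X d n : ℕ} {T : XTy} :
      InfersBranches Δ cstTy G Γ X d Ts T .nil n ∅ n
  | cons {Γ Ts : List XTy} {X d k n n₁ nf : ℕ} {Us : List UTy} {T Tk : XTy} {e : Exp}
      {bs : Branches} {C C' Cb : Set CC} :
      (k, Us) ∈ Δ.ctors d →
      Infers Δ cstTy G (Us.map (fun U => (U.inj X).subst Ts) ++ Γ) e n Tk C n₁ →
      SubInfers Δ Tk T C' → InfersBranches Δ cstTy G Γ X d Ts T bs n₁ Cb nf →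
      InfersBranches Δ cstTy G Γ X d Ts T (.cons k e bs) n
        (guardBy {⟨k, X, d⟩} (C ∪ C') ∪ Cb) nf
end

/-- `ModInfers Δ cstTy G n m G' nf` is the judgement `G ⊢ m ⟹ G'` for modules; the scheme inferred
for a definition carries the saturated constraints, restricted to the variables of its type. -/
inductive ModInfers (Δ : DataEnv) (cstTy : ℕ → Ty Empty) :
    List (Scheme (Set CC)) → ℕ → List Defn → List (Scheme (Set CC)) → ℕ → Prop
  | nil {G : List (Scheme (Set CC))} {n : ℕ} : ModInfers Δ cstTy G n [] G n
  | cons {G G' : List (Scheme (Set CC))} {n n₁ n₂ nf : ℕ} {f : Defn} {m : List Defn}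
      {T T' : XTy} {C₁ C₂ : Set CC} :
      (T, n₁) = f.ty.fresh n → Infers Δ cstTy G [T] f.body n₁ T' C₁ n₂ → SubInfers Δ T' T C₂ →
      ModInfers Δ cstTy
        (G ++ [⟨f.nty, T.frv, restrict (Sat (C₁ ∪ C₂)) {X | X ∈ T.frv}, T⟩]) n₂ m G' nf →
      ModInfers Δ cstTy G n (f :: m) G' nf

/-! ## The algorithm

Programs run on a random access machine with unit cost: a computation returns its result together
with the number of steps, or diverges. Every call of a function, and so every step of a recursion
over a list, a type or an expression, costs one step (`tick`) in addition to the cost of the calls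
that it makes. Only a bounded amount of work on machine words and pointers is part of the step of a
call: comparing or adding words, forming or taking apart a cell, and one access to the tables that
hold the constants, the datatype definitions and the schemes of the top-level names.
Sets are lists without repetitions, in any order. -/

/-- Computations with a step counter; `none` stands for divergence or failure. -/
abbrev Timed := StateT ℕ Option

/-- One step. -/
def tick : Timed Unit := fun t => some ((), t + 1)

/-- Failure. -/
def stuck {α : Type} : Timed α := fun _ => none

/-! ### Lists and finite sets -/

/-- Comparison of words (or of tuples of words of a fixed length). -/
def eqW {α : Type} [DecidableEq α] (x y : α) : Timed Bool := do
  tick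
  pure (decide (x = y))

def memT {α : Type} (eq : α → α → Timed Bool) (x : α) : List α → Timed Bool
  | [] => do tick; pure false
  | y :: ys => do
    tick
    if ← eq x y then pure true else memT eq x ys

/-- Insertion into a set; the flag says whether the set has changed. -/
def insertT {α : Type} (eq : α → α → Timed Bool) (x : α) (xs : List α) :
    Timed (List α × Bool) := do
  tick
  if ← memT eq x xs then pure (xs, false) else pure (x :: xs, true)

/-- Insertion of all elements of the first list into the second one. -/
def unionT {α : Type} (eq : α → α → Timed Bool) : List α → List α → Timed (List α × Bool)
  | [], ys => do tick; pure (ys, false)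
  | x :: xs, ys => do
    tick
    let r ← unionT eq xs ys
    let r' ← insertT eq x r.1
    pure (r'.1, r.2 || r'.2)

def appendT {α : Type} : List α → List α → Timed (List α)
  | [], ys => do tick; pure ys
  | x :: xs, ys => do
    tick
    let zs ← appendT xs ys
    pure (x :: zs)

def mapT {α β : Type} (f : α → Timed β) : List α → Timed (List β)
  | [] => do tick; pure []
  | x :: xs => do
    tick
    let y ← f x
    let ys ← mapT f xs
    pure (y :: ys)

def flatMapT {α β : Type} (f : α → Timed (List β)) : List α → Timed (List β)
  | [] => do tick; pure []
  | x :: xs => do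
    tick
    let ys ← f x
    let zs ← flatMapT f xs
    appendT ys zs

def filterT {α : Type} (p : α → Timed Bool) : List α → Timed (List α)
  | [] => do tick; pure []
  | x :: xs => do
    tick
    let b ← p x
    let ys ← filterT p xs
    if b then pure (x :: ys) else pure ys

def allT {α : Type} (p : α → Timed Bool) : List α → Timed Bool
  | [] => do tick; pure true
  | x :: xs => do
    tick
    if ← p x then allT p xs else pure false

def lengthT {α : Type} : List α → Timed ℕ
  | [] => do tick; pure 0
  | _ :: xs => do
    tick
    let n ← lengthT xs
    pure (n + 1)

def getT {α : Type} : List α → ℕ → Timed (Option α)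
  | [], _ => do tick; pure none
  | x :: _, 0 => do tick; pure (some x)
  | _ :: xs, i + 1 => do tick; getT xs i

/-- The position of the first occurrence of a word (the length of the list if there is none). -/
def idxT (x : ℕ) : List ℕ → Timed ℕ
  | [] => do tick; pure 0
  | y :: ys => do
    tick
    if x = y then pure 0
    else do
      let i ← idxT x ys
      pure (i + 1)

def subsetT {α : Type} [DecidableEq α] (xs ys : List α) : Timed Bool := do
  tick
  allT (fun x => memT eqW x ys) xs

/-- Equality of sets. -/
def seteqT {α : Type} [DecidableEq α] (xs ys : List α) : Timed Bool := do
  tick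
  if ← subsetT xs ys then subsetT ys xs else pure false

def removeT {α : Type} [DecidableEq α] (x : α) (xs : List α) : Timed (List α) := do
  tick
  filterT (fun y => do
    let b ← eqW x y
    pure (!b)) xs

/-- Fixed point iteration: replace the set `xs` by `xs ∪ step xs` until it does not change any more.
The natural number bounds the number of rounds that are simulated. -/
def closureN {α : Type} (eq : α → α → Timed Bool) (step : List α → Timed (List α)) :
    ℕ → List α → Timed (List α)
  | 0, _ => stuck
  | i + 1, xs => do
    tick
    let ys ← step xs
    let r ← unionT eq ys xs
    if r.2 then closureN eq step i r.1 else pure r.1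

open Classical in
/-- The unbounded iteration: the outcome of `closureN` for any number of rounds that is large enough,
and divergence if there is none. -/
noncomputable def closureT {α : Type} (eq : α → α → Timed Bool) (step : List α → Timed (List α))
    (xs : List α) : Timed (List α) := fun t =>
  if h : ∃ i, (closureN eq step i xs t).isSome then closureN eq step (Nat.find h) xs t else none

/-! ### Types -/

mutual
def relabelT {L L' : Type} (f : L → Timed L') : Ty L → Timed (Ty L')
  | .var a => do tick; pure (.var a)
  | .base b => do tick; pure (.base b)
  | .data l d ts => do
    tick
    let l' ← f l
    let ts' ← relabelsT f ts
    pure (.data l' d ts')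
  | .arr t u => do
    tick
    let t' ← relabelT f t
    let u' ← relabelT f u
    pure (.arr t' u')
def relabelsT {L L' : Type} (f : L → Timed L') : List (Ty L) → Timed (List (Ty L'))
  | [] => do tick; pure []
  | t :: ts => do
    tick
    let u ← relabelT f t
    let us ← relabelsT f ts
    pure (u :: us)
end

/-- The injection of a refinement variable. -/
def injT (X : ℕ) (t : UTy) : Timed XTy := do
  tick
  relabelT (fun _ => pure X) t

mutual
def substT {L : Type} (σ : List (Ty L)) : Ty L → Timed (Ty L)
  | .var a => do
    tick
    let t ← getT σ a
    pure (t.getD (.var a))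
  | .base b => do tick; pure (.base b)
  | .data l d ts => do
    tick
    let ts' ← substsT σ ts
    pure (.data l d ts')
  | .arr t u => do
    tick
    let t' ← substT σ t
    let u' ← substT σ u
    pure (.arr t' u')
def substsT {L : Type} (σ : List (Ty L)) : List (Ty L) → Timed (List (Ty L))
  | [] => do tick; pure []
  | t :: ts => do
    tick
    let t' ← substT σ t
    let ts' ← substsT σ ts
    pure (t' :: ts')
end

mutual
def labelsT {L : Type} : Ty L → Timed (List (L × ℕ))
  | .var _ => do tick; pure []
  | .base _ => do tick; pure []
  | .data l d ts => do
    tick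
    let ps ← labelssT ts
    pure ((l, d) :: ps)
  | .arr t u => do
    tick
    let ps ← labelsT t
    let qs ← labelsT u
    appendT ps qs
def labelssT {L : Type} : List (Ty L) → Timed (List (L × ℕ))
  | [] => do tick; pure []
  | t :: ts => do
    tick
    let ps ← labelsT t
    let qs ← labelssT ts
    appendT ps qs
end

def frvT (t : XTy) : Timed (List ℕ) := do
  tick
  let ps ← labelsT t
  mapT (fun p => pure p.1) ps

mutual
def freshT : UTy → ℕ → Timed (XTy × ℕ)
  | .var a, n => do tick; pure (.var a, n)
  | .base b, n => do tick; pure (.base b, n)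
  | .data _ d ts, n => do
    tick
    let r ← freshsT ts (n + 1)
    pure (.data n d r.1, r.2)
  | .arr t u, n => do
    tick
    let r ← freshT t n
    let r' ← freshT u r.2
    pure (.arr r.1 r'.1, r'.2)
def freshsT : List UTy → ℕ → Timed (List XTy × ℕ)
  | [], n => do tick; pure ([], n)
  | t :: ts, n => do
    tick
    let r ← freshT t n
    let r' ← freshsT ts r.2
    pure (r.1 :: r'.1, r'.2)
end

/-- The parameters `α_i, …, α_{i+n-1}`. -/
def paramsT (i : ℕ) : ℕ → Timed (List UTy)
  | 0 => do tick; pure []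
  | n + 1 => do
    tick
    let ts ← paramsT (i + 1) n
    pure (.var i :: ts)

def arrowsT (t : UTy) : List UTy → Timed UTy
  | [] => do tick; pure t
  | U :: Us => do
    tick
    let u ← arrowsT t Us
    pure (.arr U u)

def ctorTyT (Δ : DataEnv) (d : ℕ) (Us : List UTy) : Timed UTy := do
  tick
  let ps ← paramsT 0 (Δ.arity d)
  arrowsT (.data () d ps) Us

/-- The argument types of the constructor `k`. -/
def lookupCtorT (k : ℕ) : List (ℕ × List UTy) → Timed (List UTy)
  | [] => stuck
  | kU :: ks => do
    tick
    if kU.1 = k then pure kU.2 else lookupCtorT k ks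

/-! ### Constraints, saturation and restriction -/

/-- Constraints as they are stored: sets are lists. -/
abbrev RC := Constr (List Atom) (List ℕ)

/-- The constraint that is represented by a stored one. -/
def Constr.abs (c : RC) : CC := ⟨c.guard.toFinset, c.body.map List.toFinset⟩

/-- The scheme that is represented by a stored one. -/
def Scheme.abs (s : Scheme (List RC)) : Scheme (Set CC) :=
  ⟨s.nty, s.qs, {c | ∃ c' ∈ s.cs, c = c'.abs}, s.ty⟩

def bodyEqT (b b' : Body (List ℕ)) : Timed Bool := do
  tick
  match b, b' with
  | .sub X Y d, .sub X' Y' d' => pure (decide (X = X' ∧ Y = Y' ∧ d = d'))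
  | .subset X d ks, .subset X' d' ks' =>
    if X = X' ∧ d = d' then seteqT ks ks' else pure false
  | .mem k X d, .mem k' X' d' => pure (decide (k = k' ∧ X = X' ∧ d = d'))
  | .bot, .bot => pure true
  | _, _ => pure false

def constrEqT (c c' : RC) : Timed Bool := do
  tick
  if ← bodyEqT c.body c'.body then seteqT c.guard c'.guard else pure false

def guardByT (φ : List Atom) (C : List RC) : Timed (List RC) := do
  tick
  mapT (fun c => do
    let r ← unionT eqW φ c.guard
    pure ⟨r.1, c.body⟩) C

/-- The bodies obtained by transitivity. -/
def transT (b b' : Body (List ℕ)) : Timed (List (Body (List ℕ))) := do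
  tick
  match b, b' with
  | .sub X Y d, .sub Y' Z d' => pure (if Y = Y' ∧ d = d' then [.sub X Z d] else [])
  | .sub X Y d, .subset Y' d' ks => pure (if Y = Y' ∧ d = d' then [.subset X d ks] else [])
  | .mem k X d, .sub X' Y d' => pure (if X = X' ∧ d = d' then [.mem k Y d] else [])
  | .mem k X d, .subset X' d' ks =>
    if X = X' ∧ d = d' then do
      if ← memT eqW k ks then pure [] else pure [.bot]
    else pure []
  | .subset X d ks, .mem k Y d' =>
    if d = d' then do
      if ← seteqT ks [k] then pure [.sub X Y d] else pure []
    else pure []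
  | _, _ => pure []

/-- The conclusions of the satisfaction and weakening rules with left premise `c`, right premise `c'`
and the atom `a` of the guard of `c'`. -/
def atomT (c c' : RC) (a : Atom) : Timed (List RC) := do
  tick
  match c.body with
  | .mem k X d =>
    if a = ⟨k, X, d⟩ then do
      let ψ ← removeT a c'.guard
      let r ← unionT eqW c.guard ψ
      pure [⟨r.1, c'.body⟩]
    else pure []
  | .sub X Y d =>
    if a.X = Y ∧ a.d = d then do
      let ψ ← removeT a c'.guard
      let r ← unionT eqW c.guard ψ
      let r' ← insertT eqW ⟨a.k, X, d⟩ r.1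
      pure [⟨r'.1, c'.body⟩]
    else pure []
  | _ => pure []

/-- All conclusions of a saturation rule with premises `c` and `c'`. -/
def resolveT (c c' : RC) : Timed (List RC) := do
  tick
  let bs ← transT c.body c'.body
  let cs ← mapT (fun b => do
    let r ← unionT eqW c.guard c'.guard
    pure ⟨r.1, b⟩) bs
  let cs' ← flatMapT (atomT c c') c'.guard
  appendT cs cs'

noncomputable def saturateT (C : List RC) : Timed (List RC) := do
  tick
  closureT constrEqT (fun C => flatMapT (fun c => flatMapT (resolveT c) C) C) C

def restrictT (C : List RC) (I : List ℕ) : Timed (List RC) := do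
  tick
  filterT (fun c => do
    if ← allT (fun a => memT eqW a.X I) c.guard then subsetT c.body.frv I else pure false) C

noncomputable def closeT (Γ : List XTy) (T : XTy) (C : List RC) : Timed (List RC) := do
  tick
  let Cs ← saturateT C
  let I ← flatMapT frvT Γ
  let J ← frvT T
  let IJ ← appendT I J
  restrictT Cs IJ

/-- Renaming of the quantified variables `qs` to `n, n+1, …`. -/
def renameT (n : ℕ) (qs : List ℕ) (X : ℕ) : Timed ℕ := do
  tick
  let i ← idxT X qs
  pure (n + i)

def renameBodyT (ρ : ℕ → Timed ℕ) (b : Body (List ℕ)) : Timed (Body (List ℕ)) := do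
  tick
  match b with
  | .sub X Y d => do
    let X' ← ρ X
    let Y' ← ρ Y
    pure (.sub X' Y' d)
  | .subset X d ks => do
    let X' ← ρ X
    pure (.subset X' d ks)
  | .mem k X d => do
    let X' ← ρ X
    pure (.mem k X' d)
  | .bot => pure .bot

def renameConstrT (ρ : ℕ → Timed ℕ) (c : RC) : Timed RC := do
  tick
  let g ← mapT (fun a => do
    let X' ← ρ a.X
    pure ⟨a.k, X', a.d⟩) c.guard
  let b ← renameBodyT ρ c.body
  pure ⟨g, b⟩

/-! ### Subtype inequalities

The rule for datatypes unfolds their definitions, possibly for ever. For each datatype `d` of a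
slice we therefore compute, as a least fixed point, a summary of all paths through the constructor
arguments that lead from `inj_X d Ts ⊑ inj_Y d Ts'` to an inequality between two datatypes
with labels `X` and `Y`, or between the `i`-th type arguments. -/

/-- The end of a path. -/
inductive Target : Type where
  | data (d : ℕ)
  | param (i : ℕ)
  deriving DecidableEq

/-- A path: the atoms `k ∈ X(d)` (written `(k, d, false)`) and `k ∈ Y(d)` (written `(k, d, true)`)
that guard it, its polarity, which is `true` if the inequality at its end is reversed, and its
end. -/
structure Path where
  guard : List (ℕ × ℕ × Bool)
  flip : Bool
  target : Target

def pathEqT (p q : Path) : Timed Bool := do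
  tick
  if p.flip = q.flip ∧ p.target = q.target then seteqT p.guard q.guard else pure false

/-- The path for the reversed inequality, if `b` holds. -/
def flipT (b : Bool) (p : Path) : Timed Path := do
  tick
  let g ← mapT (fun a => pure (a.1, a.2.1, xor b a.2.2)) p.guard
  pure ⟨g, xor b p.flip, p.target⟩

/-- The path `p` followed by the path `q`. -/
def composeT (p q : Path) : Timed Path := do
  tick
  let q' ← flipT p.flip q
  let r ← unionT eqW p.guard q'.guard
  pure ⟨r.1, q'.flip, q'.target⟩

mutual
/-- The paths that start in a type, given the paths that are known for datatypes. -/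
def pathsT (facts : List (ℕ × Path)) : UTy → Timed (List Path)
  | .var a => do tick; pure [⟨[], false, .param a⟩]
  | .base _ => do tick; pure []
  | .arr t u => do
    tick
    let ps ← pathsT facts t
    let ps' ← mapT (flipT true) ps
    let qs ← pathsT facts u
    appendT ps' qs
  | .data _ d ts => do
    tick
    let pss ← pathssT facts ts
    flatMapT (fun f =>
      if f.1 = d then
        match f.2.target with
        | .data _ => pure [f.2]
        | .param i => do
          let ps ← getT pss i
          mapT (composeT f.2) (ps.getD [])
      else pure []) facts
def pathssT (facts : List (ℕ × Path)) : List UTy → Timed (List (List Path))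
  | [] => do tick; pure []
  | t :: ts => do
    tick
    let ps ← pathsT facts t
    let pss ← pathssT facts ts
    pure (ps :: pss)
end

/-- One round of the computation of the paths from the datatypes `ds`. -/
def pathStepT (Δ : DataEnv) (ds : List ℕ) (facts : List (ℕ × Path)) :
    Timed (List (ℕ × Path)) := do
  tick
  flatMapT (fun d => flatMapT (fun kU => flatMapT (fun U => do
    let ps ← pathsT facts U
    mapT (fun p => do
      let r ← insertT eqW (kU.1, d, false) p.guard
      pure (d, ⟨r.1, p.flip, p.target⟩)) ps) kU.2) (Δ.ctors d)) ds

/-- The datatypes in the slice of `d`. -/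
noncomputable def sliceT (Δ : DataEnv) (d : ℕ) : Timed (List ℕ) := do
  tick
  closureT eqW (fun ds => flatMapT (fun d => flatMapT (fun kU => flatMapT (fun U => do
    let ps ← labelsT U
    mapT (fun p => pure p.2) ps) kU.2) (Δ.ctors d)) ds) [d]

/-- All paths from the datatype `d`. -/
noncomputable def summaryT (Δ : DataEnv) (d : ℕ) : Timed (List Path) := do
  tick
  let ds ← sliceT Δ d
  let init ← mapT (fun d => pure (d, ⟨[], false, .data d⟩)) ds
  let facts ← closureT (fun f g => if f.1 = g.1 then pathEqT f.2 g.2 else do tick; pure false)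
    (pathStepT Δ ds) init
  flatMapT (fun f => if f.1 = d then pure [f.2] else pure []) facts

/-- The guard of a path whose label `X` is `lo` and whose label `Y` is `hi`. -/
def pathGuardT (lo hi : ℕ) (g : List (ℕ × ℕ × Bool)) : Timed (List Atom) := do
  tick
  let as ← mapT (fun a => pure (⟨a.1, if a.2.2 then hi else lo, a.2.1⟩ : Atom)) g
  let r ← unionT eqW as []
  pure r.1

mutual
/-- The constraints for `T₁ ⊑ T₂`, or for `T₂ ⊑ T₁` if the flag is set. -/
noncomputable def subT (Δ : DataEnv) : Bool → XTy → XTy → Timed (List RC)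
  | _, .var a, .var a' => do
    tick
    if a = a' then pure [] else stuck
  | _, .base b, .base b' => do
    tick
    if b = b' then pure [] else stuck
  | p, .arr t u, .arr t' u' => do
    tick
    let C ← subT Δ (!p) t t'
    let C' ← subT Δ p u u'
    let r ← unionT constrEqT C C'
    pure r.1
  | p, .data X d ts, .data Y d' ts' => do
    tick
    if d = d' then do
      let Cs ← subsT Δ p ts ts'
      let Cs' ← subsT Δ (!p) ts ts'
      let paths ← summaryT Δ d
      let lo := if p then Y else X
      let hi := if p then X else Y
      let C ← flatMapT (fun q => do
        let φ ← pathGuardT lo hi q.guard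
        match q.target with
        | .data d₁ =>
          if q.flip then pure [⟨φ, .sub hi lo d₁⟩] else pure [⟨φ, .sub lo hi d₁⟩]
        | .param i => do
          let Ci ← getT (if q.flip then Cs' else Cs) i
          guardByT φ (Ci.getD [])) paths
      let r ← unionT constrEqT C []
      pure r.1
    else stuck
  | _, _, _ => stuck
noncomputable def subsT (Δ : DataEnv) : Bool → List XTy → List XTy → Timed (List (List RC))
  | _, [], [] => do tick; pure []
  | p, t :: ts, t' :: ts' => do
    tick
    let C ← subT Δ p t t'
    let Cs ← subsT Δ p ts ts'
    pure (C :: Cs)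
  | _, _, _ => stuck
end

/-! ### Expressions and modules -/

mutual
/-- Inference for expressions: returns the inferred type, its constraints, saturated and restricted
to the context, and the next unused refinement variable. -/
noncomputable def inferT (Δ : DataEnv) (cstTy : ℕ → Ty Empty) (G : Array (Scheme (List RC))) :
    List XTy → Exp → ℕ → Timed (XTy × List RC × ℕ)
  | Γ, .cst c, n => do
    tick
    let T ← relabelT (fun l : Empty => l.elim) (cstTy c)
    let C ← closeT Γ T []
    pure (T, C, n)
  | Γ, .con d k Ts, n => do
    tick
    let Us ← lookupCtorT k (Δ.ctors d)
    let r ← freshsT Ts (n + 1)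
    let U ← ctorTyT Δ d Us
    let V ← injT n U
    let T ← substT r.1 V
    let C ← closeT Γ T [⟨[], .mem k n d⟩]
    pure (T, C, r.2)
  | Γ, .lvar i, n => do
    tick
    match ← getT Γ i with
    | some T => do
      let C ← closeT Γ T []
      pure (T, C, n)
    | none => stuck
  | Γ, .gvar x Ts, n => do
    tick
    match G[x]? with
    | some s => do
      let q ← lengthT s.qs
      let r ← freshsT Ts (n + q)
      let V ← relabelT (renameT n s.qs) s.ty
      let T ← substT r.1 V
      let C₀ ← mapT (renameConstrT (renameT n s.qs)) s.cs
      let C ← closeT Γ T C₀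
      pure (T, C, r.2)
    | none => stuck
  | Γ, .app e₁ e₂, n => do
    tick
    let r₁ ← inferT Δ cstTy G Γ e₁ n
    let r₂ ← inferT Δ cstTy G Γ e₂ r₁.2.2
    match r₁.1 with
    | .arr T₁ T₂ => do
      let C₃ ← subT Δ false r₂.1 T₁
      let u ← unionT constrEqT r₁.2.1 r₂.2.1
      let u' ← unionT constrEqT C₃ u.1
      let C ← closeT Γ T₂ u'.1
      pure (T₂, C, r₂.2.2)
    | _ => stuck
  | Γ, .lam T₁ e, n => do
    tick
    let f ← freshT T₁ n
    let r ← inferT Δ cstTy G (f.1 :: Γ) e f.2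
    let C ← closeT Γ (.arr f.1 r.1) r.2.1
    pure (.arr f.1 r.1, C, r.2.2)
  | Γ, .case e T bs, n => do
    tick
    let r ← inferT Δ cstTy G Γ e n
    match r.1 with
    | .data X d Ts => do
      let f ← freshT T r.2.2
      let b ← inferBranchesT Δ cstTy G Γ X d Ts f.1 bs f.2
      let u ← unionT constrEqT r.2.1 b.1
      let u' ← insertT constrEqT ⟨[], .subset X d b.2.1⟩ u.1
      let C ← closeT Γ f.1 u'.1
      pure (f.1, C, b.2.2)
    | _ => stuck
/-- Inference for the branches of a match: returns the constraints that they contribute, the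
constructors that are handled, and the next unused refinement variable. -/
noncomputable def inferBranchesT (Δ : DataEnv) (cstTy : ℕ → Ty Empty) (G : Array (Scheme (List RC))) :
    List XTy → ℕ → ℕ → List XTy → XTy → Branches → ℕ → Timed (List RC × List ℕ × ℕ)
  | _, _, _, _, _, .nil, n => do tick; pure ([], [], n)
  | Γ, X, d, Ts, T, .cons k e bs, n => do
    tick
    let Us ← lookupCtorT k (Δ.ctors d)
    let As ← mapT (fun U => do
      let V ← injT X U
      substT Ts V) Us
    let Γ' ← appendT As Γ
    let r ← inferT Δ cstTy G Γ' e n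
    let C' ← subT Δ false r.1 T
    let u ← unionT constrEqT r.2.1 C'
    let C ← guardByT [⟨k, X, d⟩] u.1
    let b ← inferBranchesT Δ cstTy G Γ X d Ts T bs r.2.2
    let v ← unionT constrEqT C b.1
    let ks ← insertT eqW k b.2.1
    pure (v.1, ks.1, b.2.2)
end

/-- Inference for modules: extends the table `G` by the schemes of the definitions. -/
noncomputable def inferModT (Δ : DataEnv) (cstTy : ℕ → Ty Empty) :
    Array (Scheme (List RC)) → List Defn → ℕ → Timed (Array (Scheme (List RC)))
  | G, [], _ => do tick; pure G
  | G, f :: m, n => do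
    tick
    let t ← freshT f.ty n
    let r ← inferT Δ cstTy G [t.1] f.body t.2
    let C₂ ← subT Δ false r.1 t.1
    let u ← unionT constrEqT r.2.1 C₂
    let S ← saturateT u.1
    let X ← frvT t.1
    let C ← restrictT S X
    inferModT Δ cstTy (G.push ⟨f.nty, X, C, t.1⟩) m r.2.2

/-! ## The initial environment -/

/-- The pair `X(d)` is meaningful in the context of `T`: `d` is in the slice of a datatype that
occurs in `T` with label `X`. -/
def Owns (Δ : DataEnv) (T : XTy) (X d : ℕ) : Prop := ∃ d₀, (X, d₀) ∈ T.labels ∧ InSlice Δ d₀ d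

/-- Well-formed bodies over the refinement variables of `T`. -/
def Body.Wf (Δ : DataEnv) (T : XTy) : Body (List ℕ) → Prop
  | .sub X Y d => Owns Δ T X d ∧ Owns Δ T Y d
  | .subset X d ks => Owns Δ T X d ∧ ks.Nodup ∧ ∀ k ∈ ks, Δ.IsCtor k d
  | .mem k X d => Owns Δ T X d ∧ Δ.IsCtor k d
  | .bot => True

/-- Well-formed closed constrained type schemes: the underlying type is well-formed, the quantified
refinement variables are those of the type, and the constraints form a set (stored without
repetitions) of well-formed atomic constraints over these variables. -/
def Scheme.Wf (Δ : DataEnv) (s : Scheme (List RC)) : Prop :=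
  s.ty.Wf Δ s.nty ∧ s.qs.Nodup ∧ (∀ X, X ∈ s.qs ↔ X ∈ s.ty.frv) ∧
  (s.cs.map Constr.abs).Nodup ∧
  ∀ c ∈ s.cs, c.guard.Nodup ∧ (∀ a ∈ c.guard, Owns Δ s.ty a.X a.d ∧ Δ.IsCtor a.k a.d) ∧
    c.body.Wf Δ s.ty

end Refinement

open Refinement

-- Inference treats a module one definition at a time, so it is enough that every definition costs
-- at most a constant. A definition sees the rest of the module only through the schemes of the
-- names that it mentions. By restriction, a scheme carries constraints over the refinement
-- variables of its own type only. That type has at most `Q` labels, each label meets the boundedly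
-- many datatypes of one slice, and each of these has at most `K` constructors. So there are
-- boundedly many atoms, guards and bodies, and a scheme stored without repetitions has bounded
-- length wherever it stands in the module (`exists_cset_bound`). Each new scheme satisfies the same
-- invariant (`defn_cost`), and an access to the table costs one step; the number of definitions
-- therefore enters only as a factor.
--
-- Inside one definition no careful estimate is needed. Each operation turns bounded input into
-- bounded output in bounded time, with a bound that depends only on the input bound. Composing
-- these along an expression of size at most `S` gives a constant (`exists_inferBound`). Two
-- operations are fixed point iterations, for which this has to be argued.
--
-- Saturation: the three rules recombine the pairs `X(d)`, constructors and constructor sets of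
-- their premises and create no new ones. Iteration stays in a finite universe whose cardinality is
-- bounded in terms of the size of the input, and every round but the last adds an element
-- (`closureT_cost`, `saturateT_cost`).
--
-- Subtyping: the datatype rule may unfold definitions for ever. While it does, the two sides carry
-- the same two labels `X` and `Y`, and only the type arguments bring in others. A derivation is
-- thus described by a path, consisting of its guard atoms (each with a bit choosing between `X` and
-- `Y`), its polarity and its end, and a slice has finitely many paths up to equality of guards as
-- sets. `subGen_data_iff` says that paths describe exactly the generated constraints: soundness is
-- induction on paths, completeness induction on the height of derivations. `summaryT_cost` computes
-- the paths.
--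
-- Time, size and correctness are proved together with the predicate `Cost`, since each time bound
-- needs the size bound of the intermediate results.

namespace Refinement

/-! ## A cost-aware program logic -/

/-- The computation `x` always succeeds, takes at most `b` steps and returns a result in `P`. -/
def Cost {α : Type} (x : Timed α) (b : ℕ) (P : α → Prop) : Prop :=
  ∀ t, ∃ a t', x t = some (a, t') ∧ t' ≤ t + b ∧ P a

namespace Cost

variable {α β : Type} {x : Timed α} {b b' : ℕ} {P P' : α → Prop}

theorem mono (h : Cost x b P) (hb : b ≤ b') : Cost x b' P := fun t => by
  obtain ⟨a, t', h1, h2, h3⟩ := h t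
  exact ⟨a, t', h1, by omega, h3⟩

theorem imp (h : Cost x b P) (hP : ∀ a, P a → P' a) : Cost x b P' := fun t => by
  obtain ⟨a, t', h1, h2, h3⟩ := h t
  exact ⟨a, t', h1, h2, hP _ h3⟩

theorem pure {a : α} (h : P a) : Cost (pure a) b P := fun t => ⟨a, t, rfl, by omega, h⟩

theorem bind {f : α → Timed β} {R : β → Prop} (hx : Cost x b P)
    (hf : ∀ a, P a → Cost (f a) b' R) : Cost (x >>= f) (b + b') R := fun t => by
  obtain ⟨a, t', h1, h2, h3⟩ := hx t
  obtain ⟨c, t'', h4, h5, h6⟩ := hf a h3 t'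
  refine ⟨c, t'', ?_, by omega, h6⟩
  show (x t).bind (fun p => f p.1 p.2) = _
  rw [h1]; exact h4

theorem step {f : Unit → Timed α} (h : Cost (f ()) b P) : Cost (tick >>= f) (b + 1) P := fun t => by
  obtain ⟨c, t'', h4, h5, h6⟩ := h (t + 1)
  exact ⟨c, t'', h4, by omega, h6⟩

end Cost

/-! ### Lists -/

theorem eqW_cost {α : Type} [DecidableEq α] (x y : α) :
    Cost (eqW x y) 1 (fun r => r = true ↔ x = y) :=
  Cost.step (Cost.pure (by simp))

-- Membership, insertion and union in lists that represent sets up to a key.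

section Keyed

variable {α κ : Type} {eq : α → α → Timed Bool} {key : α → κ} {ce : ℕ}

/-- The equality test is only required to work on the elements that are really compared, because for
constraints and paths its cost is bounded only when the lists inside them are short. The `key` is
the abstract object that an element represents. -/
theorem memT_cost {x : α} : ∀ {ys : List α},
    (∀ y ∈ ys, Cost (eq x y) ce (fun r => r = true ↔ key x = key y)) →
    Cost (memT eq x ys) ((ce + 1) * ys.length + 1) (fun r => r = true ↔ key x ∈ ys.map key)
  | [], _ => by
    exact Cost.step (Cost.pure (by simp))
  | y :: ys, h => by
    refine (Cost.step (Cost.bind (h y (by simp)) (b' := (ce + 1) * ys.length + 1)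
      fun r hr => ?_)).mono ?_
    · cases r with
      | true => exact Cost.pure (by simp at hr; simp [hr])
      | false =>
        refine (memT_cost (fun z hz => h z (by simp [hz]))).imp fun r' hr' => ?_
        simp at hr
        simp only [List.map_cons, List.mem_cons, hr, false_or]
        exact hr'
    · simp only [List.length_cons, Nat.mul_add]; omega

theorem insertT_cost {x : α} {ys : List α}
    (h : ∀ y ∈ ys, Cost (eq x y) ce (fun r => r = true ↔ key x = key y)) :
    Cost (insertT eq x ys) ((ce + 1) * ys.length + 2) (fun r =>
      (r = (ys, false) ∧ key x ∈ ys.map key) ∨ (r = (x :: ys, true) ∧ key x ∉ ys.map key)) := by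
  refine (Cost.step (Cost.bind (memT_cost h) (b' := 0) fun r hr => ?_)).mono (by omega)
  cases r with
  | true => exact Cost.pure (by simp at hr; simp [hr])
  | false => exact Cost.pure (Or.inr ⟨rfl, fun h => by simpa using hr.2 h⟩)

/-- `r` is the result of inserting `xs` into `ys`, up to the equivalence of elements by `key`. -/
structure IsUnion [DecidableEq κ] (key : α → κ) (xs ys : List α) (r : List α × Bool) : Prop where
  mem_of : ∀ z ∈ r.1, z ∈ xs ∨ z ∈ ys
  right : ∀ y ∈ ys, y ∈ r.1
  left : ∀ x ∈ xs, key x ∈ r.1.map key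
  length_le : r.1.length ≤ xs.length + ys.length
  nodup : (ys.map key).Nodup → (r.1.map key).Nodup
  card : r.1.length + (ys.map key).toFinset.card = ys.length + (r.1.map key).toFinset.card
  unchanged : r.2 = false → r.1 = ys
  changed : r.2 = true → (ys.map key).toFinset.card < (r.1.map key).toFinset.card

/-- An element is added exactly when its key is new, so length and number of distinct keys grow
together. This is the field `card`; it bounds the length of the union even if `ys` itself contains
repetitions, which the input of a fixed point iteration may do. -/
theorem unionT_cost [DecidableEq κ] {ys : List α} : ∀ {xs : List α},
    (∀ x ∈ xs, ∀ y, y ∈ xs ∨ y ∈ ys → Cost (eq x y) ce (fun r => r = true ↔ key x = key y)) →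
    Cost (unionT eq xs ys) (((ce + 1) * (xs.length + ys.length) + 3) * xs.length + 1)
      (IsUnion key xs ys)
  | [], _ => by
    refine Cost.step (Cost.pure ?_)
    constructor <;> simp
  | x :: xs, h => by
    have ih := unionT_cost (xs := xs) (ys := ys) 
      (fun z hz y hy => h z (by simp [hz]) y (by rcases hy with hy | hy <;> simp [hy]))
    refine (Cost.step (Cost.bind ih (b' := (ce + 1) * (xs.length + ys.length) + 2)
      fun r hr => Cost.bind (b' := 0) ((insertT_cost (key := key) (ce := ce) ?_).mono
        (b' := (ce + 1) * (xs.length + ys.length) + 2) ?_)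
        fun r' hr' => Cost.pure ?_)).mono ?_
    · intro y hy
      exact h x (by simp) y (by rcases hr.mem_of y hy with h | h <;> simp [h])
    · have := Nat.mul_le_mul_left (ce + 1) hr.length_le
      omega
    · rcases hr' with ⟨rfl, h'⟩ | ⟨rfl, h'⟩
      · refine ⟨fun z hz => ?_, hr.right, fun z hz => ?_, ?_, hr.nodup, hr.card, ?_, ?_⟩
        · rcases hr.mem_of z hz with h | h <;> simp [h]
        · rcases List.mem_cons.1 hz with rfl | hz
          · exact h'
          · exact hr.left z hz
        · have := hr.length_le; simp only [List.length_cons]; omega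
        · simpa using hr.unchanged
        · simpa using hr.changed
      · have hc : (List.map key (x :: r.1)).toFinset.card
            = (List.map key r.1).toFinset.card + 1 := by
          rw [List.map_cons, List.toFinset_cons, Finset.card_insert_of_notMem (by simpa using h')]
        refine ⟨fun z hz => ?_, fun y hy => by simp [hr.right y hy], fun z hz => ?_, ?_,
          fun hn => ?_, ?_, by simp, fun _ => ?_⟩
        · rcases List.mem_cons.1 hz with rfl | hz
          · simp
          · rcases hr.mem_of z hz with h | h <;> simp [h]
        · rcases List.mem_cons.1 hz with rfl | hz
          · simp
          · simp only [List.map_cons, List.mem_cons]; exact Or.inr (hr.left z hz)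
        · have := hr.length_le; simp only [List.length_cons]; omega
        · simp only [List.map_cons, List.nodup_cons]; exact ⟨h', hr.nodup hn⟩
        · have := hr.card; simp only [List.length_cons] at *; omega
        · have h1 := hr.card
          have h2 : ys.length ≤ r.1.length := by
            cases hb : r.2 with
            | false => rw [hr.unchanged hb]
            | true => have := hr.changed hb; omega
          simp only at *
          omega
    · simp only [List.length_cons, Nat.mul_add, Nat.add_mul]; omega

end Keyed

-- Traversals of lists, and finite sets of words.

section Lists

variable {α β : Type}

theorem appendT_cost : ∀ {xs ys : List α},
    Cost (appendT xs ys) (xs.length + 1) (fun zs => zs = xs ++ ys)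
  | [], _ => Cost.step (Cost.pure rfl)
  | x :: xs, ys => by
    refine (Cost.step (Cost.bind (b' := 0) (appendT_cost (xs := xs) (ys := ys))
      fun r hr => Cost.pure ?_)).mono (by simp)
    simp [hr]

theorem mapT_cost {f : α → Timed β} {c : ℕ} {R : α → β → Prop} : ∀ {xs : List α},
    (∀ x ∈ xs, Cost (f x) c (R x)) →
    Cost (mapT f xs) ((c + 1) * xs.length + 1) (fun ys => List.Forall₂ R xs ys)
  | [], _ => Cost.step (Cost.pure List.Forall₂.nil)
  | x :: xs, h => by
    refine (Cost.step (Cost.bind (h x (by simp)) fun y hy => Cost.bind (b' := 0)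
      (mapT_cost (xs := xs) (R := R) fun z hz => h z (by simp [hz]))
      fun ys hys => Cost.pure (List.Forall₂.cons hy hys))).mono ?_
    simp only [List.length_cons, Nat.mul_add]; omega

theorem forall₂_left {R : α → β → Prop} {xs : List α} {ys : List β} (h : List.Forall₂ R xs ys) :
    ∀ x ∈ xs, ∃ y ∈ ys, R x y := by
  induction h with
  | nil => simp
  | cons h _ ih =>
    refine List.forall_mem_cons.2 ⟨⟨_, List.mem_cons_self, h⟩, fun x hx => ?_⟩
    obtain ⟨y, hy, h'⟩ := ih x hx
    exact ⟨y, List.mem_cons_of_mem _ hy, h'⟩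

theorem forall₂_right {R : α → β → Prop} {xs : List α} {ys : List β} (h : List.Forall₂ R xs ys) :
    ∀ y ∈ ys, ∃ x ∈ xs, R x y := forall₂_left (R := fun y x => R x y) h.flip

theorem forall₂_eq_map {g : α → β} {xs : List α} {ys : List β}
    (h : List.Forall₂ (fun x y => y = g x) xs ys) : ys = xs.map g := by
  induction h with
  | nil => rfl
  | cons h _ ih => simp [h, ih]

theorem mapT_cost_eq {f : α → Timed β} {c : ℕ} {g : α → β} {xs : List α}
    (h : ∀ x ∈ xs, Cost (f x) c (fun y => y = g x)) :
    Cost (mapT f xs) ((c + 1) * xs.length + 1) (fun ys => ys = xs.map g) :=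
  (mapT_cost h).imp fun _ => forall₂_eq_map

/-- `zs` is the concatenation of lists that are `R`-related to the elements of `xs`. -/
def IsFlatMap (R : α → List β → Prop) (xs : List α) (zs : List β) : Prop :=
  (∀ z ∈ zs, ∃ x ∈ xs, ∃ ys, R x ys ∧ z ∈ ys) ∧ ∀ x ∈ xs, ∃ ys, R x ys ∧ ∀ y ∈ ys, y ∈ zs

theorem flatMapT_cost {f : α → Timed (List β)} {c l : ℕ} {R : α → List β → Prop} :
    ∀ {xs : List α}, (∀ x ∈ xs, Cost (f x) c (fun ys => ys.length ≤ l ∧ R x ys)) →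
    Cost (flatMapT f xs) ((c + l + 2) * xs.length + 1)
      (fun zs => zs.length ≤ l * xs.length ∧ IsFlatMap R xs zs)
  | [], _ => Cost.step (Cost.pure (by simp [IsFlatMap]))
  | x :: xs, h => by
    refine (Cost.step (Cost.bind (h x (by simp)) fun y hy => Cost.bind (b' := l + 1)
      (flatMapT_cost (xs := xs) (R := R) fun z hz => h z (by simp [hz]))
      fun ys hys => ((appendT_cost).imp fun zs hzs => ?_).mono (by omega))).mono ?_
    · subst hzs
      refine ⟨?_, fun z hz => ?_, fun z hz => ?_⟩
      · simp only [List.length_append, List.length_cons, Nat.mul_add]; omega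
      · rcases List.mem_append.1 hz with hz | hz
        · exact ⟨x, by simp, y, hy.2, hz⟩
        · obtain ⟨w, hw, h'⟩ := hys.2.1 z hz
          exact ⟨w, by simp [hw], h'⟩
      · rcases List.mem_cons.1 hz with rfl | hz
        · exact ⟨y, hy.2, fun w hw => by simp [hw]⟩
        · obtain ⟨w, hw, h'⟩ := hys.2.2 z hz
          exact ⟨w, hw, fun v hv => by simp [h' v hv]⟩
    · simp only [List.length_cons, Nat.mul_add]; omega

/-- The list `ys` represents the set `S` by elements in `J`. -/
def Rep {γ : Type} (abs : α → γ) (J : α → Prop) (ys : List α) (S : γ → Prop) : Prop :=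
  (∀ y ∈ ys, J y) ∧ ∀ c, (∃ y ∈ ys, c = abs y) ↔ S c

/-- Representations compose under union over a list. Cost and length are stated with a bound `m` for
the list, so that nested traversals get constants independent of the data. -/
theorem flatMapT_rep {γ : Type} {abs : β → γ} {J : β → Prop} {S : α → γ → Prop}
    {f : α → Timed (List β)} {c l m : ℕ} {xs : List α} (hm : xs.length ≤ m)
    (h : ∀ x ∈ xs, Cost (f x) c (fun ys => ys.length ≤ l ∧ Rep abs J ys (S x))) :
    Cost (flatMapT f xs) ((c + l + 2) * m + 1)
      (fun zs => zs.length ≤ l * m ∧ Rep abs J zs fun d => ∃ x ∈ xs, S x d) := by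
  refine ((flatMapT_cost h).imp fun zs hzs => ⟨hzs.1.trans (by gcongr), fun z hz => ?_,
    fun d => ⟨?_, ?_⟩⟩).mono (by gcongr)
  · obtain ⟨x, hx, ys, h1, h2⟩ := hzs.2.1 z hz
    exact h1.1 z h2
  · rintro ⟨z, hz, rfl⟩
    obtain ⟨x, hx, ys, h1, h2⟩ := hzs.2.1 z hz
    exact ⟨x, hx, (h1.2 _).1 ⟨z, h2, rfl⟩⟩
  · rintro ⟨x, hx, hd⟩
    obtain ⟨ys, h1, h2⟩ := hzs.2.2 x hx
    obtain ⟨y, hy, rfl⟩ := (h1.2 d).2 hd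
    exact ⟨y, h2 y hy, rfl⟩

theorem mapT_rep {γ : Type} {abs : β → γ} {J : β → Prop} {g : α → γ}
    {f : α → Timed β} {c m : ℕ} {xs : List α} (hm : xs.length ≤ m)
    (h : ∀ x ∈ xs, Cost (f x) c (fun y => J y ∧ abs y = g x)) :
    Cost (mapT f xs) ((c + 1) * m + 1)
      (fun ys => ys.length ≤ m ∧ Rep abs J ys fun d => ∃ x ∈ xs, d = g x) := by
  refine ((mapT_cost h).imp fun ys hys => ⟨hys.length_eq ▸ hm, fun y hy => ?_,
    fun d => ⟨?_, ?_⟩⟩).mono (by gcongr)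
  · obtain ⟨x, hx, h'⟩ := forall₂_right hys y hy
    exact h'.1
  · rintro ⟨y, hy, rfl⟩
    obtain ⟨x, hx, h'⟩ := forall₂_right hys y hy
    exact ⟨x, hx, h'.2⟩
  · rintro ⟨x, hx, rfl⟩
    obtain ⟨y, hy, h'⟩ := forall₂_left hys x hx
    exact ⟨y, hy, h'.2.symm⟩

theorem flatMapT_cost_eq {f : α → Timed (List β)} {c l : ℕ} {g : α → List β} :
    ∀ {xs : List α}, (∀ x ∈ xs, Cost (f x) c (fun ys => ys = g x)) →
    (∀ x ∈ xs, (g x).length ≤ l) →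
    Cost (flatMapT f xs) ((c + l + 2) * xs.length + 1) (fun zs => zs = xs.flatMap g)
  | [], _, _ => Cost.step (Cost.pure (by simp))
  | x :: xs, h, hl => by
    refine (Cost.step (Cost.bind (h x (by simp)) fun y hy => Cost.bind (b' := l + 1)
      (flatMapT_cost_eq (xs := xs) (fun z hz => h z (by simp [hz]))
        fun z hz => hl z (by simp [hz]))
      fun ys hys => ((appendT_cost).imp fun zs hzs => ?_).mono ?_)).mono ?_
    · simp [hzs, hy, hys]
    · have := hl x (by simp); simp only [hy]; omega
    · simp only [List.length_cons, Nat.mul_add]; omega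

theorem filterT_cost {p : α → Timed Bool} {c : ℕ} {q : α → Prop} [DecidablePred q] :
    ∀ {xs : List α}, (∀ x ∈ xs, Cost (p x) c (fun r => r = true ↔ q x)) →
    Cost (filterT p xs) ((c + 1) * xs.length + 1) (fun ys => ys = xs.filter q)
  | [], _ => Cost.step (Cost.pure (by simp))
  | x :: xs, h => by
    refine (Cost.step (Cost.bind (h x (by simp)) fun y hy => Cost.bind (b' := 0)
      (filterT_cost (xs := xs) (q := q) fun z hz => h z (by simp [hz]))
      fun ys hys => ?_)).mono ?_
    · cases y with
      | true => exact Cost.pure (by simp at hy; simp [hy, hys])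
      | false => exact Cost.pure (by simp at hy; simp [hy, hys])
    · simp only [List.length_cons, Nat.mul_add]; omega

theorem allT_cost {p : α → Timed Bool} {c : ℕ} {q : α → Prop} :
    ∀ {xs : List α}, (∀ x ∈ xs, Cost (p x) c (fun r => r = true ↔ q x)) →
    Cost (allT p xs) ((c + 1) * xs.length + 1) (fun r => r = true ↔ ∀ x ∈ xs, q x)
  | [], _ => Cost.step (Cost.pure (by simp))
  | x :: xs, h => by
    refine (Cost.step (Cost.bind (h x (by simp)) (b' := (c + 1) * xs.length + 1)
      fun r hr => ?_)).mono ?_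
    · cases r with
      | false => exact Cost.pure (by simp at hr; simp [hr])
      | true =>
        refine (allT_cost (fun z hz => h z (by simp [hz]))).imp fun r' hr' => ?_
        rw [hr', List.forall_mem_cons, and_iff_right (hr.1 rfl)]
    · simp only [List.length_cons, Nat.mul_add]; omega

theorem lengthT_cost : ∀ {xs : List α}, Cost (lengthT xs) (xs.length + 1) (fun n => n = xs.length)
  | [] => Cost.step (Cost.pure rfl)
  | x :: xs => by
    refine (Cost.step (Cost.bind (b' := 0) (lengthT_cost (xs := xs))
      fun r hr => Cost.pure ?_)).mono (by simp)
    simp [hr]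

theorem getT_cost : ∀ {xs : List α} {i : ℕ},
    Cost (getT xs i) (xs.length + 1) (fun r => r = xs[i]?)
  | [], _ => by unfold getT; exact Cost.step (Cost.pure (by simp))
  | x :: xs, 0 => by
    unfold getT; exact Cost.step (Cost.pure (by simp))
  | x :: xs, i + 1 => by
    unfold getT
    exact (Cost.step (getT_cost (xs := xs) (i := i))).imp (by simp)

theorem idxT_cost {x : ℕ} : ∀ {xs : List ℕ},
    Cost (idxT x xs) (xs.length + 1) (fun r => r = xs.idxOf x)
  | [] => Cost.step (Cost.pure (by simp))
  | y :: ys => by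
    refine (Cost.step (b := ys.length + 1) ?_).mono (by simp)
    by_cases h : x = y
    · simp only [h, if_true]; exact Cost.pure (by simp)
    · simp only [h, if_false]
      refine (Cost.bind (b' := 0) (idxT_cost (x := x) (xs := ys)) fun r hr => Cost.pure ?_)
      rw [List.idxOf_cons_ne _ (Ne.symm h), hr]

variable [DecidableEq α]

theorem memW_cost {x : α} {ys : List α} :
    Cost (memT eqW x ys) (2 * ys.length + 1) (fun r => r = true ↔ x ∈ ys) :=
  ((memT_cost (key := id) (ce := 1) fun y _ => eqW_cost x y)).imp fun r hr => by simpa using hr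

theorem insertW_cost {x : α} {ys : List α} :
    Cost (insertT eqW x ys) (2 * ys.length + 2) (fun r => r.1.toFinset = insert x ys.toFinset ∧
      (ys.Nodup → r.1.Nodup) ∧ (∀ z, z ∈ r.1 ↔ z = x ∨ z ∈ ys) ∧ r.1.length ≤ ys.length + 1) := by
  refine (insertT_cost (key := id) (ce := 1) fun y _ => eqW_cost x y).imp fun r hr => ?_
  simp only [id, List.map_id] at hr
  rcases hr with ⟨rfl, h⟩ | ⟨rfl, h⟩
  · refine ⟨by simp [h], by simp, fun z => ⟨Or.inr, ?_⟩, by simp⟩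
    rintro (rfl | h') <;> assumption
  · exact ⟨by simp, fun hn => by simp [h, hn], by simp, by simp⟩

theorem unionW_cost {xs ys : List α} :
    Cost (unionT eqW xs ys) ((2 * (xs.length + ys.length) + 3) * xs.length + 1)
      (fun r => r.1.toFinset = xs.toFinset ∪ ys.toFinset ∧ (ys.Nodup → r.1.Nodup) ∧
        (∀ z, z ∈ r.1 ↔ z ∈ xs ∨ z ∈ ys) ∧ r.1.length ≤ xs.length + ys.length) := by
  refine (unionT_cost (key := id) (ce := 1) fun x _ y _ => eqW_cost x y).imp fun r hr => ?_
  have h1 : ∀ z, z ∈ r.1 ↔ z ∈ xs ∨ z ∈ ys := fun z => by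
    refine ⟨hr.mem_of z, ?_⟩
    rintro (h | h)
    · simpa using hr.left z h
    · exact hr.right z h
  exact ⟨by ext z; simp [h1], by simpa using hr.nodup, h1, hr.length_le⟩

theorem subsetT_cost {xs ys : List α} :
    Cost (subsetT xs ys) ((2 * ys.length + 2) * xs.length + 2)
      (fun r => r = true ↔ xs.toFinset ⊆ ys.toFinset) := by
  refine ((Cost.step (allT_cost fun x _ => memW_cost))).imp fun r hr => ?_
  rw [hr]; simp [Finset.subset_iff]

theorem seteqT_cost {xs ys : List α} :
    Cost (seteqT xs ys) ((2 * ys.length + 2) * xs.length + (2 * xs.length + 2) * ys.length + 5)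
      (fun r => r = true ↔ xs.toFinset = ys.toFinset) := by
  refine (Cost.step (Cost.bind subsetT_cost (b' := (2 * xs.length + 2) * ys.length + 2)
      fun r hr => ?_)).mono (by omega)
  cases r with
  | true =>
    refine subsetT_cost.imp fun r' hr' => ?_
    rw [hr', Finset.Subset.antisymm_iff]; simp at hr; simp [hr]
  | false =>
    refine Cost.pure ?_
    simp at hr; simp only [Bool.false_eq_true, false_iff]; intro h; exact hr (by rw [h])

theorem removeT_cost {x : α} {xs : List α} :
    Cost (removeT x xs) (2 * xs.length + 2) (fun r => r.toFinset = xs.toFinset.erase x ∧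
      (xs.Nodup → r.Nodup) ∧ (∀ z ∈ r, z ∈ xs) ∧ r.length ≤ xs.length) := by
  refine ((Cost.step (filterT_cost (c := 1) (q := fun y => ¬ x = y) fun y _ => ?_))).imp
    fun r hr => ?_
  · refine (Cost.bind (b' := 0) (eqW_cost x y) fun r hr => Cost.pure ?_)
    rw [Bool.not_eq_true', ← Bool.not_eq_true, hr]
  · subst hr
    refine ⟨?_, fun h => h.filter _, fun z hz => (List.mem_filter.1 hz).1, List.length_filter_le _ _⟩
    ext z
    simp only [List.mem_toFinset, List.mem_filter, decide_eq_true_eq, Finset.mem_erase]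
    tauto

end Lists

/-! ### Fixed point iteration -/

section Closure

variable {α κ : Type} [DecidableEq κ] {eq : α → α → Timed Bool}
  {step : List α → Timed (List α)}

theorem closureN_succ {i : ℕ} {xs : List α} {t : ℕ} {r : List α × ℕ}
    (h : closureN eq step i xs t = some r) : closureN eq step (i + 1) xs t = some r := by
  induction i generalizing xs t with
  | zero => simp [closureN, stuck] at h
  | succ i ih =>
    have key : ∀ j, closureN eq step (j + 1) xs t =
        (step xs (t + 1)).bind fun p => (unionT eq p.1 xs p.2).bind fun q =>
          (if q.1.2 then closureN eq step j q.1.1 else Pure.pure q.1.1 : Timed (List α)) q.2 :=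
      fun j => rfl
    rw [key] at h ⊢
    cases hs : step xs (t + 1) with
    | none => simp [hs] at h
    | some p =>
      rw [hs] at h
      simp only [Option.bind_some] at h ⊢
      cases hu : unionT eq p.1 xs p.2 with
      | none => simp [hu] at h
      | some q =>
        rw [hu] at h
        simp only [Option.bind_some] at h ⊢
        cases hb : q.1.2 with
        | true => simp only [hb, if_true] at h ⊢; exact ih h
        | false => simpa [hb] using h

theorem closureN_le {i j : ℕ} (hij : i ≤ j) {xs : List α} {t : ℕ} {r : List α × ℕ}
    (h : closureN eq step i xs t = some r) : closureN eq step j xs t = some r := by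
  induction hij with
  | refl => exact h
  | step _ ih => exact closureN_succ ih

/-- More fuel never changes a successful outcome (`closureN_le`), so the run with the least
sufficient fuel, which defines `closureT`, agrees with any run that succeeds. -/
theorem closureT_of_closureN {i b : ℕ} {xs : List α} {P : List α → Prop}
    (h : Cost (closureN eq step i xs) b P) : Cost (closureT eq step xs) b P := fun t => by
  obtain ⟨a, t', h1, h2, h3⟩ := h t
  refine ⟨a, t', ?_, h2, h3⟩
  have hex : ∃ i, (closureN eq step i xs t).isSome := ⟨i, by simp [h1]⟩
  unfold closureT
  rw [dif_pos hex]
  have hf := Nat.find_spec hex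
  obtain ⟨r, hr⟩ := Option.isSome_iff_exists.1 hf
  have hle := Nat.find_min' hex (m := i) (by simp [h1])
  have := closureN_le hle hr
  rw [h1] at this
  cases this
  convert hr

/-- The elements of the fixed point satisfy the invariant `I`, and `StepRel` relates the fixed point
to a list all of whose elements belong to it. -/
structure IsClosure (key : α → κ) (I : α → Prop) (StepRel : List α → List α → Prop)
    (xs₀ xs : List α) : Prop where
  inv : ∀ x ∈ xs, I x
  init : ∀ x ∈ xs₀, x ∈ xs
  nodup : (xs₀.map key).Nodup → (xs.map key).Nodup
  closed : ∃ ys, StepRel xs ys ∧ ∀ y ∈ ys, key y ∈ xs.map key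

/-- Every round that does not stop adds a key of the finite universe `U`, so at most `M + 1` rounds
occur. The invariant `I` keeps all elements inside `U` and also makes their comparison cheap. The
list has at most `L + M` elements: `L` for the start, repetitions included, and one for each new
key. -/
theorem closureT_cost {key : α → κ} {I : α → Prop} {StepRel : List α → List α → Prop}
    {U : Finset κ} {M ce cs l L : ℕ} {xs₀ : List α} (hU : ∀ x, I x → key x ∈ U) (hM : U.card ≤ M)
    (heq : ∀ x y, I x → I y → Cost (eq x y) ce (fun r => r = true ↔ key x = key y))
    (hstep : ∀ xs, (∀ x ∈ xs, I x) → xs.length ≤ L + M →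
      Cost (step xs) cs (fun ys => StepRel xs ys ∧ ys.length ≤ l ∧ ∀ y ∈ ys, I y))
    (hI : ∀ x ∈ xs₀, I x) (hL : xs₀.length ≤ L) :
    Cost (closureT eq step xs₀) ((cs + (((ce + 1) * (l + (L + M)) + 3) * l + 1) + 1) * (M + 1))
      (fun xs => xs.length ≤ L + M ∧ IsClosure key I StepRel xs₀ xs) := by
  set R := cs + (((ce + 1) * (l + (L + M)) + 3) * l + 1) + 1
  have hcard : ∀ xs : List α, (∀ x ∈ xs, I x) → (xs.map key).toFinset.card ≤ M := fun xs hxs =>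
    (Finset.card_le_card fun k hk => by
      simp only [List.mem_toFinset, List.mem_map] at hk
      obtain ⟨x, hx, rfl⟩ := hk
      exact hU x (hxs x hx)).trans hM
  -- The fuel `i` exceeds the number of keys of `U` that can still be added. The equation between
  -- lengths and numbers of keys is the invariant that bounds the length of `xs`.
  suffices H : ∀ i xs, (∀ x ∈ xs, I x) → (∀ x ∈ xs₀, x ∈ xs) →
      ((xs₀.map key).Nodup → (xs.map key).Nodup) →
      xs.length + (xs₀.map key).toFinset.card = xs₀.length + (xs.map key).toFinset.card →
      M < i + (xs.map key).toFinset.card →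
      Cost (closureN eq step i xs) (R * i)
        (fun xs => xs.length ≤ L + M ∧ IsClosure key I StepRel xs₀ xs) from
    closureT_of_closureN (H (M + 1) xs₀ hI (fun _ h => h) id rfl (by omega))
  intro i
  induction i with
  | zero => intro xs h1 _ _ _ h5; have := hcard xs h1; omega
  | succ i ih =>
    intro xs h1 h2 h3 h4 h5
    have hlen : xs.length ≤ L + M := by have := hcard xs h1; omega
    unfold closureN
    refine (Cost.step (Cost.bind (hstep xs h1 hlen) fun ys hys => Cost.bind (b' := R * i)
      (((unionT_cost (key := key) (ce := ce) ?_)).mono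
        (b' := ((ce + 1) * (l + (L + M)) + 3) * l + 1) ?_) fun r hr => ?_)).mono ?_
    · rintro x hx y (hy | hy)
      · exact heq x y (hys.2.2 x hx) (hys.2.2 y hy)
      · exact heq x y (hys.2.2 x hx) (h1 y hy)
    · have h6 : ys.length ≤ l := hys.2.1
      gcongr
    · have hI' : ∀ x ∈ r.1, I x := fun x hx => by
        rcases hr.mem_of x hx with h | h
        · exact hys.2.2 x h
        · exact h1 x h
      cases hb : r.2 with
      | true =>
        have h7 := hr.changed hb
        have h8 := hr.card
        simp only [if_true]
        exact ih r.1 hI' (fun x hx => hr.right x (h2 x hx)) (fun h => hr.nodup (h3 h))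
          (by omega) (by omega)
      | false =>
        have h7 := hr.unchanged hb
        simp only [Bool.false_eq_true, if_false]
        refine Cost.pure ?_
        rw [h7]
        -- The union has returned `xs` itself, so the keys of `ys` were present already and `xs` is
        -- closed.
        refine ⟨hlen, h1, h2, h3, ys, hys.1, fun y hy => ?_⟩
        have := hr.left y hy
        rwa [h7] at this
    · simp only [R, Nat.mul_add]; omega

end Closure

/-! ## Types -/

namespace Ty

variable {L L' L'' : Type}

theorem ind {P : Ty L → Prop} (var : ∀ a, P (.var a)) (base : ∀ b, P (.base b))
    (data : ∀ l d ts, (∀ t ∈ ts, P t) → P (.data l d ts))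
    (arr : ∀ t u, P t → P u → P (.arr t u)) (t : Ty L) : P t :=
  Ty.rec (motive_1 := P) (motive_2 := fun ts => ∀ t ∈ ts, P t) var base data arr
    (by simp) (fun t ts h1 h2 => by simpa using ⟨h1, h2⟩) t

theorem relabels_eq (f : L → L') : ∀ ts : List (Ty L), relabels f ts = ts.map (relabel f)
  | [] => rfl
  | t :: ts => by rw [relabels, relabels_eq f ts]; rfl

theorem substs_eq (σ : List (Ty L)) : ∀ ts : List (Ty L), substs σ ts = ts.map (subst σ)
  | [] => rfl
  | t :: ts => by rw [substs, substs_eq σ ts]; rfl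

theorem labelss_eq : ∀ ts : List (Ty L), labelss ts = ts.flatMap labels
  | [] => rfl
  | t :: ts => by rw [labelss, labelss_eq ts]; rfl

theorem size_pos (t : Ty L) : 0 < t.size := by cases t <;> simp only [size] <;> omega

theorem size_le_sizes {t : Ty L} : ∀ {ts : List (Ty L)}, t ∈ ts → t.size ≤ sizes ts
  | u :: ts, h => by
    rcases List.mem_cons.1 h with rfl | h
    · simp only [sizes]; omega
    · have := size_le_sizes h; simp only [sizes]; omega

theorem length_le_sizes : ∀ ts : List (Ty L), ts.length ≤ sizes ts
  | [] => by simp [sizes]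
  | t :: ts => by
    have := length_le_sizes ts; have := t.size_pos; simp only [sizes, List.length_cons]; omega

theorem sizes_map_eq {f : Ty L → Ty L'} : ∀ {ts : List (Ty L)},
    (∀ t ∈ ts, (f t).size = t.size) → sizes (ts.map f) = sizes ts
  | [], _ => rfl
  | t :: ts, h => by
    simp only [List.map_cons, sizes, h t (by simp),
      sizes_map_eq (fun t ht => h t (by simp [ht]) : ∀ t ∈ ts, (f t).size = t.size)]

theorem size_relabel (f : L → L') (t : Ty L) : (t.relabel f).size = t.size := by
  induction t using ind with
  | var | base => rfl
  | data l d ts ih => simp only [relabel, size, relabels_eq, sizes_map_eq ih]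
  | arr t u h1 h2 => simp only [relabel, size, h1, h2]

theorem relabel_relabel (f : L → L') (g : L' → L'') (t : Ty L) :
    (t.relabel f).relabel g = t.relabel (g ∘ f) := by
  induction t using ind with
  | var | base => rfl
  | data l d ts ih => simpa [relabel, relabels_eq] using ih
  | arr t u h1 h2 => simp only [relabel, h1, h2]

theorem under_relabel (f : L → L') (t : Ty L) : (t.relabel f).under = t.under :=
  relabel_relabel _ _ t

theorem under_unit (t : UTy) : t.under = t := by
  unfold under
  induction t using ind with
  | var | base => rfl
  | data l d ts ih =>
    simp only [relabel, relabels_eq]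
    rw [List.map_congr_left ih]; simp
  | arr t u h1 h2 => simp only [relabel, h1, h2]

theorem under_inj (X : ℕ) (t : UTy) : (t.inj X).under = t :=
  (under_relabel _ t).trans (under_unit t)

theorem size_under (t : Ty L) : t.under.size = t.size := size_relabel _ t

theorem relabel_subst (f : L → L') (σ : List (Ty L)) (t : Ty L) :
    (t.subst σ).relabel f = (t.relabel f).subst (σ.map (relabel f)) := by
  induction t using ind with
  | var a => simp only [subst, relabel, List.getElem?_map]; cases σ[a]? <;> rfl
  | base => rfl
  | data l d ts ih => simpa [relabel, relabels_eq, subst, substs_eq] using ih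
  | arr t u h1 h2 => simp only [relabel, subst, h1, h2]

theorem under_subst (σ : List (Ty L)) (t : Ty L) :
    (t.subst σ).under = t.under.subst (σ.map under) := relabel_subst _ σ t

theorem sizes_map_le {M : ℕ} {f : Ty L → Ty L'} : ∀ {ts : List (Ty L)},
    (∀ t ∈ ts, (f t).size ≤ t.size * M) → sizes (ts.map f) ≤ sizes ts * M
  | [], _ => by simp [sizes]
  | t :: ts, h => by
    have h1 := sizes_map_le (fun t ht => h t (by simp [ht]) : ∀ t ∈ ts, (f t).size ≤ t.size * M)
    have h2 := h t (by simp)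
    simp only [List.map_cons, sizes, Nat.add_mul]; omega

/-- Each node either stays or is a variable replaced by a type of size at most `M`. The factor `M +
1` also covers variables that `σ` leaves alone and `M = 0`. -/
theorem size_subst_le {σ : List (Ty L)} {M : ℕ} (h : ∀ u ∈ σ, u.size ≤ M) (t : Ty L) :
    (t.subst σ).size ≤ t.size * (M + 1) := by
  induction t using ind with
  | var a =>
    simp only [subst, size]
    cases hu : σ[a]? with
    | none => simp [size]
    | some u => have := h u (List.mem_of_getElem? hu); simp; omega
  | base => simp [subst, size]
  | data l d ts ih =>
    have := sizes_map_le ih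
    simp only [subst, size, substs_eq, Nat.add_mul] at *; omega
  | arr t u h1 h2 => simp only [subst, size, Nat.add_mul] at *; omega

theorem labels_relabel (f : L → L') (t : Ty L) :
    (t.relabel f).labels = t.labels.map fun p => (f p.1, p.2) := by
  induction t using ind with
  | var | base => rfl
  | data l d ts ih =>
    simp only [relabel, labels, labelss_eq, relabels_eq, List.map_cons, List.flatMap_map,
      List.map_flatMap]
    congr 1
    exact List.flatMap_congr ih
  | arr t u h1 h2 => simp only [relabel, labels, h1, h2, List.map_append]

theorem mem_labels_subst {σ : List (Ty L)} {t : Ty L} {p : L × ℕ} (h : p ∈ (t.subst σ).labels) :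
    p ∈ t.labels ∨ ∃ u ∈ σ, p ∈ u.labels := by
  induction t using ind with
  | var a =>
    simp only [subst] at h
    cases hu : σ[a]? with
    | none => simp [hu, labels] at h
    | some u => exact Or.inr ⟨u, List.mem_of_getElem? hu, by simpa [hu] using h⟩
  | base => simp [subst, labels] at h
  | data l d ts ih =>
    simp only [subst, labels, labelss_eq, substs_eq, List.mem_cons, List.mem_flatMap,
      List.mem_map] at h ⊢
    rcases h with h | ⟨_, ⟨t, ht, rfl⟩, h⟩
    · exact Or.inl (Or.inl h)
    · rcases ih t ht h with h | h
      · exact Or.inl (Or.inr ⟨t, ht, h⟩)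
      · exact Or.inr h
  | arr t u h1 h2 =>
    simp only [subst, labels, List.mem_append] at h ⊢
    rcases h with h | h
    · rcases h1 h with h | h <;> simp [h]
    · rcases h2 h with h | h <;> simp [h]

theorem mem_labels_inj {X : ℕ} {t : UTy} {p : ℕ × ℕ} :
    p ∈ (t.inj X).labels ↔ p.1 = X ∧ ((), p.2) ∈ t.labels := by
  rw [inj, labels_relabel, List.mem_map]
  constructor
  · rintro ⟨q, h, rfl⟩; exact ⟨rfl, h⟩
  · rintro ⟨h1, h2⟩; exact ⟨_, h2, by rw [← h1]⟩

theorem length_labels_le (t : Ty L) : t.labels.length ≤ t.size := by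
  induction t using ind with
  | var | base => simp [labels, size]
  | data l d ts ih =>
    simp only [labels, size, labelss_eq, List.length_cons]
    suffices (ts.flatMap labels).length ≤ sizes ts by omega
    clear l d
    induction ts with
    | nil => simp [sizes]
    | cons t ts ih' =>
      have h1 := ih t (by simp)
      have h2 := ih' fun u hu => ih u (by simp [hu])
      simp only [List.flatMap_cons, List.length_append, sizes]; omega
  | arr t u h1 h2 => simp only [labels, size, List.length_append]; omega

theorem mem_frv {t : XTy} {X : ℕ} : X ∈ t.frv ↔ ∃ d, (X, d) ∈ t.labels := by
  simp [frv]

theorem length_frv_le (t : XTy) : t.frv.length ≤ t.size := by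
  simpa [frv] using t.length_labels_le

theorem wfs_iff {Δ : DataEnv} {n : ℕ} : ∀ {ts : List (Ty L)}, Wfs Δ n ts ↔ ∀ t ∈ ts, t.Wf Δ n
  | [] => by simp [Wfs]
  | t :: ts => by simp [Wfs, wfs_iff (ts := ts)]

theorem wf_relabel {Δ : DataEnv} {n : ℕ} (f : L → L') (t : Ty L) :
    (t.relabel f).Wf Δ n ↔ t.Wf Δ n := by
  induction t using ind with
  | var | base => rfl
  | data l d ts ih =>
    simp only [relabel, Wf, relabels_eq, List.length_map, wfs_iff, List.forall_mem_map]
    constructor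
    · rintro ⟨h1, h2, h3⟩; exact ⟨h1, h2, fun t ht => (ih t ht).1 (h3 t ht)⟩
    · rintro ⟨h1, h2, h3⟩; exact ⟨h1, h2, fun t ht => (ih t ht).2 (h3 t ht)⟩
  | arr t u h1 h2 => simp only [relabel, Wf, h1, h2]

/-- Freshly labelled types take their labels, all distinct, from an interval. -/
theorem freshs_spec : ∀ (ts : List UTy),
    (∀ t ∈ ts, ∀ n, (t.fresh n).1.under = t ∧ n ≤ (t.fresh n).2 ∧ (t.fresh n).1.frv.Nodup ∧
      ∀ X ∈ (t.fresh n).1.frv, n ≤ X ∧ X < (t.fresh n).2) → ∀ n,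
    (freshs ts n).1.map under = ts ∧ n ≤ (freshs ts n).2 ∧
      ((freshs ts n).1.flatMap frv).Nodup ∧
      ∀ X ∈ (freshs ts n).1.flatMap frv, n ≤ X ∧ X < (freshs ts n).2
  | [], _, n => by simp [freshs]
  | t :: ts, h, n => by
    obtain ⟨h1, h2, h3, h4⟩ := h t (by simp) n
    obtain ⟨h5, h6, h7, h8⟩ := freshs_spec ts (fun t ht => h t (by simp [ht])) (t.fresh n).2
    simp only [freshs, List.map_cons, h1, h5, List.flatMap_cons, List.nodup_append, h3, h7,
      List.mem_append, true_and]
    refine ⟨by omega, fun X hX Y hY => ?_, fun X hX => ?_⟩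
    · have := h4 X hX; have := h8 Y hY; omega
    · rcases hX with hX | hX
      · have := h4 X hX; omega
      · have := h8 X hX; omega

theorem fresh_spec (t : UTy) : ∀ n, (t.fresh n).1.under = t ∧ n ≤ (t.fresh n).2 ∧
    (t.fresh n).1.frv.Nodup ∧ ∀ X ∈ (t.fresh n).1.frv, n ≤ X ∧ X < (t.fresh n).2 := by
  induction t using ind with
  | var | base => intro n; simp [fresh, under, relabel, frv, labels]
  | data l d ts ih =>
    intro n
    obtain ⟨h1, h2, h3, h4⟩ := freshs_spec ts ih (n + 1)
    have e : (fresh (.data l d ts) n).1.frv = n :: (freshs ts (n + 1)).1.flatMap frv := by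
      simp only [fresh, frv, labels, labelss_eq, List.map_cons, List.map_flatMap]
      rfl
    rw [e]
    simp only [fresh, under, relabel, relabels_eq]
    refine ⟨?_, by omega, ?_, fun X hX => ?_⟩
    · exact congrArg (Ty.data () d) h1
    · rw [List.nodup_cons]; exact ⟨fun h => by have := h4 _ h; omega, h3⟩
    · rcases List.mem_cons.1 hX with rfl | hX
      · omega
      · have := h4 X hX; omega
  | arr t u ih1 ih2 =>
    intro n
    obtain ⟨h1, h2, h3, h4⟩ := ih1 n
    obtain ⟨h5, h6, h7, h8⟩ := ih2 (t.fresh n).2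
    have e : (fresh (.arr t u) n).1.frv = (t.fresh n).1.frv ++ (u.fresh (t.fresh n).2).1.frv := by
      simp only [fresh, frv, labels, List.map_append]
    rw [e]
    simp only [under] at h1 h5
    simp only [fresh, under, relabel, h1, h5, List.nodup_append, h3, h7, List.mem_append, true_and]
    refine ⟨by omega, fun X hX Y hY => ?_, fun X hX => ?_⟩
    · have := h4 X hX; have := h8 Y hY; omega
    · rcases hX with hX | hX
      · have := h4 X hX; omega
      · have := h8 X hX; omega

theorem freshs_spec' (ts : List UTy) (n : ℕ) : (freshs ts n).1.map under = ts ∧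
    n ≤ (freshs ts n).2 ∧ ∀ t ∈ (freshs ts n).1, ∀ p ∈ t.labels, n ≤ p.1 := by
  obtain ⟨h1, h2, _, h4⟩ := freshs_spec ts (fun t _ => fresh_spec t) n
  refine ⟨h1, h2, fun t ht p hp => (h4 p.1 ?_).1⟩
  exact List.mem_flatMap.2 ⟨t, ht, List.mem_map.2 ⟨p, hp, rfl⟩⟩

theorem size_fresh (t : UTy) (n : ℕ) : (t.fresh n).1.size = t.size := by
  rw [← size_under, (fresh_spec t n).1]

theorem sizes_freshs (ts : List UTy) (n : ℕ) : sizes (freshs ts n).1 = sizes ts := by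
  conv_rhs => rw [← (freshs_spec' ts n).1]
  exact (sizes_map_eq fun t _ => size_under t).symm

theorem length_freshs (ts : List UTy) (n : ℕ) : (freshs ts n).1.length = ts.length := by
  conv_rhs => rw [← (freshs_spec' ts n).1]
  simp

end Ty

/-! ### Costs of operations on types -/

section

variable {L L' : Type}

theorem relabelsT_eq (f : L → Timed L') : ∀ ts : List (Ty L),
    relabelsT f ts = mapT (relabelT f) ts
  | [] => rfl
  | t :: ts => by rw [relabelsT, relabelsT_eq f ts]; rfl

theorem substsT_eq (σ : List (Ty L)) : ∀ ts : List (Ty L), substsT σ ts = mapT (substT σ) ts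
  | [] => rfl
  | t :: ts => by rw [substsT, substsT_eq σ ts]; rfl

theorem labelssT_eq : ∀ ts : List (Ty L), labelssT ts = flatMapT labelsT ts
  | [] => rfl
  | t :: ts => by rw [labelssT, labelssT_eq ts]; rfl

/-- The form `∃ b, ∀ …` recurs throughout: the bound is chosen before the data and depends on size
parameters only. Induction is on the size bound rather than on the type, so that the recursion over
a list of types becomes one traversal with a uniform cost per element. The resulting constants are
far from sharp, but only their existence matters. -/
theorem relabelT_cost (c s : ℕ) : ∃ b, ∀ {L L' : Type} (f : L → Timed L') (f' : L → L') (t : Ty L),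
    (∀ l, Cost (f l) c (fun l' => l' = f' l)) → t.size ≤ s →
    Cost (relabelT f t) b (fun u => u = t.relabel f') := by
  induction s with
  | zero => exact ⟨0, fun f f' t _ h => by have := t.size_pos; omega⟩
  | succ s ih =>
    obtain ⟨b, hb⟩ := ih
    refine ⟨c + ((b + 1) * s + 1) + (b + b) + 1, fun f f' t hf h => ?_⟩
    cases t with
    | var | base => unfold relabelT; exact Cost.step (Cost.pure rfl)
    | data l d ts =>
      simp only [Ty.size] at h
      unfold relabelT
      rw [relabelsT_eq]
      refine (Cost.step (Cost.bind (hf l) fun l' hl => Cost.bind (b' := 0)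
        (((mapT_cost_eq (g := Ty.relabel f') (c := b) fun t ht => hb f f' t hf ?_)).mono
          (b' := (b + 1) * s + 1) ?_) fun us hus => Cost.pure ?_)).mono ?_
      · have := Ty.size_le_sizes ht; omega
      · have := Ty.length_le_sizes ts; gcongr; omega
      · simp only [Ty.relabel, Ty.relabels_eq, hl, hus]
      · omega
    | arr t u =>
      simp only [Ty.size] at h
      unfold relabelT
      refine (Cost.step (Cost.bind (hb f f' t hf (by omega)) fun t' ht => Cost.bind (b' := 0)
        (hb f f' u hf (by omega)) fun u' hu => Cost.pure ?_)).mono (by omega)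
      simp only [Ty.relabel, ht, hu]

theorem injT_cost (s : ℕ) : ∃ b, ∀ (X : ℕ) (t : UTy), t.size ≤ s →
    Cost (injT X t) b (fun u => u = t.inj X) := by
  obtain ⟨b, hb⟩ := relabelT_cost 0 s
  exact ⟨b + 1, fun X t h => Cost.step (hb _ _ t (fun _ => Cost.pure rfl) h)⟩

theorem substT_cost (s : ℕ) : ∃ b, ∀ {L : Type} (σ : List (Ty L)) (t : Ty L),
    σ.length ≤ s → t.size ≤ s → Cost (substT σ t) b (fun u => u = t.subst σ) := by
  suffices H : ∀ r, ∃ b, ∀ {L : Type} (σ : List (Ty L)) (t : Ty L),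
    σ.length ≤ s → t.size ≤ r → Cost (substT σ t) b (fun u => u = t.subst σ) from H s
  intro r
  induction r with
  | zero => exact ⟨0, fun σ t _ h => by have := t.size_pos; omega⟩
  | succ r ih =>
    obtain ⟨b, hb⟩ := ih
    refine ⟨s + 1 + ((b + 1) * r + 1) + (b + b) + 1, fun σ t hσ h => ?_⟩
    cases t with
    | base => unfold substT; exact Cost.step (Cost.pure rfl)
    | var a =>
      unfold substT
      refine (Cost.step (Cost.bind (b' := 0) getT_cost fun u hu => Cost.pure ?_)).mono (by omega)
      rw [hu]; rfl
    | data l d ts =>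
      simp only [Ty.size] at h
      unfold substT
      rw [substsT_eq]
      refine (Cost.step (Cost.bind (b' := 0)
        (((mapT_cost_eq (g := Ty.subst σ) (c := b) fun t ht => hb σ t hσ ?_)).mono
          (b' := (b + 1) * r + 1) ?_) fun us hus => Cost.pure ?_)).mono ?_
      · have := Ty.size_le_sizes ht; omega
      · have := Ty.length_le_sizes ts; gcongr; omega
      · simp only [Ty.subst, Ty.substs_eq, hus]
      · omega
    | arr t u =>
      simp only [Ty.size] at h
      unfold substT
      refine (Cost.step (Cost.bind (hb σ t hσ (by omega)) fun t' ht => Cost.bind (b' := 0)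
        (hb σ u hσ (by omega)) fun u' hu => Cost.pure ?_)).mono (by omega)
      simp only [Ty.subst, ht, hu]

theorem labelsT_cost (s : ℕ) : ∃ b, ∀ {L : Type} (t : Ty L), t.size ≤ s →
    Cost (labelsT t) b (fun u => u = t.labels) := by
  induction s with
  | zero => exact ⟨0, fun t h => by have := t.size_pos; omega⟩
  | succ r ih =>
    obtain ⟨b, hb⟩ := ih
    refine ⟨((b + r + 2) * r + 1) + (b + b + r + 1) + 1, fun t h => ?_⟩
    cases t with
    | base | var => unfold labelsT; exact Cost.step (Cost.pure rfl)
    | data l d ts =>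
      simp only [Ty.size] at h
      unfold labelsT
      rw [labelssT_eq]
      refine (Cost.step (Cost.bind (b' := 0)
        (((flatMapT_cost_eq (g := Ty.labels) (c := b) (l := r) (fun t ht => hb t ?_)
          fun t ht => ?_)).mono
          (b' := (b + r + 2) * r + 1) ?_) fun us hus => Cost.pure ?_)).mono ?_
      · have := Ty.size_le_sizes ht; omega
      · have := Ty.size_le_sizes ht; have := t.length_labels_le; omega
      · have := Ty.length_le_sizes ts; gcongr; omega
      · simp only [Ty.labels, Ty.labelss_eq, hus]
      · omega
    | arr t u =>
      simp only [Ty.size] at h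
      unfold labelsT
      refine (Cost.step (Cost.bind (hb t (by omega)) fun t' ht => Cost.bind (b' := r + 1)
        (hb u (by omega)) fun u' hu => (appendT_cost.imp fun w hw => ?_).mono ?_)).mono (by omega)
      · simp only [Ty.labels, ← ht, ← hu, hw]
      · have := t.length_labels_le; rw [ht]; omega

theorem frvT_cost (s : ℕ) : ∃ b, ∀ (t : XTy), t.size ≤ s →
    Cost (frvT t) b (fun u => u = t.frv) := by
  obtain ⟨b, hb⟩ := labelsT_cost s
  refine ⟨b + (1 * s + 1) + 1, fun t h => ?_⟩
  refine Cost.step (Cost.bind (hb t h) fun ps hps =>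
    ((mapT_cost_eq (c := 0) (g := Prod.fst) fun p _ => Cost.pure rfl).imp
      fun u hu => ?_).mono ?_)
  · rw [hu, hps]; rfl
  · have := t.length_labels_le; rw [hps]; omega

theorem freshsT_cost {b : ℕ} : ∀ {ts : List UTy} {n : ℕ},
    (∀ t ∈ ts, ∀ n, Cost (freshT t n) b (fun r => r = t.fresh n)) →
    Cost (freshsT ts n) ((b + 1) * ts.length + 1) (fun r => r = Ty.freshs ts n)
  | [], n, _ => by unfold freshsT; exact Cost.step (Cost.pure rfl)
  | t :: ts, n, h => by
    unfold freshsT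
    refine (Cost.step (Cost.bind (h t (by simp) n) fun r hr => Cost.bind (b' := 0)
      (freshsT_cost (ts := ts) fun t ht => h t (by simp [ht])) fun r' hr' => Cost.pure ?_)).mono ?_
    · subst hr; subst hr'; rfl
    · simp only [List.length_cons, Nat.mul_add]; omega

theorem freshT_cost (s : ℕ) : ∃ b, ∀ (t : UTy) (n : ℕ), t.size ≤ s →
    Cost (freshT t n) b (fun r => r = t.fresh n) := by
  induction s with
  | zero => exact ⟨0, fun t _ h => by have := t.size_pos; omega⟩
  | succ s ih =>
    obtain ⟨b, hb⟩ := ih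
    refine ⟨((b + 1) * s + 1) + (b + b) + 1, fun t n h => ?_⟩
    cases t with
    | var | base => unfold freshT; exact Cost.step (Cost.pure rfl)
    | data l d ts =>
      simp only [Ty.size] at h
      unfold freshT
      refine (Cost.step (Cost.bind (b' := 0)
        ((freshsT_cost (b := b) fun t ht n => hb t n ?_).mono
          (b' := (b + 1) * s + 1) ?_) fun us hus => Cost.pure ?_)).mono ?_
      · have := Ty.size_le_sizes ht; omega
      · have := Ty.length_le_sizes ts; gcongr; omega
      · simp only [Ty.fresh, hus]
      · omega
    | arr t u =>
      simp only [Ty.size] at h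
      unfold freshT
      refine (Cost.step (Cost.bind (hb t n (by omega)) fun t' ht => Cost.bind (b' := 0)
        (hb u _ (by omega)) fun u' hu => Cost.pure ?_)).mono (by omega)
      simp only [Ty.fresh, ht, hu]

theorem freshsT_cost' (s : ℕ) : ∃ b, ∀ (ts : List UTy) (n : ℕ), Ty.sizes ts ≤ s →
    Cost (freshsT ts n) b (fun r => r = Ty.freshs ts n) := by
  obtain ⟨b, hb⟩ := freshT_cost s
  refine ⟨(b + 1) * s + 1, fun ts n h => (freshsT_cost fun t ht n => hb t n ?_).mono ?_⟩
  · exact (Ty.size_le_sizes ht).trans h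
  · have := Ty.length_le_sizes ts; gcongr; omega

theorem paramsT_cost : ∀ {n i : ℕ}, Cost (paramsT i n) (n + 1)
    (fun ts => ts = (List.range' i n).map Ty.var)
  | 0, i => Cost.step (Cost.pure rfl)
  | n + 1, i => Cost.step (Cost.bind (b' := 0) (paramsT_cost (n := n) (i := i + 1)) fun ts hts =>
      Cost.pure (by simp [hts, List.range'_succ]))

theorem arrowsT_cost {t : UTy} : ∀ {Us : List UTy}, Cost (arrowsT t Us) (Us.length + 1)
    (fun u => u = Us.foldr Ty.arr t)
  | [] => Cost.step (Cost.pure rfl)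
  | U :: Us => Cost.step (Cost.bind (b' := 0) (arrowsT_cost (Us := Us)) fun u hu =>
      Cost.pure (by simp [hu]))

theorem ctorTyT_cost {Δ : DataEnv} {d : ℕ} {Us : List UTy} :
    Cost (ctorTyT Δ d Us) (Δ.arity d + Us.length + 3) (fun u => u = ctorTy Δ d Us) := by
  refine (Cost.step (Cost.bind paramsT_cost fun ts hts => (arrowsT_cost).imp fun u hu => ?_)).mono
    (by omega)
  rw [hu, hts, ← List.range_eq_range']; rfl

theorem lookupCtorT_cost {k : ℕ} : ∀ {ks : List (ℕ × List UTy)}, (∃ Us, (k, Us) ∈ ks) →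
    Cost (lookupCtorT k ks) ks.length (fun Us => (k, Us) ∈ ks)
  | [], h => by simp at h
  | kU :: ks, h => by
    unfold lookupCtorT
    refine Cost.step ?_
    by_cases hk : kU.1 = k
    · simp only [hk, if_true]
      exact Cost.pure (by simp [← hk])
    · simp only [hk, if_false]
      refine (lookupCtorT_cost ?_).imp fun Us hUs => List.mem_cons_of_mem _ hUs
      obtain ⟨Us, hUs⟩ := h
      rcases List.mem_cons.1 hUs with rfl | hUs
      · simp at hk
      · exact ⟨Us, hUs⟩

theorem size_ctorTy (Δ : DataEnv) (d : ℕ) (Us : List UTy) :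
    (ctorTy Δ d Us).size = Us.length + Ty.sizes Us + 1 + Δ.arity d := by
  unfold ctorTy
  induction Us with
  | nil =>
    simp only [List.foldr_nil, Ty.size, List.length_nil, Ty.sizes]
    have : ∀ l : List ℕ, Ty.sizes (l.map (Ty.var (L := Unit))) = l.length := by
      intro l
      induction l with
      | nil => rfl
      | cons a l ih => simp only [List.map_cons, Ty.sizes, ih, Ty.size, List.length_cons]; omega
    rw [this, List.length_range]
  | cons U Us ih =>
    simp only [List.foldr_cons, Ty.size, ih, List.length_cons, Ty.sizes]; omega

end

/-! ## Stored constraints -/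

/-- The set of constraints that is represented by a list. -/
def absSet (C : List RC) : Set CC := {c | ∃ c' ∈ C, c = c'.abs}

/-- A body whose pairs `X(d)` are in `p`, whose bodies `k ∈ X(d)` are such that `kk k d`, and whose
bodies `X(d) ⊆ ks` are such that `kss d ks`. -/
def Body.Ok (p kk : ℕ → ℕ → Prop) (kss : ℕ → List ℕ → Prop) : Body (List ℕ) → Prop
  | .sub X Y d => p X d ∧ p Y d
  | .subset X d ks => p X d ∧ kss d ks
  | .mem k X d => p X d ∧ kk k d
  | .bot => True

/-- Constraints all of whose pairs are in `p`, all of whose constructors are in `kk`, and all of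
whose sets of constructors are in `kss`. -/
structure Constr.Ok (p kk : ℕ → ℕ → Prop) (kss : ℕ → List ℕ → Prop) (c : RC) : Prop where
  nodup : c.guard.Nodup
  guard : ∀ a ∈ c.guard, p a.X a.d ∧ kk a.k a.d
  body : c.body.Ok p kk kss

theorem Body.Ok.imp {p kk p' kk' : ℕ → ℕ → Prop} {kss kss' : ℕ → List ℕ → Prop}
    (hp : ∀ X d, p X d → p' X d) (hk : ∀ k d, kk k d → kk' k d)
    (hks : ∀ d ks, kss d ks → kss' d ks) : ∀ {b : Body (List ℕ)}, b.Ok p kk kss → b.Ok p' kk' kss'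
  | .sub _ _ _, h => ⟨hp _ _ h.1, hp _ _ h.2⟩
  | .subset _ _ _, h => ⟨hp _ _ h.1, hks _ _ h.2⟩
  | .mem _ _ _, h => ⟨hp _ _ h.1, hk _ _ h.2⟩
  | .bot, _ => trivial

/-- Bounded size of the lists in a constraint. -/
def Constr.Small (s : ℕ) (c : RC) : Prop :=
  c.guard.length ≤ s ∧ c.body.Ok (fun _ _ => True) (fun _ _ => True) (fun _ ks => ks.length ≤ s)

theorem Constr.Small.mono {s s' : ℕ} {c : RC} (h : c.Small s) (hs : s ≤ s') : c.Small s' :=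
  ⟨h.1.trans hs, h.2.imp (fun _ _ h => h) (fun _ _ h => h) fun _ _ h => h.trans hs⟩

/-! ### Counting -/

section Count

variable (P : Finset (ℕ × ℕ)) (A : Finset ℕ) (B : Finset (Finset ℕ))

/-- All atoms over given pairs and constructors. -/
def atomsOver : Finset Atom := (P ×ˢ A).image fun q => ⟨q.2, q.1.1, q.1.2⟩

/-- All bodies over given pairs, constructors and sets of constructors. -/
def bodiesOver [DecidableEq (Body (Finset ℕ))] : Finset (Body (Finset ℕ)) :=
  (P ×ˢ P).image (fun q => .sub q.1.1 q.2.1 q.1.2) ∪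
  (P ×ˢ B).image (fun q => .subset q.1.1 q.1.2 q.2) ∪
  (P ×ˢ A).image (fun q => .mem q.2 q.1.1 q.1.2) ∪ {.bot}

open Classical in
/-- All constraints over given pairs, constructors and sets of constructors. -/
noncomputable def constrsOver : Finset CC :=
  ((atomsOver P A).powerset ×ˢ bodiesOver P A B).image fun q => ⟨q.1, q.2⟩

variable {P A B}

theorem card_atomsOver {p a : ℕ} (hP : P.card ≤ p) (hA : A.card ≤ a) :
    (atomsOver P A).card ≤ p * a := by
  refine Finset.card_image_le.trans ?_
  rw [Finset.card_product]; gcongr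

theorem card_constrsOver {p a b : ℕ} (hP : P.card ≤ p) (hA : A.card ≤ a) (hB : B.card ≤ b) :
    (constrsOver P A B).card ≤ 2 ^ (p * a) * (p * p + p * b + p * a + 1) := by
  classical
  unfold constrsOver
  refine Finset.card_image_le.trans ?_
  rw [Finset.card_product, Finset.card_powerset]
  gcongr
  · norm_num
  · exact card_atomsOver hP hA
  · unfold bodiesOver
    refine (Finset.card_union_le _ _).trans (Nat.add_le_add ((Finset.card_union_le _ _).trans
      (Nat.add_le_add ((Finset.card_union_le _ _).trans (Nat.add_le_add ?_ ?_)) ?_)) ?_)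
    · refine Finset.card_image_le.trans ?_
      rw [Finset.card_product]; gcongr
    · refine Finset.card_image_le.trans ?_
      rw [Finset.card_product]; gcongr
    · refine Finset.card_image_le.trans ?_
      rw [Finset.card_product]; gcongr
    · simp

theorem guard_subset_atomsOver {kss : ℕ → List ℕ → Prop} {c : RC}
    (h : c.Ok (fun X d => (X, d) ∈ P) (fun k _ => k ∈ A) kss) :
    c.guard.toFinset ⊆ atomsOver P A := by
  intro a ha
  obtain ⟨h1, h2⟩ := h.guard a (by simpa using ha)
  exact Finset.mem_image.2 ⟨((a.X, a.d), a.k), by simp [h1, h2], rfl⟩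

theorem length_guard_le {p a : ℕ} (hP : P.card ≤ p) (hA : A.card ≤ a) {kss : ℕ → List ℕ → Prop}
    {c : RC} (h : c.Ok (fun X d => (X, d) ∈ P) (fun k _ => k ∈ A) kss) :
    c.guard.length ≤ p * a := by
  rw [← List.toFinset_card_of_nodup h.nodup]
  exact (Finset.card_le_card (guard_subset_atomsOver h)).trans (card_atomsOver hP hA)

theorem abs_mem_constrsOver {kss : ℕ → List ℕ → Prop} (hk : ∀ d ks, kss d ks → ks.toFinset ∈ B)
    {c : RC} (h : c.Ok (fun X d => (X, d) ∈ P) (fun k _ => k ∈ A) kss) :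
    c.abs ∈ constrsOver P A B := by
  classical
  unfold constrsOver
  refine Finset.mem_image.2 ⟨(c.guard.toFinset, c.body.map List.toFinset), ?_, rfl⟩
  simp only [Finset.mem_product, Finset.mem_powerset]
  refine ⟨guard_subset_atomsOver h, ?_⟩
  have hb := h.body
  unfold bodiesOver
  simp only [Finset.mem_union, Finset.mem_image, Finset.mem_product, Prod.exists]
  cases hc : c.body with
  | sub X Y d => rw [hc] at hb; exact Or.inl (Or.inl (Or.inl ⟨X, d, Y, d, hb, rfl⟩))
  | subset X d ks =>
    rw [hc] at hb
    exact Or.inl (Or.inl (Or.inr ⟨X, d, _, ⟨hb.1, hk _ _ hb.2⟩, rfl⟩))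
  | mem k X d => rw [hc] at hb; exact Or.inl (Or.inr ⟨X, d, k, hb, rfl⟩)
  | bot => exact Or.inr (by simp [Body.map])

end Count

/-! ### Equality -/

theorem bodyEqT_cost (s : ℕ) : ∃ b, ∀ c c' : RC, c.Small s → c'.Small s →
    Cost (bodyEqT c.body c'.body) b
      (fun r => r = true ↔ c.body.map List.toFinset = c'.body.map List.toFinset) := by
  refine ⟨((2 * s + 2) * s + (2 * s + 2) * s + 5) + 1, fun c c' hc hc' => ?_⟩
  have h1 := hc.2
  have h2 := hc'.2
  generalize c.body = u at *
  generalize c'.body = u' at *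
  unfold bodyEqT
  refine Cost.step ?_
  cases u <;> cases u'
  case subset.subset X d ks X' d' ks' =>
    have h3 : ks.length ≤ s := h1.2
    have h4 : ks'.length ≤ s := h2.2
    by_cases h : X = X' ∧ d = d'
    · simp only [h, and_self, if_true]
      refine ((seteqT_cost).imp fun r hr => ?_).mono ?_
      · rw [hr]; simp [Body.map]
      · gcongr
    · simp only [h, if_false]
      exact Cost.pure (by
        simp only [Body.map, Body.subset.injEq, Bool.false_eq_true, false_iff]; tauto)
  all_goals exact Cost.pure (by simp [Body.map])

theorem constrEqT_cost (s : ℕ) : ∃ b, ∀ c c' : RC, c.Small s → c'.Small s →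
    Cost (constrEqT c c') b (fun r => r = true ↔ c.abs = c'.abs) := by
  obtain ⟨b, hb⟩ := bodyEqT_cost s
  refine ⟨b + ((2 * s + 2) * s + (2 * s + 2) * s + 5) + 1, fun c c' hc hc' => ?_⟩
  refine Cost.step (Cost.bind (hb c c' hc hc') fun r hr => ?_)
  have e : c.abs = c'.abs ↔ c.guard.toFinset = c'.guard.toFinset ∧
      c.body.map List.toFinset = c'.body.map List.toFinset := by
    simp only [Constr.abs, Constr.mk.injEq]
  cases r with
  | true =>
    refine (seteqT_cost.imp fun r' hr' => ?_).mono (b' := (2 * s + 2) * s + (2 * s + 2) * s + 5) ?_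
    · rw [hr', e, and_iff_left (hr.1 rfl)]
    · have := hc.1; have := hc'.1; gcongr
  | false =>
    refine Cost.pure ?_
    simp only [Bool.false_eq_true, false_iff, e] at hr ⊢
    exact fun h => hr h.2

/-! ### Sets of constraints -/

/-- Constraint sets of bounded size all of whose elements satisfy `Constr.Ok`. -/
structure CSet (p kk : ℕ → ℕ → Prop) (kss : ℕ → List ℕ → Prop) (s : ℕ) (C : List RC) : Prop where
  length_le : C.length ≤ s
  ok : ∀ c ∈ C, c.Ok p kk kss
  small : ∀ c ∈ C, c.Small s

section CSets

variable {p kk : ℕ → ℕ → Prop} {kss : ℕ → List ℕ → Prop}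

theorem CSet.mono {s s' : ℕ} {C : List RC} (h : CSet p kk kss s C) (hs : s ≤ s') :
    CSet p kk kss s' C :=
  ⟨h.length_le.trans hs, h.ok, fun c hc => (h.small c hc).mono hs⟩

theorem CSet.nil {s : ℕ} : CSet p kk kss s [] := ⟨by simp, by simp, by simp⟩

/-- As in the later lemmas of this shape, the one number `b` bounds the time, the length of the
result and the lists inside its elements; extra summands in the witness make it large enough for all
three. It is independent of `p`, `kk` and `kss`, which say what the constraints are about. -/
theorem unionC_cost (s : ℕ) : ∃ b, ∀ {p kk : ℕ → ℕ → Prop} {kss : ℕ → List ℕ → Prop}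
    {C C' : List RC}, CSet p kk kss s C → CSet p kk kss s C' →
    Cost (unionT constrEqT C C') b (fun r => CSet p kk kss b r.1 ∧
      absSet r.1 = absSet C ∪ absSet C' ∧
      ((C'.map Constr.abs).Nodup → (r.1.map Constr.abs).Nodup)) := by
  classical
  obtain ⟨b, hb⟩ := constrEqT_cost s
  refine ⟨((b + 1) * (s + s) + 3) * s + 1 + (s + s), fun {p kk kss C C'} h h' => ?_⟩
  refine ((unionT_cost (key := Constr.abs) (ce := b) fun x hx y hy => hb x y (h.small x hx)
    (hy.elim (h.small y) (h'.small y))).imp fun r hr => ?_).mono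
    (b := ((b + 1) * (C.length + C'.length) + 3) * C.length + 1) ?_
  · refine ⟨⟨?_, fun c hc => ?_, fun c hc => ?_⟩, ?_, hr.nodup⟩
    · have := hr.length_le; have := h.length_le; have := h'.length_le; omega
    · exact (hr.mem_of c hc).elim (h.ok c) (h'.ok c)
    · exact ((hr.mem_of c hc).elim (h.small c) (h'.small c)).mono (by omega)
    · ext x
      constructor
      · rintro ⟨c, hc, rfl⟩
        exact (hr.mem_of c hc).imp (fun h => ⟨c, h, rfl⟩) (fun h => ⟨c, h, rfl⟩)
      · rintro (⟨c, hc, rfl⟩ | ⟨c, hc, rfl⟩)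
        · obtain ⟨z, hz, e⟩ := List.mem_map.1 (hr.left c hc)
          exact ⟨z, hz, e.symm⟩
        · exact ⟨c, hr.right c hc, rfl⟩
  · refine (Nat.add_le_add_right (m := ((b + 1) * (s + s) + 3) * s) ?_ 1).trans (by omega)
    have := h.length_le; have := h'.length_le; gcongr

theorem insertC_cost (s : ℕ) : ∃ b, ∀ {p kk : ℕ → ℕ → Prop} {kss : ℕ → List ℕ → Prop}
    {c : RC} {C : List RC}, c.Ok p kk kss → c.Small s → CSet p kk kss s C →
    Cost (insertT constrEqT c C) b (fun r => CSet p kk kss b r.1 ∧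
      absSet r.1 = absSet C ∪ {c.abs}) := by
  obtain ⟨b, hb⟩ := constrEqT_cost s
  refine ⟨(b + 1) * s + 2 + s, fun {p kk kss c C} h1 h2 h => ?_⟩
  refine ((insertT_cost (key := Constr.abs) (ce := b) fun y hy => hb c y h2 (h.small y hy)).imp
    fun r hr => ?_).mono ?_
  · rcases hr with ⟨rfl, hr⟩ | ⟨rfl, hr⟩
    · refine ⟨h.mono (by omega), ?_⟩
      rw [Set.union_eq_left.2]
      obtain ⟨z, hz, e⟩ := List.mem_map.1 hr
      rintro _ rfl
      exact ⟨z, hz, e.symm⟩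
    · have hl := h.length_le
      refine ⟨⟨by simp only [List.length_cons]; omega, ?_, ?_⟩, ?_⟩
      · exact List.forall_mem_cons.2 ⟨h1, h.ok⟩
      · exact List.forall_mem_cons.2 ⟨h2.mono (by omega), fun c hc => (h.small c hc).mono (by omega)⟩
      · ext x
        simp only [absSet, List.mem_cons, exists_eq_or_imp, Set.mem_ofPred_eq, Set.mem_union,
          Set.mem_singleton_iff]
        exact or_comm
  · refine (Nat.add_le_add_right (m := (b + 1) * s) ?_ 2).trans (by omega)
    have := h.length_le; gcongr

theorem guardByT_cost (s : ℕ) : ∃ b, ∀ {p kk : ℕ → ℕ → Prop} {kss : ℕ → List ℕ → Prop}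
    {φ : List Atom} {C : List RC}, φ.length ≤ s → (∀ a ∈ φ, p a.X a.d ∧ kk a.k a.d) →
    CSet p kk kss s C →
    Cost (guardByT φ C) b (fun D => CSet p kk kss b D ∧
      absSet D = guardBy φ.toFinset (absSet C)) := by
  refine ⟨(((2 * (s + s) + 3) * s + 1) + 1) * s + 1 + 1 + (s + s), fun {p kk kss φ C} hφ hp h => ?_⟩
  refine ((Cost.step (mapT_cost (c := (2 * (s + s) + 3) * s + 1)
    (R := fun c d => d.guard.toFinset = φ.toFinset ∪ c.guard.toFinset ∧ d.body = c.body ∧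
      (c.Ok p kk kss → d.Ok p kk kss) ∧ (c.Small s → d.Small (s + s)))
    fun c hc => ?_)).imp fun D hD => ?_).mono ?_
  · refine (Cost.bind (b' := 0) unionW_cost fun r hr =>
      Cost.pure ⟨hr.1, rfl, fun h => ?_, fun h => ?_⟩).mono ?_
    · have := (h.small c hc).1
      simp only [Nat.add_zero]; gcongr
    · exact ⟨hr.2.1 h.nodup, fun a ha => ((hr.2.2.1 a).1 ha).elim (hp a) (h.guard a), h.body⟩
    · have h1 := hr.2.2.2
      have h2 := h.1
      refine ⟨by simp only; omega, ?_⟩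
      exact h.2.imp (fun _ _ h => h) (fun _ _ h => h) fun _ _ h => h.trans (by omega)
  · have hl : D.length = C.length := hD.length_eq.symm
    have fwd : ∀ d ∈ D, ∃ c ∈ C, d.guard.toFinset = φ.toFinset ∪ c.guard.toFinset ∧
      d.body = c.body ∧ (c.Ok p kk kss → d.Ok p kk kss) ∧ (c.Small s → d.Small (s + s)) :=
      forall₂_right hD
    have bwd : ∀ c ∈ C, ∃ d ∈ D, d.guard.toFinset = φ.toFinset ∪ c.guard.toFinset ∧
      d.body = c.body := fun c hc =>
      let ⟨d, hd, h⟩ := forall₂_left hD c hc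
      ⟨d, hd, h.1, h.2.1⟩
    refine ⟨⟨?_, fun d hd => ?_, fun d hd => ?_⟩, ?_⟩
    · have := h.length_le; omega
    · obtain ⟨c, hc, h'⟩ := fwd d hd
      exact h'.2.2.1 (h.ok c hc)
    · obtain ⟨c, hc, h'⟩ := fwd d hd
      exact (h'.2.2.2 (h.small c hc)).mono (by omega)
    · ext x
      constructor
      · rintro ⟨d, hd, rfl⟩
        obtain ⟨c, hc, h1, h2, _⟩ := fwd d hd
        exact ⟨c.abs, ⟨c, hc, rfl⟩, by simp only [Constr.abs, h1, h2]⟩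
      · rintro ⟨_, ⟨c, hc, rfl⟩, rfl⟩
        obtain ⟨d, hd, h1, h2⟩ := bwd c hc
        exact ⟨d, hd, by simp only [Constr.abs, h1, h2]⟩
  · have := h.length_le
    refine (Nat.add_le_add_right (Nat.add_le_add_right
      (Nat.mul_le_mul_left _ this) 1) 1).trans (by omega)

/-! ### Saturation -/

/-- The conclusions of the saturation rules with given premises. -/
inductive Resolves (c c' : CC) : CC → Prop
  | transitivity {b : Body (Finset ℕ)} : Trans c.body c'.body b →
      Resolves c c' ⟨c.guard ∪ c'.guard, b⟩
  | satisfaction {k X d : ℕ} : c.body = .mem k X d → ⟨k, X, d⟩ ∈ c'.guard →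
      Resolves c c' ⟨c.guard ∪ c'.guard.erase ⟨k, X, d⟩, c'.body⟩
  | weakening {k X Y d : ℕ} : c.body = .sub X Y d → ⟨k, Y, d⟩ ∈ c'.guard →
      Resolves c c' ⟨insert ⟨k, X, d⟩ (c.guard ∪ c'.guard.erase ⟨k, Y, d⟩), c'.body⟩

theorem Sat.resolve {C : Set CC} {c c' d : CC} (hc : Sat C c) (hc' : Sat C c')
    (h : Resolves c c' d) : Sat C d := by
  cases h with
  | transitivity h => exact Sat.transitivity hc hc' h
  | satisfaction h1 h2 =>
    obtain ⟨φ, b⟩ := c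
    cases h1
    exact Sat.satisfaction hc hc' h2
  | weakening h1 h2 =>
    obtain ⟨φ, b⟩ := c
    cases h1
    exact Sat.weakening hc hc' h2

/-- Minimality of `Sat`: this shows that the computed fixed point misses nothing, while
`Sat.resolve` shows that it contains nothing else. -/
theorem Sat.subset_of_closed {C D : Set CC} (h : C ⊆ D)
    (hD : ∀ c ∈ D, ∀ c' ∈ D, ∀ d, Resolves c c' d → d ∈ D) : Sat C ⊆ D := by
  intro c hc
  induction hc with
  | base h' => exact h h'
  | transitivity _ _ h3 h1 h2 => exact hD _ h1 _ h2 _ (.transitivity h3)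
  | satisfaction _ _ h3 h1 h2 => exact hD _ h1 _ h2 _ (.satisfaction rfl h3)
  | weakening _ _ h3 h1 h2 => exact hD _ h1 _ h2 _ (.weakening rfl h3)

/-- Inversion in the form of equations. The rule with the singleton `{k}` needs it, since an
arbitrary set of constructors must be compared with `{k}` and not matched against it. -/
theorem Trans.eq {u v x : Body (Finset ℕ)} (h : Trans u v x) :
    (∃ X Y Z d, u = .sub X Y d ∧ v = .sub Y Z d ∧ x = .sub X Z d) ∨
    (∃ X Y d ks, u = .sub X Y d ∧ v = .subset Y d ks ∧ x = .subset X d ks) ∨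
    (∃ k X Y d, u = .mem k X d ∧ v = .sub X Y d ∧ x = .mem k Y d) ∨
    (∃ k X d ks, k ∉ ks ∧ u = .mem k X d ∧ v = .subset X d ks ∧ x = .bot) ∨
    ∃ k X Y d, u = .subset X d {k} ∧ v = .mem k Y d ∧ x = .sub X Y d := by
  cases h with
  | sub_sub => exact Or.inl ⟨_, _, _, _, rfl, rfl, rfl⟩
  | sub_subset => exact Or.inr (Or.inl ⟨_, _, _, _, rfl, rfl, rfl⟩)
  | mem_sub => exact Or.inr (Or.inr (Or.inl ⟨_, _, _, _, rfl, rfl, rfl⟩))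
  | mem_subset h => exact Or.inr (Or.inr (Or.inr (Or.inl ⟨_, _, _, _, h, rfl, rfl, rfl⟩)))
  | subset_mem => exact Or.inr (Or.inr (Or.inr (Or.inr ⟨_, _, _, _, rfl, rfl, rfl⟩)))

theorem trans_subset_mem {X Y d d' k : ℕ} {K : Finset ℕ} {x : Body (Finset ℕ)} :
    Trans (.subset X d K) (.mem k Y d') x ↔ K = {k} ∧ d = d' ∧ x = .sub X Y d := by
  constructor
  · intro h
    simpa [and_assoc, eq_comm] using h.eq
  · rintro ⟨rfl, rfl, rfl⟩
    exact .subset_mem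

/-- The conclusion preserves `Body.Ok` for all predicates at once. This expresses that transitivity
creates no pair, constructor or set that is absent from the premises; `atomT_cost` and
`resolveT_cost` have the same form. -/
theorem transT_cost (s : ℕ) : ∃ b, ∀ c c' : RC, c.Small s → c'.Small s →
    Cost (transT c.body c'.body) b (fun bs => bs.length ≤ 1 ∧
      (∀ (p kk : ℕ → ℕ → Prop) (kss : ℕ → List ℕ → Prop), c.body.Ok p kk kss →
        c'.body.Ok p kk kss → ∀ b ∈ bs, b.Ok p kk kss) ∧
      ∀ x, (∃ b ∈ bs, x = b.map List.toFinset) ↔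
        Trans (c.body.map List.toFinset) (c'.body.map List.toFinset) x) := by
  refine ⟨((2 * 1 + 2) * s + (2 * s + 2) * 1 + 5) + (2 * s + 1) + 1, fun c c' hc hc' => ?_⟩
  have h1 := hc.2
  have h2 := hc'.2
  generalize c.body = u at *
  generalize c'.body = u' at *
  unfold transT
  refine Cost.step ?_
  cases u <;> cases u'
  case sub.sub X Y d Y' Z d' =>
    by_cases h : Y = Y' ∧ d = d'
    · obtain ⟨rfl, rfl⟩ := h
      refine Cost.pure ⟨by simp, fun p kk kss h h' => by simpa using ⟨h.1, h'.2⟩, fun x => ?_⟩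
      simp only [and_self, if_true, List.mem_singleton, exists_eq_left, Body.map]
      exact ⟨fun h => h ▸ .sub_sub, fun h => by cases h; rfl⟩
    · refine Cost.pure ⟨by simp [h], by simp [h], fun x => ?_⟩
      simp only [h, if_false, Body.map]
      refine ⟨by simp, fun h' => ?_⟩
      cases h'; exact absurd ⟨rfl, rfl⟩ h
  case sub.subset X Y d Y' d' ks =>
    by_cases h : Y = Y' ∧ d = d'
    · obtain ⟨rfl, rfl⟩ := h
      refine Cost.pure ⟨by simp, fun p kk kss h h' => by simpa using ⟨h.1, h'.2⟩, fun x => ?_⟩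
      simp only [and_self, if_true, List.mem_singleton, exists_eq_left, Body.map]
      exact ⟨fun h => h ▸ .sub_subset, fun h => by cases h; rfl⟩
    · refine Cost.pure ⟨by simp [h], by simp [h], fun x => ?_⟩
      simp only [h, if_false, Body.map]
      refine ⟨by simp, fun h' => ?_⟩
      cases h'; exact absurd ⟨rfl, rfl⟩ h
  case mem.sub k X d X' Y d' =>
    by_cases h : X = X' ∧ d = d'
    · obtain ⟨rfl, rfl⟩ := h
      refine Cost.pure ⟨by simp, fun p kk kss h h' => by simpa using ⟨h'.2, h.2⟩, fun x => ?_⟩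
      simp only [and_self, if_true, List.mem_singleton, exists_eq_left, Body.map]
      exact ⟨fun h => h ▸ .mem_sub, fun h => by cases h; rfl⟩
    · refine Cost.pure ⟨by simp [h], by simp [h], fun x => ?_⟩
      simp only [h, if_false, Body.map]
      refine ⟨by simp, fun h' => ?_⟩
      cases h'; exact absurd ⟨rfl, rfl⟩ h
  case mem.subset k X d X' d' ks =>
    by_cases h : X = X' ∧ d = d'
    · obtain ⟨rfl, rfl⟩ := h
      have hl : ks.length ≤ s := h2.2
      simp only [and_self, if_true]
      refine (Cost.bind (b' := 0) memW_cost fun r hr => ?_).mono (by omega)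
      cases r with
      | true =>
        refine Cost.pure ⟨by simp, by simp, fun x => ⟨by simp, fun h => ?_⟩⟩
        simp only [Body.map] at h
        cases h with
        | mem_subset h => exact absurd (by simpa using hr) h
      | false =>
        refine Cost.pure ⟨by simp, fun _ _ _ _ _ => by simp [Body.Ok], fun x => ?_⟩
        simp only [List.mem_singleton, exists_eq_left, Body.map]
        exact ⟨fun h => h ▸ .mem_subset (by simpa using hr), fun h => by cases h; rfl⟩
    · simp only [h, if_false]
      refine Cost.pure ⟨by simp, by simp, fun x => ?_⟩
      simp only [Body.map]
      refine ⟨by simp, fun h' => ?_⟩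
      cases h'; exact absurd ⟨rfl, rfl⟩ h
  case subset.mem X d ks k Y d' =>
    by_cases h : d = d'
    · subst h
      have hl : ks.length ≤ s := h1.2
      simp only [if_true]
      refine (Cost.bind (b' := 0) seteqT_cost fun r hr => ?_).mono ?_
      · simp only [List.toFinset_cons, List.toFinset_nil, insert_empty_eq] at hr
        cases r with
        | true =>
          refine Cost.pure ⟨by simp, fun p kk kss h h' => by simpa using ⟨h.1, h'.1⟩, fun x => ?_⟩
          simp [Body.map, trans_subset_mem, hr.1 rfl]
        | false =>
          refine Cost.pure ⟨by simp, by simp, fun x => ⟨by simp, fun h => ?_⟩⟩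
          simp only [Body.map, trans_subset_mem] at h
          exact absurd (hr.2 h.1) (by simp)
      · simp only [List.length_singleton]; omega
    · simp only [h, if_false]
      refine Cost.pure ⟨by simp, by simp, fun x => ?_⟩
      simp [Body.map, trans_subset_mem, h]
  all_goals
    refine Cost.pure ⟨by simp, by simp, fun x => ⟨by simp, fun h => ?_⟩⟩
    simpa [Body.map] using h.eq

/-- The conclusions of the satisfaction and weakening rules for a given atom. -/
inductive ResolvesAtom (c c' : CC) (a : Atom) : CC → Prop
  | satisfaction : c.body = .mem a.k a.X a.d →
      ResolvesAtom c c' a ⟨c.guard ∪ c'.guard.erase a, c'.body⟩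
  | weakening {X : ℕ} : c.body = .sub X a.X a.d →
      ResolvesAtom c c' a ⟨insert ⟨a.k, X, a.d⟩ (c.guard ∪ c'.guard.erase a), c'.body⟩

/-- Matches the rules with the way in which conclusions are computed: transitivity once for a pair
of constraints, satisfaction and weakening once for each atom of the second guard. -/
theorem resolves_iff {c c' d : CC} : Resolves c c' d ↔
    (∃ b, Trans c.body c'.body b ∧ d = ⟨c.guard ∪ c'.guard, b⟩) ∨
      ∃ a ∈ c'.guard, ResolvesAtom c c' a d := by
  constructor
  · rintro (h | ⟨h1, h2⟩ | ⟨h1, h2⟩)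
    · exact Or.inl ⟨_, h, rfl⟩
    · exact Or.inr ⟨_, h2, .satisfaction h1⟩
    · exact Or.inr ⟨_, h2, .weakening h1⟩
  · rintro (⟨b, h, rfl⟩ | ⟨a, ha, h | h⟩)
    · exact .transitivity h
    · exact .satisfaction h ha
    · exact .weakening h ha

theorem atomT_cost (s : ℕ) : ∃ b, ∀ c c' : RC, c.Small s → c'.Small s → ∀ a ∈ c'.guard,
    Cost (atomT c c' a) b (fun ds => ds.length ≤ 1 ∧
      (∀ (p kk : ℕ → ℕ → Prop) (kss : ℕ → List ℕ → Prop), c.Ok p kk kss → c'.Ok p kk kss →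
        ∀ d ∈ ds, d.Ok p kk kss) ∧
      ∀ x, (∃ d ∈ ds, x = d.abs) ↔ ResolvesAtom c.abs c'.abs a x) := by
  refine ⟨(2 * s + 2) + ((2 * (s + s) + 3) * s + 1) + (2 * (s + s) + 2) + 1,
    fun c c' hc hc' a ha => ?_⟩
  have hl := hc.1
  have hl' := hc'.1
  unfold atomT
  refine Cost.step ?_
  cases hb : c.body with
  | mem k X d =>
    by_cases h : a = ⟨k, X, d⟩
    · simp only [h, if_true]
      refine (Cost.bind removeT_cost fun ψ hψ => Cost.bind (b' := 0)
        (unionW_cost.mono (b' := (2 * (s + s) + 3) * s + 1) ?_) fun r hr =>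
        Cost.pure ⟨by simp, fun p kk kss h1 h2 => ?_, fun x => ?_⟩).mono (by omega)
      · have := hψ.2.2.2.trans hl'; gcongr
      · rw [List.forall_mem_singleton]
        refine ⟨hr.2.1 (hψ.2.1 h2.nodup), fun a ha => ?_, h2.body⟩
        exact ((hr.2.2.1 a).1 ha).elim (h1.guard a) fun h => h2.guard a (hψ.2.2.1 a h)
      · simp only [List.mem_singleton, exists_eq_left, Constr.abs, hr.1, hψ.1]
        constructor
        · rintro rfl; exact .satisfaction (by simp [hb, Body.map])
        · rintro (h' | h')
          · rfl
          · simp [hb, Body.map] at h'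
    · simp only [h, if_false]
      refine Cost.pure ⟨by simp, by simp, fun x => ⟨by simp, ?_⟩⟩
      rintro (h' | h')
      · simp only [Constr.abs, hb, Body.map, Body.mem.injEq] at h'
        exact absurd (by rw [h'.1, h'.2.1, h'.2.2]) h
      · simp [Constr.abs, hb, Body.map] at h'
  | sub X Y d =>
    by_cases h : a.X = Y ∧ a.d = d
    · simp only [h, and_self, if_true]
      refine (Cost.bind removeT_cost fun ψ hψ => Cost.bind
        (unionW_cost.mono (b' := (2 * (s + s) + 3) * s + 1) ?_) fun r hr =>
        Cost.bind (b' := 0) (insertW_cost.mono (b' := 2 * (s + s) + 2) ?_) fun r' hr' =>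
        Cost.pure ⟨by simp, fun p kk kss h1 h2 => ?_, fun x => ?_⟩).mono (by omega)
      · have := hψ.2.2.2.trans hl'; gcongr
      · have := hψ.2.2.2; have := hr.2.2.2; omega
      · rw [List.forall_mem_singleton]
        refine ⟨hr'.2.1 (hr.2.1 (hψ.2.1 h2.nodup)), fun a' ha' => ?_, h2.body⟩
        rcases (hr'.2.2.1 a').1 ha' with rfl | ha'
        -- The new atom `k ∈ X(d)` takes its pair from the inclusion `X(d) ⊆ Y(d)` and its
        -- constructor from the atom `k ∈ Y(d)` that it replaces.
        · have h3 := h1.body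
          rw [hb] at h3
          exact ⟨h3.1, h.2 ▸ (h2.guard a ha).2⟩
        · exact ((hr.2.2.1 a').1 ha').elim (h1.guard a') fun h => h2.guard a' (hψ.2.2.1 a' h)
      · simp only [List.mem_singleton, exists_eq_left, Constr.abs, hr'.1, hr.1, hψ.1]
        obtain ⟨rfl, rfl⟩ := h
        constructor
        · rintro rfl; exact .weakening (by simp [hb, Body.map])
        · rintro (h' | h')
          · simp [hb, Body.map] at h'
          · simp only [hb, Body.map, Body.sub.injEq] at h'
            rw [h'.1]
    · simp only [h, if_false]
      refine Cost.pure ⟨by simp, by simp, fun x => ⟨by simp, ?_⟩⟩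
      rintro (h' | h')
      · simp [Constr.abs, hb, Body.map] at h'
      · simp only [Constr.abs, hb, Body.map, Body.sub.injEq] at h'
        exact absurd ⟨h'.2.1.symm, h'.2.2.symm⟩ h
  | subset X d ks =>
    refine Cost.pure ⟨by simp, by simp, fun x => ⟨by simp, ?_⟩⟩
    rintro (h' | h') <;> simp [Constr.abs, hb, Body.map] at h'
  | bot =>
    refine Cost.pure ⟨by simp, by simp, fun x => ⟨by simp, ?_⟩⟩
    rintro (h' | h') <;> simp [Constr.abs, hb, Body.map] at h'

theorem resolveT_cost (s : ℕ) : ∃ b, ∀ c c' : RC, c.Small s → c'.Small s →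
    Cost (resolveT c c') b (fun ds => ds.length ≤ b ∧
      (∀ (p kk : ℕ → ℕ → Prop) (kss : ℕ → List ℕ → Prop), c.Ok p kk kss → c'.Ok p kk kss →
        ∀ d ∈ ds, d.Ok p kk kss) ∧
      ∀ x, (∃ d ∈ ds, x = d.abs) ↔ Resolves c.abs c'.abs x) := by
  obtain ⟨b₁, h₁⟩ := transT_cost s
  obtain ⟨b₂, h₂⟩ := atomT_cost s
  refine ⟨b₁ + (((2 * (s + s) + 3) * s + 1 + 1) * 1 + 1) + ((b₂ + 1 + 2) * s + 1) + (1 + 1) + 1 +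
    (1 + 1 * s), fun c c' hc hc' => ?_⟩
  have hl := hc.1
  have hl' := hc'.1
  refine (Cost.step (Cost.bind (h₁ c c' hc hc') fun bs hbs => Cost.bind
    ((mapT_cost (c := (2 * (s + s) + 3) * s + 1)
      (R := fun b d => d.body = b ∧ d.guard.toFinset = c.guard.toFinset ∪ c'.guard.toFinset ∧
        (c'.guard.Nodup → d.guard.Nodup) ∧ ∀ a ∈ d.guard, a ∈ c.guard ∨ a ∈ c'.guard)
      fun b _ => ?_).mono (b' := (((2 * (s + s) + 3) * s + 1) + 1) * 1 + 1) ?_) fun cs hcs =>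
    Cost.bind ((flatMapT_cost (c := b₂) (l := 1) fun a ha => h₂ c c' hc hc' a ha).mono
      (b' := (b₂ + 1 + 2) * s + 1) ?_) fun cs' hcs' =>
    (appendT_cost.imp fun ds hds => ?_).mono (b' := 1 + 1) ?_)).mono ?_
  · refine (Cost.bind (b' := 0) unionW_cost fun r hr => Cost.pure
      ⟨rfl, hr.1, hr.2.1, fun a ha => (hr.2.2.1 a).1 ha⟩).mono ?_
    simp only [Nat.add_zero]; gcongr
  · have := hbs.1; gcongr
  · gcongr
  · have hl₁ : cs.length = bs.length := hcs.length_eq.symm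
    have fwd : ∀ d ∈ cs, ∃ b ∈ bs, d.body = b ∧
        d.guard.toFinset = c.guard.toFinset ∪ c'.guard.toFinset ∧
        (c'.guard.Nodup → d.guard.Nodup) ∧ ∀ a ∈ d.guard, a ∈ c.guard ∨ a ∈ c'.guard := forall₂_right hcs
    have bwd : ∀ b ∈ bs, ∃ d ∈ cs, d.body = b ∧
        d.guard.toFinset = c.guard.toFinset ∪ c'.guard.toFinset := fun b hb =>
      let ⟨d, hd, h⟩ := forall₂_left hcs b hb
      ⟨d, hd, h.1, h.2.1⟩
    subst hds
    refine ⟨?_, fun p kk kss h1 h2 d hd => ?_, fun x => ?_⟩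
    · have := hbs.1
      have h3 : cs'.length ≤ 1 * s := hcs'.1.trans (by gcongr)
      rw [List.length_append]; omega
    · rcases List.mem_append.1 hd with hd | hd
      · obtain ⟨b, hb, rfl, _, h3, h4⟩ := fwd d hd
        exact ⟨h3 h2.nodup, fun a ha => (h4 a ha).elim (h1.guard a) (h2.guard a),
          hbs.2.1 p kk kss h1.body h2.body _ hb⟩
      · obtain ⟨a, ha, ds, h3, h4⟩ := hcs'.2.1 d hd
        exact h3.1 p kk kss h1 h2 d h4
    · rw [resolves_iff]
      constructor
      · rintro ⟨d, hd, rfl⟩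
        rcases List.mem_append.1 hd with hd | hd
        · obtain ⟨b, hb, rfl, h3, _⟩ := fwd d hd
          refine Or.inl ⟨d.body.map List.toFinset, (hbs.2.2 _).1 ⟨_, hb, rfl⟩, ?_⟩
          simp only [Constr.abs, h3]
        · obtain ⟨a, ha, ds, h3, h4⟩ := hcs'.2.1 d hd
          exact Or.inr ⟨a, by simpa [Constr.abs] using ha, (h3.2 _).1 ⟨d, h4, rfl⟩⟩
      · rintro (⟨b, hb, rfl⟩ | ⟨a, ha, h⟩)
        · obtain ⟨b', hb', rfl⟩ := (hbs.2.2 _).2 hb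
          obtain ⟨d, hd, rfl, h3⟩ := bwd b' hb'
          exact ⟨d, List.mem_append_left _ hd, by simp only [Constr.abs, h3]⟩
        · obtain ⟨ds, h3, h4⟩ := hcs'.2.2 a (by simpa [Constr.abs] using ha)
          obtain ⟨d, hd, rfl⟩ := (h3.2 _).2 h
          exact ⟨d, List.mem_append_right _ (h4 d hd), rfl⟩
  · have := hbs.1; rw [← hcs.length_eq]; omega
  · omega

end CSets

-- The finite universe of a constraint set, and saturation inside it.

/-- The constructors of the bodies `k ∈ X(d)`. -/
def Body.ctorList : Body (List ℕ) → List ℕ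
  | .mem k _ _ => [k]
  | _ => []

/-- The sets of the bodies `X(d) ⊆ ks`. -/
def Body.setList : Body (List ℕ) → List (Finset ℕ)
  | .subset _ _ ks => [ks.toFinset]
  | _ => []

theorem length_flatMap_le {α β : Type} {f : α → List β} {l : ℕ} : ∀ {xs : List α},
    (∀ x ∈ xs, (f x).length ≤ l) → (xs.flatMap f).length ≤ xs.length * l
  | [], _ => by simp
  | x :: xs, h => by
    have h1 := length_flatMap_le (fun x hx => h x (by simp [hx]) : ∀ x ∈ xs, (f x).length ≤ l)
    have h2 := h x (by simp)
    simp only [List.flatMap_cons, List.length_append, List.length_cons, Nat.add_mul]; omega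

theorem card_flatMap_le {α β : Type} [DecidableEq β] {f : α → List β} {l s : ℕ} {xs : List α}
    (hs : xs.length ≤ s) (h : ∀ x ∈ xs, (f x).length ≤ l) :
    (xs.flatMap f).toFinset.card ≤ s * l :=
  (List.toFinset_card_le _).trans ((length_flatMap_le h).trans (by gcongr))

/-- Constraint sets of bounded size range over finite sets of bounded cardinality. -/
theorem CSet.exists_finite {p kk : ℕ → ℕ → Prop} {kss : ℕ → List ℕ → Prop} {s : ℕ} {C : List RC}
    (h : CSet p kk kss s C) : ∃ (P : Finset (ℕ × ℕ)) (A : Finset ℕ) (B : Finset (Finset ℕ)),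
      P.card ≤ s * (s + 2) ∧ A.card ≤ s * (s + 1) ∧ B.card ≤ s * 1 ∧
      ∀ c ∈ C, c.Ok (fun X d => (X, d) ∈ P) (fun k _ => k ∈ A)
        (fun _ ks => ks.toFinset ∈ B ∧ ks.length ≤ s) := by
  -- Each of the at most `s` constraints has at most `s` atoms; its body adds at most two pairs, one
  -- constructor and one set.
  refine ⟨(C.flatMap fun c => c.guard.map (fun a => (a.X, a.d)) ++ c.body.pairs).toFinset,
    (C.flatMap fun c => c.guard.map Atom.k ++ c.body.ctorList).toFinset,
    (C.flatMap fun c => c.body.setList).toFinset, card_flatMap_le h.length_le fun c hc => ?_,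
    card_flatMap_le h.length_le fun c hc => ?_, card_flatMap_le h.length_le fun c hc => ?_,
    fun c hc => ⟨(h.ok c hc).nodup, fun a ha => ⟨?_, ?_⟩, ?_⟩⟩
  · have := (h.small c hc).1
    have : c.body.pairs.length ≤ 2 := by cases c.body <;> simp [Body.pairs]
    rw [List.length_append, List.length_map]; omega
  · have := (h.small c hc).1
    have : c.body.ctorList.length ≤ 1 := by cases c.body <;> simp [Body.ctorList]
    rw [List.length_append, List.length_map]; omega
  · cases c.body <;> simp [Body.setList]
  · simp only [List.mem_toFinset, List.mem_flatMap, List.mem_append, List.mem_map]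
    exact ⟨c, hc, Or.inl ⟨a, ha, rfl⟩⟩
  · simp only [List.mem_toFinset, List.mem_flatMap, List.mem_append, List.mem_map]
    exact ⟨c, hc, Or.inl ⟨a, ha, rfl⟩⟩
  · have hb := (h.small c hc).2
    simp only [List.mem_toFinset, List.mem_flatMap, List.mem_append]
    cases e : c.body with
    | sub X Y d => exact ⟨⟨c, hc, by simp [e, Body.pairs]⟩, ⟨c, hc, by simp [e, Body.pairs]⟩⟩
    | subset X d ks =>
      rw [e] at hb
      exact ⟨⟨c, hc, by simp [e, Body.pairs]⟩, ⟨c, hc, by simp [e, Body.setList]⟩, hb.2⟩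
    | mem k X d => exact ⟨⟨c, hc, by simp [e, Body.pairs]⟩, ⟨c, hc, by simp [e, Body.ctorList]⟩⟩
    | bot => trivial

/-- The pairs, constructors and sets that occur in `C` span a universe of at most `M` constraints,
where `M` depends on `s` alone, and the rules do not leave it. So `closureT_cost` applies although
`p` may hold of infinitely many pairs. -/
theorem saturateT_cost (s : ℕ) : ∃ b, ∀ {p kk : ℕ → ℕ → Prop} {kss : ℕ → List ℕ → Prop}
    {C : List RC}, CSet p kk kss s C →
    Cost (saturateT C) b (fun D => CSet p kk kss b D ∧ absSet D = Sat (absSet C) ∧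
      ((C.map Constr.abs).Nodup → (D.map Constr.abs).Nodup)) := by
  classical
  set g := s * (s + 2) * (s * (s + 1)) with hg
  set M := 2 ^ g * (s * (s + 2) * (s * (s + 2)) + s * (s + 2) * (s * 1) +
    s * (s + 2) * (s * (s + 1)) + 1) with hM
  obtain ⟨b₁, h₁⟩ := constrEqT_cost (g + s)
  obtain ⟨b₂, h₂⟩ := resolveT_cost (g + s)
  set N := s + M with hN
  set cs := (((b₂ + b₂ + 2) * N + 1) + b₂ * N + 2) * N + 1
  set l := b₂ * N * N with hl
  refine ⟨(cs + (((b₁ + 1) * (l + (s + M)) + 3) * l + 1) + 1) * (M + 1) + 1 + (N + (g + s)),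
    fun {p kk kss C} h => ?_⟩
  obtain ⟨P, A, B, hP, hA, hB, hC⟩ := h.exists_finite
  -- Guards are short because they have no repetitions and at most `g` atoms exist. The lists in
  -- bodies may have repetitions, so their length is bounded by a separate conjunct, with the bound
  -- `s` of the input.
  have hsmall : ∀ {c : RC}, c.Ok (fun X d => (X, d) ∈ P) (fun k _ => k ∈ A)
      (fun _ ks => ks.toFinset ∈ B ∧ ks.length ≤ s) → c.Small (g + s) := fun hc =>
    ⟨(length_guard_le hP hA hc).trans (Nat.le_add_right _ _),
      hc.body.imp (fun _ _ _ => trivial) (fun _ _ _ => trivial) fun _ _ h => by have := h.2; omega⟩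
  refine ((Cost.step (closureT_cost (key := Constr.abs) (U := constrsOver P A B) (M := M)
    (ce := b₁) (cs := cs) (l := l) (L := s)
    -- The three parts of the invariant are the property that the caller wants back, membership in
    -- the finite universe for termination, and derivability for soundness.
    (I := fun c => c.Ok p kk kss ∧ (c.Ok (fun X d => (X, d) ∈ P) (fun k _ => k ∈ A)
      (fun _ ks => ks.toFinset ∈ B ∧ ks.length ≤ s)) ∧ Sat (absSet C) c.abs)
    (StepRel := fun xs ys => ∀ x, (∃ y ∈ ys, x = y.abs) ↔
      ∃ c ∈ xs, ∃ c' ∈ xs, Resolves c.abs c'.abs x)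
    ?_ ?_ ?_ ?_ ?_ h.length_le)).imp fun D hD => ?_).mono (by omega)
  · exact fun c hc => abs_mem_constrsOver (fun _ _ h => h.1) hc.2.1
  · exact card_constrsOver hP hA hB
  · exact fun x y hx hy => h₁ x y (hsmall hx.2.1) (hsmall hy.2.1)
  · intro xs hxs hlen
    refine ((flatMapT_cost (c := (b₂ + b₂ + 2) * N + 1) (l := b₂ * N)
      (R := fun c => IsFlatMap (fun c' ds => (∀ (p kk : ℕ → ℕ → Prop) (kss : ℕ → List ℕ → Prop),
        c.Ok p kk kss → c'.Ok p kk kss → ∀ d ∈ ds, d.Ok p kk kss) ∧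
        ∀ x, (∃ d ∈ ds, x = d.abs) ↔ Resolves c.abs c'.abs x) xs) fun c hc => ?_).imp
        fun ys hys => ?_).mono ?_
    · refine ((flatMapT_cost (c := b₂) (l := b₂) fun c' hc' =>
        h₂ c c' (hsmall (hxs c hc).2.1) (hsmall (hxs c' hc').2.1)).imp fun zs hzs =>
          ⟨hzs.1.trans (Nat.mul_le_mul_left _ hlen), hzs.2⟩).mono ?_
      gcongr
    · refine ⟨fun x => ⟨?_, ?_⟩, hys.1.trans (Nat.mul_le_mul_left _ hlen), fun y hy => ?_⟩
      · rintro ⟨y, hy, rfl⟩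
        obtain ⟨c, hc, zs, h3, h4⟩ := hys.2.1 y hy
        obtain ⟨c', hc', ds, h5, h6⟩ := h3.1 y h4
        exact ⟨c, hc, c', hc', (h5.2 _).1 ⟨y, h6, rfl⟩⟩
      · rintro ⟨c, hc, c', hc', h'⟩
        obtain ⟨zs, h3, h4⟩ := hys.2.2 c hc
        obtain ⟨ds, h5, h6⟩ := h3.2 c' hc'
        obtain ⟨d, hd, rfl⟩ := (h5.2 _).2 h'
        exact ⟨d, h4 d (h6 d hd), rfl⟩
      · obtain ⟨c, hc, zs, h3, h4⟩ := hys.2.1 y hy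
        obtain ⟨c', hc', ds, h5, h6⟩ := h3.1 y h4
        -- The preservation statement for arbitrary predicates is used twice, for those of the
        -- caller and for the finite universe.
        exact ⟨h5.1 _ _ _ (hxs c hc).1 (hxs c' hc').1 y h6,
          h5.1 _ _ _ (hxs c hc).2.1 (hxs c' hc').2.1 y h6,
          (hxs c hc).2.2.resolve (hxs c' hc').2.2 ((h5.2 _).1 ⟨y, h6, rfl⟩)⟩
    · simp only [cs]; gcongr
  · exact fun c hc => ⟨h.ok c hc, hC c hc, .base ⟨c, hc, rfl⟩⟩
  · refine ⟨⟨hD.1.trans (by omega), fun c hc => (hD.2.inv c hc).1,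
      fun c hc => (hsmall (hD.2.inv c hc).2.1).mono (by omega)⟩, Set.Subset.antisymm ?_ ?_,
      hD.2.nodup⟩
    · rintro _ ⟨c, hc, rfl⟩
      exact (hD.2.inv c hc).2.2
    · refine Sat.subset_of_closed ?_ ?_
      · rintro _ ⟨c, hc, rfl⟩
        exact ⟨c, hD.2.init c hc, rfl⟩
      · rintro _ ⟨c, hc, rfl⟩ _ ⟨c', hc', rfl⟩ d hd
        obtain ⟨ys, h3, h4⟩ := hD.2.closed
        obtain ⟨y, hy, rfl⟩ := (h3 d).2 ⟨c, hc, c', hc', hd⟩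
        obtain ⟨z, hz, e⟩ := List.mem_map.1 (h4 y hy)
        exact ⟨z, hz, e.symm⟩

/-! ### Restriction -/

/-- Besides the set that is computed, the stored list is described: its variables lie in `I` and no
constraint is repeated. Both are needed for the scheme of a definition to be well formed. -/
theorem restrictT_cost (s : ℕ) : ∃ b, ∀ {p kk : ℕ → ℕ → Prop} {kss : ℕ → List ℕ → Prop}
    {C : List RC} {I : List ℕ}, CSet p kk kss s C → I.length ≤ s →
    Cost (restrictT C I) b (fun D => CSet p kk kss b D ∧
      absSet D = restrict (absSet C) {X | X ∈ I} ∧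
      (∀ c ∈ D, c.abs.frv ⊆ {X | X ∈ I}) ∧
      ((C.map Constr.abs).Nodup → (D.map Constr.abs).Nodup)) := by
  classical
  set cp := ((2 * s + 1) + 1) * s + 1 + ((2 * s + 2) * 2 + 2)
  refine ⟨(cp + 1) * s + 1 + 1 + s, fun {p kk kss C I} h hI => ?_⟩
  refine ((Cost.step (filterT_cost (c := cp) (q := fun c => c.abs.frv ⊆ {X | X ∈ I})
    fun c hc => ?_)).imp fun D hD => ?_).mono ?_
  · refine Cost.bind (b := ((2 * s + 1) + 1) * s + 1) (b' := (2 * s + 2) * 2 + 2)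
      ((allT_cost (c := 2 * s + 1) (q := fun a : Atom => a.X ∈ I) fun a _ => memW_cost.mono ?_).mono ?_)
      fun r hr => ?_
    · omega
    · have := (h.small c hc).1; gcongr
    · have e : c.abs.frv ⊆ {X | X ∈ I} ↔ (∀ a ∈ c.guard, a.X ∈ I) ∧ ∀ X ∈ c.body.frv, X ∈ I := by
        have hb : c.abs.body.frv = c.body.frv := by
          simp only [Constr.abs]; cases c.body <;> rfl
        simp only [Constr.frv, hb, Set.subset_def]
        simp only [Constr.abs, List.mem_toFinset]
        constructor
        · exact fun h => ⟨fun a ha => h _ (Or.inl ⟨a, ha, rfl⟩), fun X hX => h _ (Or.inr hX)⟩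
        · rintro ⟨h1, h2⟩ X (⟨a, ha, rfl⟩ | hX)
          · exact h1 a ha
          · exact h2 X hX
      cases r with
      | true =>
        refine (subsetT_cost.imp fun r' hr' => ?_).mono ?_
        · rw [hr', e, and_iff_right (hr.1 rfl)]
          simp only [Finset.subset_iff, List.mem_toFinset]
        · have : c.body.frv.length ≤ 2 := by cases c.body <;> simp [Body.frv, Body.pairs]
          gcongr
      | false =>
        refine Cost.pure ?_
        rw [e]
        simp only [Bool.false_eq_true, false_iff] at hr ⊢
        exact fun h => hr h.1
  · subst hD
    refine ⟨⟨?_, fun c hc => h.ok c (List.mem_filter.1 hc).1,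
      fun c hc => (h.small c (List.mem_filter.1 hc).1).mono (by omega)⟩, ?_,
      fun c hc => by simpa using (List.mem_filter.1 hc).2, fun hn => ?_⟩
    · have := List.length_filter_le (fun c : RC => decide (c.abs.frv ⊆ {X | X ∈ I})) C
      have := h.length_le
      omega
    · ext x
      simp only [absSet, restrict, List.mem_filter, decide_eq_true_eq, Set.mem_ofPred_eq]
      constructor
      · rintro ⟨c, ⟨hc, h'⟩, rfl⟩
        exact ⟨⟨c, hc, rfl⟩, h'⟩
      · rintro ⟨⟨c, hc, rfl⟩, h'⟩
        exact ⟨c, ⟨hc, h'⟩, rfl⟩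
    · exact hn.sublist ((List.filter_sublist).map _)
  · have := h.length_le
    refine (Nat.add_le_add_right (m := (cp + 1) * s + 1) ?_ 1).trans (by omega)
    gcongr

theorem closeT_cost (s : ℕ) : ∃ b, ∀ {p kk : ℕ → ℕ → Prop} {kss : ℕ → List ℕ → Prop}
    {Γ : List XTy} {T : XTy} {C : List RC}, Γ.length ≤ s → (∀ U ∈ Γ, U.size ≤ s) → T.size ≤ s →
    CSet p kk kss s C →
    Cost (closeT Γ T C) b (fun D => CSet p kk kss b D ∧ absSet D = close Γ T (absSet C)) := by
  obtain ⟨b₁, h₁⟩ := saturateT_cost s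
  obtain ⟨b₂, h₂⟩ := frvT_cost s
  obtain ⟨b₃, h₃⟩ := restrictT_cost (b₁ + (s * s + s))
  refine ⟨b₁ + (((b₂ + s + 2) * s + 1) + (b₂ + ((s * s + 1) + b₃))) + 1,
    fun {p kk kss Γ T C} hΓ hΓs hT h => ?_⟩
  have hI : (Γ.flatMap Ty.frv).length ≤ s * s :=
    (length_flatMap_le fun U hU => (U.length_frv_le).trans (hΓs U hU)).trans (by gcongr)
  have hJ : T.frv.length ≤ s := (T.length_frv_le).trans hT
  refine Cost.step (Cost.bind (h₁ h) fun Cs hCs => Cost.bind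
    ((flatMapT_cost_eq (g := Ty.frv) (l := s) (fun U hU => h₂ U (hΓs U hU))
      fun U hU => (U.length_frv_le).trans (hΓs U hU)).mono (by gcongr)) fun I hI' =>
    Cost.bind (h₂ T hT) fun J hJ' => Cost.bind (appendT_cost.mono ?_) fun IJ hIJ =>
    (h₃ (hCs.1.mono (Nat.le_add_right _ _)) ?_).imp fun D hD => ⟨?_, ?_⟩)
  · subst hI'; gcongr
  · subst hIJ hI' hJ'
    rw [List.length_append]; omega
  · exact hD.1.mono (by omega)
  · rw [hD.2.1, hCs.2.1, close]
    congr 1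
    ext X
    simp [hIJ, hI', hJ']

/-! ### Renaming -/

theorem renameT_cost {n : ℕ} {qs : List ℕ} (X : ℕ) :
    Cost (renameT n qs X) (qs.length + 2) (fun r => r = n + qs.idxOf X) := by
  refine (Cost.step (Cost.bind (b' := 0) idxT_cost fun i hi => Cost.pure ?_)).mono (by omega)
  rw [hi]

theorem renameBodyT_cost {c : ℕ} {ρ : ℕ → Timed ℕ} {ρ' : ℕ → ℕ}
    (hρ : ∀ X, Cost (ρ X) c (fun r => r = ρ' X)) (b : Body (List ℕ)) :
    Cost (renameBodyT ρ b) (c + c + 1) (fun r => r = b.rename ρ') := by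
  unfold renameBodyT
  refine Cost.step ?_
  cases b with
  | sub X Y d =>
    refine Cost.bind (hρ X) fun X' hX => (Cost.bind (b' := 0) (hρ Y) fun Y' hY => Cost.pure ?_)
    rw [hX, hY]; rfl
  | subset X d ks =>
    refine (Cost.bind (b' := 0) (hρ X) fun X' hX => Cost.pure ?_).mono (by omega)
    rw [hX]; rfl
  | mem k X d =>
    refine (Cost.bind (b' := 0) (hρ X) fun X' hX => Cost.pure ?_).mono (by omega)
    rw [hX]; rfl
  | bot => exact Cost.pure rfl

/-- Renaming of a stored constraint. -/
def renameRC (ρ : ℕ → ℕ) (c : RC) : RC := ⟨c.guard.map (Atom.rename ρ), c.body.rename ρ⟩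

theorem abs_renameRC (ρ : ℕ → ℕ) (c : RC) : (renameRC ρ c).abs = Constr.rename ρ c.abs := by
  simp only [Constr.abs, renameRC, Constr.rename, Constr.mk.injEq]
  constructor
  · ext a; simp
  · cases c.body <;> rfl

theorem renameConstrT_cost {c s : ℕ} {ρ : ℕ → Timed ℕ} {ρ' : ℕ → ℕ}
    (hρ : ∀ X, Cost (ρ X) c (fun r => r = ρ' X)) {r : RC} (hr : r.guard.length ≤ s) :
    Cost (renameConstrT ρ r) (((c + 1) * s + 1) + (c + c + 1) + 1) (fun r' => r' = renameRC ρ' r) := by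
  refine Cost.step (Cost.bind ((mapT_cost_eq (c := c) (g := Atom.rename ρ') fun a _ => ?_).mono
    (by gcongr)) fun g hg => Cost.bind (b' := 0) (renameBodyT_cost hρ r.body) fun b hb =>
      Cost.pure ?_)
  · refine (Cost.bind (b' := 0) (hρ a.X) fun X' hX => Cost.pure ?_)
    rw [hX]; rfl
  · rw [hg, hb]; rfl

/-- Injectivity on the variables that may occur is what keeps guards free of repetitions, since
renaming maps them elementwise without removing duplicates. -/
theorem CSet.rename {p kk p' : ℕ → ℕ → Prop} {kss : ℕ → List ℕ → Prop} {s : ℕ} {C : List RC}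
    (h : CSet p kk kss s C) {ρ : ℕ → ℕ} (hinj : ∀ X d Y d', p X d → p Y d' → ρ X = ρ Y → X = Y)
    (hp : ∀ X d, p X d → p' (ρ X) d) : CSet p' kk kss s (C.map (renameRC ρ)) := by
  refine ⟨by simpa using h.length_le, List.forall_mem_map.2 fun c hc => ?_,
    List.forall_mem_map.2 fun c hc => ?_⟩
  · have hc := h.ok c hc
    refine ⟨?_, List.forall_mem_map.2 fun a ha => ⟨hp _ _ (hc.guard a ha).1, (hc.guard a ha).2⟩, ?_⟩
    · refine List.Nodup.map_on ?_ hc.nodup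
      rintro ⟨k, X, d⟩ ha ⟨k', X', d'⟩ ha' e
      simp only [Atom.rename, Atom.mk.injEq] at e
      simp only [Atom.mk.injEq, e, true_and, and_true]
      exact hinj _ _ _ _ (hc.guard _ ha).1 (hc.guard _ ha').1 e.2.1
    · have hb := hc.body
      simp only [renameRC]
      cases e : c.body <;> rw [e] at hb
      · exact ⟨hp _ _ hb.1, hp _ _ hb.2⟩
      · exact ⟨hp _ _ hb.1, hb.2⟩
      · exact ⟨hp _ _ hb.1, hb.2⟩
      · trivial
  · have hc := h.small c hc
    refine ⟨by simpa [renameRC] using hc.1, ?_⟩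
    have hb := hc.2
    simp only [renameRC]
    cases e : c.body <;> rw [e] at hb <;> exact hb

theorem absSet_rename (ρ : ℕ → ℕ) (C : List RC) :
    absSet (C.map (renameRC ρ)) = Constr.rename ρ '' absSet C := by
  ext x
  constructor
  · rintro ⟨_, h, rfl⟩
    obtain ⟨c, hc, rfl⟩ := List.mem_map.1 h
    exact ⟨_, ⟨c, hc, rfl⟩, (abs_renameRC ρ c).symm⟩
  · rintro ⟨_, ⟨c, hc, rfl⟩, rfl⟩
    exact ⟨_, List.mem_map.2 ⟨c, hc, rfl⟩, (abs_renameRC ρ c).symm⟩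

/-! ## Paths and subtype constraints -/

/-- Paths with genuine finite sets. -/
@[ext]
structure APath where
  guard : Finset (ℕ × ℕ × Bool)
  flip : Bool
  target : Target
  deriving DecidableEq

/-- Reversal of an atom of a path, if `b` holds. -/
def flipAtom (b : Bool) (a : ℕ × ℕ × Bool) : ℕ × ℕ × Bool := (a.1, a.2.1, xor b a.2.2)

/-- Reversal, if `b` holds. -/
def APath.flipBy (b : Bool) (p : APath) : APath :=
  ⟨p.guard.image (flipAtom b), xor b p.flip, p.target⟩

/-- Concatenation. -/
def APath.comp (p q : APath) : APath :=
  ⟨p.guard ∪ (q.flipBy p.flip).guard, (q.flipBy p.flip).flip, q.target⟩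

/-- A path that starts with an unfolding of the constructor `k` of `d`. -/
def APath.unfold (k d : ℕ) (p : APath) : APath := ⟨insert (k, d, false) p.guard, p.flip, p.target⟩

/-- The path that is represented by a stored one. -/
def Path.abs (p : Path) : APath := ⟨p.guard.toFinset, p.flip, p.target⟩

/-- The paths that start in a type, given the paths `D` that start in datatypes. -/
inductive TPath (D : ℕ → APath → Prop) : UTy → APath → Prop
  | var {a : ℕ} : TPath D (.var a) ⟨∅, false, .param a⟩
  | arrL {t u : UTy} {p : APath} : TPath D t p → TPath D (.arr t u) (p.flipBy true)
  | arrR {t u : UTy} {p : APath} : TPath D u p → TPath D (.arr t u) p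
  | data {l : Unit} {d d' : ℕ} {ts : List UTy} {p : APath} :
      D d p → p.target = .data d' → TPath D (.data l d ts) p
  | param {l : Unit} {d i : ℕ} {ts : List UTy} {t : UTy} {p q : APath} :
      D d p → p.target = .param i → ts[i]? = some t → TPath D t q →
      TPath D (.data l d ts) (p.comp q)

/-- Only the datatypes that occur in `U` are consulted. This locality allows paths to be computed
within one slice. -/
theorem TPath.mono {D D' : ℕ → APath → Prop} {U : UTy} {p : APath} (h : TPath D U p)
    (hD : ∀ d, ((), d) ∈ U.labels → ∀ p, D d p → D' d p) : TPath D' U p := by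
  induction h with
  | var => exact .var
  | arrL _ ih => exact .arrL (ih fun d hd => hD d (by simp [Ty.labels, hd]))
  | arrR _ ih => exact .arrR (ih fun d hd => hD d (by simp [Ty.labels, hd]))
  | data h1 h2 => exact .data (hD _ (by simp [Ty.labels]) _ h1) h2
  | param h1 h2 h3 _ ih =>
    refine .param (hD _ (by simp [Ty.labels]) _ h1) h2 h3 (ih fun d hd => hD d ?_)
    rw [Ty.labels, Ty.labelss_eq]
    exact List.mem_cons_of_mem _ (List.mem_flatMap.2 ⟨_, List.mem_of_getElem? h3, hd⟩)

/-- `D` is closed under the formation of paths that start in datatypes. -/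
def PathClosed (Δ : DataEnv) (D : ℕ → APath → Prop) : Prop :=
  (∀ d, D d ⟨∅, false, .data d⟩) ∧
    ∀ d k Us U p, (k, Us) ∈ Δ.ctors d → U ∈ Us → TPath D U p → D d (p.unfold k d)

/-- The paths that start in a datatype. -/
def DPath (Δ : DataEnv) (d : ℕ) (p : APath) : Prop := ∀ D, PathClosed Δ D → D d p

/-- `DPath` is the intersection of all closed families, and it is itself closed because `TPath` is
monotone in its parameter. Induction on paths is instantiation of `D`. Keeping `TPath` parametric
lets the same relation describe one round of the computation, with `D` the facts found so far. -/
theorem DPath.closed (Δ : DataEnv) : PathClosed Δ (DPath Δ) :=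
  ⟨fun d _ hD => hD.1 d, fun d k Us U p hk hU h D hD =>
    hD.2 d k Us U p hk hU (h.mono fun _ _ _ hp => hp D hD)⟩

-- The constraints that a path denotes, and the soundness of paths.

/-- The guard of a path whose labels are `X` and `Y`. -/
def guardOf (X Y : ℕ) (g : Finset (ℕ × ℕ × Bool)) : Finset Atom :=
  g.image fun a => ⟨a.1, if a.2.2 then Y else X, a.2.1⟩

/-- The constraint `c` is generated along the path `p` from an inequality between types of the form
`inj_X d Ts` and `inj_Y d Ts'`; the relation `R` generates constraints from inequalities between
the type arguments. -/
def Denotes (R : XTy → XTy → CC → Prop) (X Y : ℕ) (Ts Ts' : List XTy) (p : APath) (c : CC) : Prop :=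
  match p.target with
  | .data d => c = ⟨guardOf X Y p.guard, if p.flip then .sub Y X d else .sub X Y d⟩
  | .param i => ∃ T T' c', Ts[i]? = some T ∧ Ts'[i]? = some T' ∧
      (if p.flip then R T' T c' else R T T' c') ∧
      c = ⟨guardOf X Y p.guard ∪ c'.guard, c'.body⟩

section Denotes

variable {R : XTy → XTy → CC → Prop} {X Y : ℕ} {Ts Ts' : List XTy} {p q : APath} {c : CC}

theorem guardOf_flip (g : Finset (ℕ × ℕ × Bool)) :
    guardOf X Y (g.image (flipAtom true)) = guardOf Y X g := by
  unfold guardOf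
  rw [Finset.image_image]
  congr 1
  funext a
  rcases a with ⟨k, d, b⟩
  cases b <;> simp [flipAtom]

theorem APath.flipBy_false (p : APath) : p.flipBy false = p := by
  ext1
  · have : flipAtom false = id := by funext a; simp [flipAtom]
    simp [APath.flipBy, this]
  · simp [APath.flipBy]
  · rfl

/-- Contravariance exchanges the two sides, hence the labels and the type arguments. A path stores
only which of the two labels an atom uses, so negating these bits and the polarity has the same
effect. -/
theorem denotes_flip : Denotes R X Y Ts Ts' (p.flipBy true) c ↔ Denotes R Y X Ts' Ts p c := by
  rcases p with ⟨g, b, t⟩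
  cases t with
  | data d => cases b <;> simp [Denotes, APath.flipBy, guardOf_flip]
  | param i =>
    simp only [Denotes, APath.flipBy, guardOf_flip]
    constructor
    · rintro ⟨T, T', c', h1, h2, h3, h4⟩
      exact ⟨T', T, c', h2, h1, by cases b <;> simpa using h3, h4⟩
    · rintro ⟨T, T', c', h1, h2, h3, h4⟩
      exact ⟨T', T, c', h2, h1, by cases b <;> simpa using h3, h4⟩

/-- If `p` reverses the inequality, then `q` starts from the reversed one; reversing `q` first
reduces this to the union of two guards over the same `X` and `Y`. -/
theorem denotes_comp : Denotes R X Y Ts Ts' (p.comp q) c ↔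
    ∃ c', (if p.flip then Denotes R Y X Ts' Ts q c' else Denotes R X Y Ts Ts' q c') ∧
      c = ⟨guardOf X Y p.guard ∪ c'.guard, c'.body⟩ := by
  have e : ∀ c', (if p.flip then Denotes R Y X Ts' Ts q c' else Denotes R X Y Ts Ts' q c') ↔
      Denotes R X Y Ts Ts' (q.flipBy p.flip) c' := fun c' => by
    cases p.flip with
    | true => simp [denotes_flip]
    | false => simp [APath.flipBy_false]
  simp only [e]
  have e' : p.comp q = ⟨p.guard ∪ (q.flipBy p.flip).guard, (q.flipBy p.flip).flip,
    (q.flipBy p.flip).target⟩ := rfl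
  rw [e']
  generalize q.flipBy p.flip = q'
  rcases q' with ⟨g, b, t⟩
  have hu : guardOf X Y (p.guard ∪ g) = guardOf X Y p.guard ∪ guardOf X Y g := Finset.image_union _ _
  cases t with
  | data d => simp [Denotes, hu]
  | param i =>
    simp only [Denotes, hu]
    constructor
    · rintro ⟨T, T', c', h1, h2, h3, h4⟩
      exact ⟨_, ⟨T, T', c', h1, h2, h3, rfl⟩, by rw [h4, Finset.union_assoc]⟩
    · rintro ⟨_, ⟨T, T', c', h1, h2, h3, rfl⟩, h4⟩
      exact ⟨T, T', c', h1, h2, h3, by rw [h4, Finset.union_assoc]⟩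

theorem denotes_unfold {k d : ℕ} : Denotes R X Y Ts Ts' (p.unfold k d) c ↔
    ∃ c', Denotes R X Y Ts Ts' p c' ∧ c = ⟨{⟨k, X, d⟩} ∪ c'.guard, c'.body⟩ := by
  have hu : guardOf X Y (insert (k, d, false) p.guard) = {⟨k, X, d⟩} ∪ guardOf X Y p.guard := by
    simp [guardOf, Finset.image_insert]
  rcases p with ⟨g, b, t⟩
  cases t with
  | data d =>
    simp only [Denotes, APath.unfold, hu]
    exact ⟨fun h => ⟨_, rfl, h⟩, fun ⟨_, h1, h2⟩ => by subst h1; exact h2⟩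
  | param i =>
    simp only [Denotes, APath.unfold, hu]
    constructor
    · rintro ⟨T, T', c', h1, h2, h3, h4⟩
      exact ⟨_, ⟨T, T', c', h1, h2, h3, rfl⟩, by rw [h4, Finset.union_assoc]⟩
    · rintro ⟨_, ⟨T, T', c', h1, h2, h3, rfl⟩, h4⟩
      exact ⟨T, T', c', h1, h2, h3, by rw [h4, Finset.union_assoc]⟩

theorem Denotes.imp {R' : XTy → XTy → CC → Prop} (h : Denotes R X Y Ts Ts' p c)
    (hR : ∀ T T' c, R T T' c → R' T T' c) : Denotes R' X Y Ts Ts' p c := by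
  rcases p with ⟨g, b, t⟩
  cases t with
  | data d => exact h
  | param i =>
    obtain ⟨T, T', c', h1, h2, h3, h4⟩ := h
    exact ⟨T, T', c', h1, h2, by cases b <;> exact hR _ _ _ h3, h4⟩

theorem denotes_data {d : ℕ} (h : p.target = .data d) : Denotes R X Y Ts Ts' p c ↔
    c = ⟨guardOf X Y p.guard, if p.flip then .sub Y X d else .sub X Y d⟩ := by
  simp only [Denotes, h]

theorem denotes_param {i : ℕ} (h : p.target = .param i) : Denotes R X Y Ts Ts' p c ↔
    ∃ T T' c', Ts[i]? = some T ∧ Ts'[i]? = some T' ∧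
      (if p.flip then R T' T c' else R T T' c') ∧
      c = ⟨guardOf X Y p.guard ∪ c'.guard, c'.body⟩ := by
  simp only [Denotes, h]

end Denotes

theorem Ty.inj_data {X d : ℕ} {l : Unit} {ts : List UTy} {Ts : List XTy} :
    ((Ty.data l d ts).inj X).subst Ts = .data X d (ts.map fun t => (t.inj X).subst Ts) := by
  simp only [Ty.inj, Ty.relabel, Ty.relabels_eq, Ty.subst, Ty.substs_eq, List.map_map]
  rfl

theorem Ty.inj_arr {X : ℕ} {t u : UTy} {Ts : List XTy} :
    ((Ty.arr t u).inj X).subst Ts = .arr ((t.inj X).subst Ts) ((u.inj X).subst Ts) := rfl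

/-- Paths only denote generated constraints. -/
theorem TPath.sound {Δ : DataEnv} {D : ℕ → APath → Prop} {U : UTy} {p : APath} (h : TPath D U p)
    (hD : ∀ d p, D d p → ∀ X Y Ts Ts' c, Denotes (SubGen Δ) X Y Ts Ts' p c →
      SubGen Δ (.data X d Ts) (.data Y d Ts') c) :
    ∀ X Y Ts Ts' c, Denotes (SubGen Δ) X Y Ts Ts' p c →
      SubGen Δ ((U.inj X).subst Ts) ((U.inj Y).subst Ts') c := by
  induction h with
  | @var a =>
    intro X Y Ts Ts' c h
    obtain ⟨T, T', c', h1, h2, h3, rfl⟩ := h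
    simp only [Ty.inj, Ty.relabel, Ty.subst, h1, h2, Option.getD_some]
    simpa [guardOf] using h3
  | arrL _ ih => exact fun X Y Ts Ts' c h => .arrL (ih _ _ _ _ _ (denotes_flip.1 h))
  | arrR _ ih => exact fun X Y Ts Ts' c h => .arrR (ih _ _ _ _ _ h)
  | data h1 h2 =>
    intro X Y Ts Ts' c h
    rw [Ty.inj_data, Ty.inj_data]
    exact hD _ _ h1 _ _ _ _ _ ((denotes_data h2).2 ((denotes_data h2).1 h))
  | @param l d i ts t p q h1 h2 h3 _ ih =>
    intro X Y Ts Ts' c h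
    rw [Ty.inj_data, Ty.inj_data]
    obtain ⟨c', h4, rfl⟩ := denotes_comp.1 h
    refine hD _ _ h1 _ _ _ _ _ ((denotes_param h2).2
      ⟨(t.inj X).subst Ts, (t.inj Y).subst Ts', c', by simp [h3], by simp [h3], ?_, rfl⟩)
    cases hf : p.flip <;> rw [hf] at h4
    · exact ih _ _ _ _ _ h4
    · exact ih _ _ _ _ _ h4

/-- Sound paths form a closed family: the trivial path is the rule `incl`, and an unfolding is the
rule `arg` applied to `TPath.sound`. -/
theorem DPath.sound {Δ : DataEnv} {d : ℕ} {p : APath} (h : DPath Δ d p) :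
    ∀ X Y Ts Ts' c, Denotes (SubGen Δ) X Y Ts Ts' p c →
      SubGen Δ (.data X d Ts) (.data Y d Ts') c := by
  refine h (fun d p => ∀ X Y Ts Ts' c, Denotes (SubGen Δ) X Y Ts Ts' p c →
      SubGen Δ (.data X d Ts) (.data Y d Ts') c) ⟨fun d X Y Ts Ts' c h => ?_, ?_⟩
  · rw [denotes_data rfl] at h
    rw [h]
    exact .incl
  · intro d k Us U p hk hU hp X Y Ts Ts' c h
    obtain ⟨c', h', rfl⟩ := denotes_unfold.1 h
    exact .arg hk hU (hp.sound (fun d p h => h) _ _ _ _ _ h')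

-- Completeness of paths, by the height of derivations.

/-- `SubGen` with a bound on the height of derivations. -/
inductive SubGenH (Δ : DataEnv) : ℕ → XTy → XTy → CC → Prop
  | arrL {h : ℕ} {T₁ T₂ U₁ U₂ : XTy} {c : CC} :
      SubGenH Δ h U₁ T₁ c → SubGenH Δ (h + 1) (.arr T₁ T₂) (.arr U₁ U₂) c
  | arrR {h : ℕ} {T₁ T₂ U₁ U₂ : XTy} {c : CC} :
      SubGenH Δ h T₂ U₂ c → SubGenH Δ (h + 1) (.arr T₁ T₂) (.arr U₁ U₂) c
  | incl {h X Y d : ℕ} {Ts Ts' : List XTy} :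
      SubGenH Δ h (.data X d Ts) (.data Y d Ts') ⟨∅, .sub X Y d⟩
  | arg {h X Y d k : ℕ} {Ts Ts' : List XTy} {Us : List UTy} {U : UTy} {c : CC} :
      (k, Us) ∈ Δ.ctors d → U ∈ Us →
      SubGenH Δ h ((U.inj X).subst Ts) ((U.inj Y).subst Ts') c →
      SubGenH Δ (h + 1) (.data X d Ts) (.data Y d Ts') ⟨{⟨k, X, d⟩} ∪ c.guard, c.body⟩

theorem SubGen.exists_height {Δ : DataEnv} {T U : XTy} {c : CC} (h : SubGen Δ T U c) :
    ∃ n, SubGenH Δ n T U c := by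
  induction h with
  | arrL _ ih => exact ih.imp' _ fun _ => .arrL
  | arrR _ ih => exact ih.imp' _ fun _ => .arrR
  | incl => exact ⟨0, .incl⟩
  | arg h1 h2 _ ih => exact ih.imp' _ fun _ => .arg h1 h2

theorem SubGenH.subGen {Δ : DataEnv} {n : ℕ} {T U : XTy} {c : CC} (h : SubGenH Δ n T U c) :
    SubGen Δ T U c := by
  induction h with
  | arrL _ ih => exact .arrL ih
  | arrR _ ih => exact .arrR ih
  | incl => exact .incl
  | arg h1 h2 _ ih => exact .arg h1 h2 ih

/-- `SubGenH.exists_tPath` for derivations of height at most `n`. -/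
def TPathComplete (Δ : DataEnv) (n : ℕ) : Prop :=
  ∀ U X Y Ts Ts' c, SubGenH Δ n ((Ty.inj X U).subst Ts) ((Ty.inj Y U).subst Ts') c →
    ∃ p, TPath (DPath Δ) U p ∧
      Denotes (fun T T' c => ∃ n' ≤ n, SubGenH Δ n' T T' c) X Y Ts Ts' p c

/-- Reaching a type argument takes at least one unfolding, so the derivations left at the end of the
path have height strictly below `n`. This makes the recursion in `tPathComplete` well founded. -/
theorem SubGenH.exists_dPath {Δ : DataEnv} {n : ℕ} (ih : ∀ n' < n, TPathComplete Δ n') {X Y d : ℕ}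
    {Ts Ts' : List XTy} {c : CC} (h : SubGenH Δ n (.data X d Ts) (.data Y d Ts') c) :
    ∃ p, DPath Δ d p ∧ Denotes (fun T T' c => ∃ n' < n, SubGenH Δ n' T T' c) X Y Ts Ts' p c := by
  cases h with
  | incl =>
    refine ⟨_, (DPath.closed Δ).1 d, ?_⟩
    rw [denotes_data rfl]
    simp [guardOf]
  | arg h1 h2 h3 =>
    obtain ⟨p, hp, h⟩ := ih _ (Nat.lt_succ_self _) _ _ _ _ _ _ h3
    exact ⟨_, (DPath.closed Δ).2 _ _ _ _ _ h1 h2 hp, denotes_unfold.2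
      ⟨_, h.imp fun T T' c ⟨n', h, h'⟩ => ⟨n', by omega, h'⟩, rfl⟩⟩

/-- For a datatype applied to arguments, follow a path of the datatype to a parameter and then a
path in the corresponding argument. The argument occurs in `U`, but its derivation comes from the
end of the first path and not from a premise; only its height is known to be smaller. Hence strong
induction on the height. -/
theorem tPathComplete (Δ : DataEnv) (n : ℕ) : TPathComplete Δ n := by
  induction n using Nat.strong_induction_on with
  | _ n ih =>
  intro U X Y Ts Ts' c h
  cases U with
  | base b => simp only [Ty.inj, Ty.relabel, Ty.subst] at h; cases h
  | var a =>
    refine ⟨_, .var, ?_⟩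
    rw [denotes_param rfl]
    simp only [Ty.inj, Ty.relabel, Ty.subst] at h
    cases h1 : Ts[a]? with
    | none => rw [h1] at h; cases h
    | some T =>
      cases h2 : Ts'[a]? with
      | none =>
        rw [h2, h1] at h
        simp only [Option.getD_some, Option.getD_none] at h
        cases h
      | some T' =>
        rw [h2, h1] at h
        exact ⟨T, T', c, rfl, rfl, ⟨n, le_rfl, h⟩, by simp [guardOf]⟩
  | arr t u =>
    rw [Ty.inj_arr, Ty.inj_arr] at h
    cases h with
    | arrL h =>
      obtain ⟨p, hp, h'⟩ := ih _ (Nat.lt_succ_self _) _ _ _ _ _ _ h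
      exact ⟨_, .arrL hp, denotes_flip.2 (h'.imp fun T T' c ⟨n', h, h'⟩ => ⟨n', by omega, h'⟩)⟩
    | arrR h =>
      obtain ⟨p, hp, h'⟩ := ih _ (Nat.lt_succ_self _) _ _ _ _ _ _ h
      exact ⟨_, .arrR hp, h'.imp fun T T' c ⟨n', h, h'⟩ => ⟨n', by omega, h'⟩⟩
  | data l d ts =>
    rw [Ty.inj_data, Ty.inj_data] at h
    obtain ⟨p, hp, h'⟩ := h.exists_dPath ih
    cases ht : p.target with
    | data d' =>
      exact ⟨p, .data hp ht, (denotes_data ht).2 ((denotes_data ht).1 h')⟩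
    | param i =>
      obtain ⟨T, T', c', h1, h2, h3, rfl⟩ := (denotes_param ht).1 h'
      simp only [List.getElem?_map, Option.map_eq_some_iff] at h1 h2
      obtain ⟨t, h1, rfl⟩ := h1
      obtain ⟨t', h2, rfl⟩ := h2
      obtain rfl : t = t' := by rw [h1] at h2; exact Option.some.inj h2
      suffices H : ∃ q, TPath (DPath Δ) t q ∧
          if p.flip then Denotes (fun T T' c => ∃ n' ≤ n, SubGenH Δ n' T T' c) Y X Ts' Ts q c'
          else Denotes (fun T T' c => ∃ n' ≤ n, SubGenH Δ n' T T' c) X Y Ts Ts' q c' by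
        obtain ⟨q, hq, h4⟩ := H
        exact ⟨_, .param hp ht h1 hq, denotes_comp.2 ⟨c', h4, rfl⟩⟩
      cases hf : p.flip <;> rw [hf] at h3 <;> obtain ⟨n', hn, h3⟩ := h3 <;>
        obtain ⟨q, hq, h4⟩ := ih n' hn _ _ _ _ _ _ h3 <;>
        exact ⟨q, hq, h4.imp fun T T' c ⟨m, h, h'⟩ => ⟨m, by omega, h'⟩⟩

/-- Replaces the possibly infinite unfolding by paths that depend on `d` alone, while labels and
type arguments enter only through `Denotes`. The correctness of `subT` at datatypes rests on it. -/
theorem subGen_data_iff {Δ : DataEnv} {X Y d : ℕ} {Ts Ts' : List XTy} {c : CC} :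
    SubGen Δ (.data X d Ts) (.data Y d Ts') c ↔
      ∃ p, DPath Δ d p ∧ Denotes (SubGen Δ) X Y Ts Ts' p c := by
  constructor
  · intro h
    obtain ⟨n, h⟩ := h.exists_height
    obtain ⟨p, hp, h'⟩ := h.exists_dPath fun n' _ => tPathComplete Δ n'
    exact ⟨p, hp, h'.imp fun T T' c ⟨n, _, h⟩ => h.subGen⟩
  · rintro ⟨p, hp, h⟩
    exact hp.sound _ _ _ _ _ h

/-! ### The computation of paths -/

section Bounds

variable {Δ : DataEnv} {Q K D : ℕ}

theorem DataEnv.Bounded.length_ctors_le (h : Δ.Bounded Q K D) (d : ℕ) :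
    (Δ.ctors d).length ≤ K := by
  by_cases hd : (Δ d).isSome
  · exact (h d hd).2.1
  · simp [DataEnv.ctors, Option.not_isSome_iff_eq_none.1 hd]

theorem DataEnv.isSome_of_mem_ctors {d k : ℕ} {Us : List UTy} (hk : (k, Us) ∈ Δ.ctors d) :
    (Δ d).isSome := by
  by_contra hd
  simp [DataEnv.ctors, Option.not_isSome_iff_eq_none.1 hd] at hk

theorem DataEnv.Bounded.ctor_size_le (h : Δ.Bounded Q K D) {d k : ℕ} {Us : List UTy}
    (hk : (k, Us) ∈ Δ.ctors d) : Us.length + Ty.sizes Us + 1 + Δ.arity d ≤ Q := by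
  rw [← size_ctorTy]
  exact (h d (DataEnv.isSome_of_mem_ctors hk)).1 k Us hk

/-- The bound is `D + 1` because `Bounded` says nothing about undeclared identifiers, whose slice is
the singleton of themselves even if `D = 0`. -/
theorem DataEnv.Bounded.slice_encard_le (h : Δ.Bounded Q K D) (d : ℕ) :
    {d' | InSlice Δ d d'}.encard ≤ (D + 1 : ℕ) := by
  by_cases hd : (Δ d).isSome
  · exact (h d hd).2.2.trans (by norm_cast; omega)
  · have : {d' | InSlice Δ d d'} ⊆ {d} := by
      intro d' hd'
      induction hd' with
      | refl => rfl
      | step _ h2 _ _ ih => cases ih; exact absurd (DataEnv.isSome_of_mem_ctors h2) hd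
    refine (Set.encard_le_encard this).trans ?_
    rw [Set.encard_singleton]
    norm_cast
    omega

theorem DataEnv.Bounded.exists_slice (h : Δ.Bounded Q K D) (d : ℕ) :
    ∃ s : Finset ℕ, s.card ≤ D + 1 ∧ ∀ d', d' ∈ s ↔ InSlice Δ d d' := by
  have h1 := h.slice_encard_le d
  have hf : {d' | InSlice Δ d d'}.Finite := Set.finite_of_encard_le_coe h1
  refine ⟨hf.toFinset, ?_, by simp⟩
  rw [hf.encard_eq_coe_toFinset_card] at h1
  exact_mod_cast h1

end Bounds

theorem InSlice.trans {Δ : DataEnv} {d d' d'' : ℕ} (h : InSlice Δ d d') (h' : InSlice Δ d' d'') :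
    InSlice Δ d d'' := by
  induction h' with
  | refl => exact h
  | step _ h2 h3 h4 ih => exact .step ih h2 h3 h4

theorem sliceT_cost (Q K D : ℕ) : ∃ b, ∀ {Δ : DataEnv}, Δ.Bounded Q K D → ∀ d,
    Cost (sliceT Δ d) b (fun ds => ds.length ≤ b ∧ ∀ d', d' ∈ ds ↔ InSlice Δ d d') := by
  obtain ⟨bl, hl⟩ := labelsT_cost Q
  set N := 1 + (D + 1) with hN
  set c₁ := bl + ((0 + 1) * Q + 1)
  set c₂ := (c₁ + Q + 2) * Q + 1
  set c₃ := (c₂ + Q * Q + 2) * K + 1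
  set cs := (c₃ + Q * Q * K + 2) * N + 1
  set l := Q * Q * K * N
  refine ⟨(cs + (((1 + 1) * (l + N) + 3) * l + 1) + 1) * (D + 1 + 1) + 1 + N,
    fun {Δ} h d => ?_⟩
  obtain ⟨s, hs, hs'⟩ := h.exists_slice d
  refine ((Cost.step (closureT_cost (key := id) (U := s) (M := D + 1) (ce := 1) (cs := cs)
    (l := l) (L := 1) (I := InSlice Δ d) (StepRel := fun xs ys => ∀ y, y ∈ ys ↔
      ∃ d₁ ∈ xs, ∃ kU ∈ Δ.ctors d₁, ∃ U ∈ kU.2, ∃ p ∈ U.labels, y = p.2)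
    (fun x hx => (hs' x).2 hx) hs (fun x y _ _ => eqW_cost x y) ?_ (by simpa using .refl)
    (by simp))).imp fun ds hds => ⟨?_, fun d' => ⟨hds.2.inv d', fun hd' => ?_⟩⟩).mono
      (by simp only [N]; omega)
  · intro xs hxs hlen
    refine (flatMapT_rep (abs := id) (J := InSlice Δ d) (c := c₃) (l := Q * Q * K)
      (S := fun d₁ y => ∃ kU ∈ Δ.ctors d₁, ∃ U ∈ kU.2, ∃ p ∈ U.labels, y = p.2) hlen
      fun d₁ hd₁ => flatMapT_rep (c := c₂) (l := Q * Q)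
        (S := fun kU y => ∃ U ∈ kU.2, ∃ p ∈ U.labels, y = p.2) (h.length_ctors_le d₁)
        fun kU hkU => ?_).imp fun ys hys => ⟨fun y => by simpa using hys.2.2 y, hys.1, hys.2.1⟩
    have hQ := h.ctor_size_le (k := kU.1) (Us := kU.2) hkU
    refine flatMapT_rep (c := c₁) (l := Q) (xs := kU.2) (m := Q)
      (S := fun U y => ∃ p ∈ U.labels, y = p.2) (by omega)
      fun U hU => Cost.bind (hl U ?_) fun ps hps => ?_
    · have := Ty.size_le_sizes hU; omega
    · subst hps
      refine mapT_rep (g := fun p : Unit × ℕ => p.2) ?_ fun p hp => Cost.pure ⟨?_, rfl⟩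
      · have := U.length_labels_le; have := Ty.size_le_sizes hU; omega
      · exact .step (hxs d₁ hd₁) hkU hU hp
  · have := hds.1; omega
  · obtain ⟨ys, h1, h2⟩ := hds.2.closed
    induction hd' with
    | refl => exact hds.2.init d (by simp)
    | step _ h3 h4 h5 ih =>
      simpa using h2 _ ((h1 _).2 ⟨_, ih, _, h3, _, h4, _, h5, rfl⟩)

-- Stored paths and the cost of the operations on them.

/-- Stored paths through the datatypes `ds`. -/
structure Path.Ok (Δ : DataEnv) (ds : List ℕ) (Q : ℕ) (p : Path) : Prop where
  nodup : p.guard.Nodup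
  guard : ∀ a ∈ p.guard, a.2.1 ∈ ds ∧ Δ.IsCtor a.1 a.2.1
  data : ∀ d, p.target = .data d → d ∈ ds
  param : ∀ i, p.target = .param i → i < Q

/-- Reversal of stored paths. -/
def Path.flipBy (b : Bool) (p : Path) : Path := ⟨p.guard.map (flipAtom b), xor b p.flip, p.target⟩

theorem Path.abs_flipBy (b : Bool) (p : Path) : (p.flipBy b).abs = p.abs.flipBy b := by
  simp only [Path.abs, Path.flipBy, APath.flipBy, APath.mk.injEq, and_true]
  ext a; simp

theorem flipAtom_injective (b : Bool) : Function.Injective (flipAtom b) := by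
  rintro ⟨k, d, x⟩ ⟨k', d', x'⟩ h
  simpa [flipAtom] using h

section Paths

variable {Δ : DataEnv} {ds : List ℕ} {Q K : ℕ}

theorem Path.Ok.flipBy {p : Path} (h : p.Ok Δ ds Q) (b : Bool) : (p.flipBy b).Ok Δ ds Q :=
  ⟨h.nodup.map (flipAtom_injective b), List.forall_mem_map.2 h.guard, h.data, h.param⟩

/-- The atoms of paths through the datatypes `ds`. -/
def pathAtoms (Δ : DataEnv) (ds : List ℕ) : Finset (ℕ × ℕ × Bool) :=
  (ds.flatMap fun d => (Δ.ctors d).flatMap fun kU => [(kU.1, d, false), (kU.1, d, true)]).toFinset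

theorem card_pathAtoms_le (hK : ∀ d, (Δ.ctors d).length ≤ K) {s : ℕ} (hs : ds.length ≤ s) :
    (pathAtoms Δ ds).card ≤ s * (K * 2) :=
  card_flatMap_le hs fun d _ => (length_flatMap_le (l := 2) fun kU _ => by simp).trans
    (by gcongr; exact hK d)

theorem Path.Ok.guard_subset {p : Path} (h : p.Ok Δ ds Q) : p.guard.toFinset ⊆ pathAtoms Δ ds := by
  intro a ha
  obtain ⟨h1, Us, h2⟩ := h.guard a (by simpa using ha)
  simp only [pathAtoms, List.mem_toFinset, List.mem_flatMap]
  refine ⟨_, h1, _, h2, ?_⟩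
  rcases a with ⟨k, d, b⟩
  cases b <;> simp

theorem Path.Ok.length_le {p : Path} (h : p.Ok Δ ds Q) (hK : ∀ d, (Δ.ctors d).length ≤ K) {s : ℕ}
    (hs : ds.length ≤ s) : p.guard.length ≤ s * (K * 2) := by
  rw [← List.toFinset_card_of_nodup h.nodup]
  exact (Finset.card_le_card h.guard_subset).trans (card_pathAtoms_le hK hs)

theorem flipT_cost {b : Bool} {p : Path} {g : ℕ} (h : p.guard.length ≤ g) :
    Cost (flipT b p) (g + 2) (fun q => q = p.flipBy b) := by
  refine (Cost.step (Cost.bind (b' := 0) ((mapT_cost_eq (c := 0) (g := flipAtom b)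
    fun a _ => Cost.pure rfl)) fun r hr => Cost.pure ?_)).mono (by omega)
  rw [hr]; rfl

theorem composeT_cost {p q : Path} {g : ℕ} (hp : p.guard.length ≤ g) (hq : q.guard.length ≤ g) :
    Cost (composeT p q) ((g + 2) + ((2 * (g + g) + 3) * g + 1) + 1) (fun r =>
      (p.Ok Δ ds Q → q.Ok Δ ds Q → r.Ok Δ ds Q) ∧ r.abs = p.abs.comp q.abs) := by
  refine (Cost.step (Cost.bind (flipT_cost hq) fun q' hq' => Cost.bind (b' := 0)
    (unionW_cost.mono (b' := (2 * (g + g) + 3) * g + 1) ?_) fun r hr =>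
    Cost.pure ⟨fun h1 h2 => ?_, ?_⟩)).mono (by omega)
  · have : q'.guard.length ≤ g := by rw [hq']; simpa [Path.flipBy] using hq
    gcongr
  · have h3 := h2.flipBy p.flip
    rw [← hq'] at h3
    exact ⟨hr.2.1 h3.nodup, fun a ha => ((hr.2.2.1 a).1 ha).elim (h1.guard a) (h3.guard a),
      h3.data, h3.param⟩
  · have h1 : q'.abs = q.abs.flipBy p.flip := by rw [hq', Path.abs_flipBy]
    refine APath.ext ?_ ?_ ?_
    · show r.1.toFinset = p.guard.toFinset ∪ (q.abs.flipBy p.flip).guard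
      rw [hr.1, ← h1]; rfl
    · show q'.flip = (q.abs.flipBy p.flip).flip
      rw [← h1]; rfl
    · rw [hq']; rfl

/-- The paths in a list of facts. -/
def FactRel (facts : List (ℕ × Path)) (d : ℕ) (x : APath) : Prop :=
  ∃ f ∈ facts, f.1 = d ∧ x = f.2.abs

theorem pathssT_eq (facts : List (ℕ × Path)) : ∀ ts : List UTy,
    pathssT facts ts = mapT (pathsT facts) ts
  | [] => rfl
  | t :: ts => by rw [pathssT, pathssT_eq facts ts]; rfl

end Paths

/-- Well-formedness of `U` over `n ≤ Q` variables keeps the parameters at the ends of paths below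
`Q`, and this is what makes the set of possible paths finite. -/
theorem pathsT_cost (g F s : ℕ) : ∃ b, ∀ {Δ : DataEnv} {ds : List ℕ} {Q n : ℕ}
    {facts : List (ℕ × Path)} {U : UTy}, (∀ p : Path, p.Ok Δ ds Q → p.guard.length ≤ g) → n ≤ Q →
    facts.length ≤ F → (∀ f ∈ facts, f.2.Ok Δ ds Q) → U.Wf Δ n → U.size ≤ s →
    Cost (pathsT facts U) b (fun ps => ps.length ≤ b ∧
      Rep Path.abs (Path.Ok Δ ds Q) ps (TPath (FactRel facts) U)) := by
  induction s with
  | zero => exact ⟨0, fun {_ _ _ _ _ U} _ _ _ _ _ h => by have := U.size_pos; omega⟩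
  | succ s ih =>
    obtain ⟨b, hb⟩ := ih
    set cc := (g + 2) + ((2 * (g + g) + 3) * g + 1) + 1
    set cf := (s + 1) + ((cc + 1) * b + 1)
    refine ⟨1 + (b + (((g + 2) + 1) * b + 1) + b + (b + 1)) + (b + b) +
      ((b + 1) * s + 1 + ((cf + (b + 1) + 2) * F + 1)) + (b + 1) * F,
      fun {Δ ds Q n facts U} hg hn hF hf hU h => ?_⟩
    cases U with
    | base =>
      unfold pathsT
      exact Cost.mono (b := 1) (Cost.step (Cost.pure
        ⟨by simp, by simp, fun c => ⟨by simp, fun h => by cases h⟩⟩)) (by omega)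
    | var a =>
      unfold pathsT
      refine Cost.mono (b := 1) (Cost.step (Cost.pure ⟨by simp; omega, ?_, fun c => ?_⟩)) (by omega)
      · simp only [List.mem_singleton, forall_eq]
        refine ⟨by simp, by simp, by simp, fun i hi => ?_⟩
        cases hi
        exact lt_of_lt_of_le hU hn
      · simp only [List.mem_singleton, exists_eq_left, Path.abs, List.toFinset_nil]
        exact ⟨fun h => h ▸ .var, fun h => by cases h; rfl⟩
    | arr t u =>
      simp only [Ty.size] at h
      unfold pathsT
      refine (Cost.step (Cost.bind (hb hg hn hF hf hU.1 (by omega)) fun ps hps => Cost.bind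
        (mapT_rep (abs := Path.abs) (J := Path.Ok Δ ds Q) (g := fun p => p.abs.flipBy true) hps.1
          fun p hp => (flipT_cost (hg p (hps.2.1 p hp))).imp fun q hq => ?_) fun ps' hps' =>
        Cost.bind (b' := b + 1) (hb hg hn hF hf hU.2 (by omega)) fun qs hqs =>
        (appendT_cost.imp fun rs hrs => ?_).mono (by omega))).mono (by omega)
      · rw [hq]
        exact ⟨(hps.2.1 p hp).flipBy true, Path.abs_flipBy _ _⟩
      · subst hrs
        refine ⟨by rw [List.length_append]; omega, fun r hr => ?_, fun x => ⟨?_, fun hx => ?_⟩⟩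
        · exact (List.mem_append.1 hr).elim (hps'.2.1 r) (hqs.2.1 r)
        · rintro ⟨r, hr, rfl⟩
          rcases List.mem_append.1 hr with hr | hr
          · obtain ⟨p, hp, h'⟩ := (hps'.2.2 _).1 ⟨r, hr, rfl⟩
            rw [h']
            exact .arrL ((hps.2.2 _).1 ⟨p, hp, rfl⟩)
          · exact .arrR ((hqs.2.2 _).1 ⟨r, hr, rfl⟩)
        · cases hx with
          | arrL hx =>
            obtain ⟨p, hp, rfl⟩ := (hps.2.2 _).2 hx
            obtain ⟨r, hr, h'⟩ := (hps'.2.2 _).2 ⟨p, hp, rfl⟩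
            exact ⟨r, List.mem_append_left _ hr, h'⟩
          | arrR hx =>
            obtain ⟨r, hr, h'⟩ := (hqs.2.2 _).2 hx
            exact ⟨r, List.mem_append_right _ hr, h'⟩
    | data l d ts =>
      simp only [Ty.size] at h
      have hlen := Ty.length_le_sizes ts
      have hwf := Ty.wfs_iff.1 hU.2.2
      unfold pathsT
      rw [pathssT_eq]
      refine (Cost.step (Cost.bind (b' := (cf + (b + 1) + 2) * F + 1) ((mapT_cost (c := b)
        (R := fun t ps => ps.length ≤ b ∧ Rep Path.abs (Path.Ok Δ ds Q) ps (TPath (FactRel facts) t))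
        fun t ht => hb hg hn hF hf (hwf t ht) ?_).mono (b' := (b + 1) * s + 1) ?_) fun pss hpss =>
        (flatMapT_rep (abs := Path.abs) (J := Path.Ok Δ ds Q) (c := cf) (l := b + 1)
        (S := fun f x => f.1 = d ∧ ((∃ d', f.2.target = .data d' ∧ x = f.2.abs) ∨
          ∃ i t q, f.2.target = .param i ∧ ts[i]? = some t ∧ TPath (FactRel facts) t q ∧
            x = f.2.abs.comp q)) hF fun f hf' => ?_).imp fun rs hrs => ?_)).mono ?_
      · have := Ty.size_le_sizes ht; omega
      · gcongr; omega
      · by_cases hd : f.1 = d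
        · simp only [hd, if_true]
          cases ht : f.2.target with
          | data d' =>
            refine Cost.pure ⟨by simp, by simpa using hf f hf', fun x => ?_⟩
            simp
          | param i =>
            simp only
            refine Cost.bind (b := s + 1) (getT_cost.mono ?_) fun ps hps => ?_
            · rw [← hpss.length_eq]; omega
            · subst hps
              cases hi : pss[i]? with
              -- The path ends at a parameter for which there is no argument; algorithm and `TPath`
              -- agree that nothing continues it.
              | none =>
                have hi' : ts[i]? = none := by
                  rw [List.getElem?_eq_none_iff] at hi ⊢
                  rw [hpss.length_eq]; exact hi
                refine (Cost.mono (b := 1) ?_ (by omega))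
                refine Cost.step (Cost.pure ⟨by simp, by simp, fun x => ⟨by simp, ?_⟩⟩)
                rintro ⟨_, ⟨d', h1, _⟩ | ⟨j, t, q, h1, h2, _⟩⟩
                · cases h1
                · cases h1; simp [hi'] at h2
              | some ps =>
                obtain ⟨hlt, hps⟩ := List.getElem?_eq_some_iff.1 hi
                have hlt' : i < ts.length := by rw [hpss.length_eq]; exact hlt
                have hR := hpss.get hlt' hlt
                simp only [List.get_eq_getElem, hps] at hR
                refine (mapT_rep (abs := Path.abs) (J := Path.Ok Δ ds Q) (c := cc)
                  (g := fun q => f.2.abs.comp q.abs) hR.1 fun q hq =>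
                  (composeT_cost (hg _ (hf f hf')) (hg _ (hR.2.1 q hq))).imp
                    fun r hr => ⟨hr.1 (hf f hf') (hR.2.1 q hq), hr.2⟩).imp
                  fun rs hrs => ⟨hrs.1.trans (by omega), hrs.2.1, fun x => (hrs.2.2 x).trans ?_⟩
                constructor
                · rintro ⟨q, hq, rfl⟩
                  exact ⟨trivial, Or.inr ⟨i, _, q.abs, rfl, List.getElem?_eq_getElem hlt',
                    (hR.2.2 _).1 ⟨q, hq, rfl⟩, rfl⟩⟩
                · rintro ⟨_, ⟨d', h1, _⟩ | ⟨j, t, q, h1, h2, h3, rfl⟩⟩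
                  · cases h1
                  · cases h1
                    rw [List.getElem?_eq_getElem hlt'] at h2
                    cases h2
                    obtain ⟨q, hq, rfl⟩ := (hR.2.2 _).2 h3
                    exact ⟨q, hq, rfl⟩
        · simp only [hd, if_false]
          exact Cost.pure ⟨by simp, by simp, fun x => by simp⟩
      · refine ⟨hrs.1.trans (by omega), hrs.2.1, fun x => (hrs.2.2 x).trans ⟨?_, fun hx => ?_⟩⟩
        · rintro ⟨f, hf', hd, ⟨d', h1, rfl⟩ | ⟨i, t, q, h1, h2, h3, rfl⟩⟩
          · exact .data ⟨f, hf', hd, rfl⟩ h1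
          · exact .param ⟨f, hf', hd, rfl⟩ h1 h2 h3
        · cases hx with
          | data h1 h2 =>
            obtain ⟨f, hf', hd, rfl⟩ := h1
            exact ⟨f, hf', hd, Or.inl ⟨_, h2, rfl⟩⟩
          | param h1 h2 h3 h4 =>
            obtain ⟨f, hf', hd, rfl⟩ := h1
            exact ⟨f, hf', hd, Or.inr ⟨_, _, _, h2, h3, h4, rfl⟩⟩
      · omega

theorem pathEqT_cost {p q : Path} {g : ℕ} (hp : p.guard.length ≤ g) (hq : q.guard.length ≤ g) :
    Cost (pathEqT p q) ((2 * g + 2) * g + (2 * g + 2) * g + 5 + 1)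
      (fun r => r = true ↔ p.abs = q.abs) := by
  refine Cost.step ?_
  by_cases h : p.flip = q.flip ∧ p.target = q.target
  · simp only [h, and_self, if_true]
    refine (seteqT_cost.imp fun r hr => ?_).mono (by gcongr)
    rw [hr]; simp [Path.abs, h]
  · simp only [h, if_false]
    exact Cost.pure (by simp only [Path.abs, APath.mk.injEq, Bool.false_eq_true, false_iff]; tauto)

theorem pathStepT_cost (Q K D F g : ℕ) : ∃ b, ∀ {Δ : DataEnv} {ds : List ℕ}
    {facts : List (ℕ × Path)}, Δ.Wf → Δ.Bounded Q K D → ds.length ≤ D →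
    (∀ p : Path, p.Ok Δ ds Q → p.guard.length ≤ g) → facts.length ≤ F →
    (∀ f ∈ facts, f.2.Ok Δ ds Q) →
    Cost (pathStepT Δ ds facts) b (fun fs => fs.length ≤ b ∧
      Rep (fun f => (f.1, f.2.abs)) (fun f => f.1 ∈ ds ∧ f.2.Ok Δ ds Q) fs
        fun x => ∃ d ∈ ds, ∃ kU ∈ Δ.ctors d, ∃ U ∈ kU.2, ∃ p, TPath (FactRel facts) U p ∧
          x = (d, p.unfold kU.1 d)) := by
  obtain ⟨b, hb⟩ := pathsT_cost g F Q
  set c₀ := 2 * g + 2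
  set c₁ := b + ((c₀ + 1) * b + 1)
  set c₂ := (c₁ + b + 2) * Q + 1
  set c₃ := (c₂ + b * Q + 2) * K + 1
  refine ⟨(c₃ + b * Q * K + 2) * D + 1 + 1 + b * Q * K * D,
    fun {Δ ds facts} hΔ h hD hg hF hf => ?_⟩
  refine ((Cost.step (flatMapT_rep (abs := fun f => (f.1, f.2.abs))
    (J := fun f => f.1 ∈ ds ∧ f.2.Ok Δ ds Q) (c := c₃) (l := b * Q * K) (S := fun d x =>
      ∃ kU ∈ Δ.ctors d, ∃ U ∈ kU.2, ∃ p, TPath (FactRel facts) U p ∧ x = (d, p.unfold kU.1 d))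
    hD fun d hd => flatMapT_rep (c := c₂) (l := b * Q) (S := fun kU x =>
      ∃ U ∈ kU.2, ∃ p, TPath (FactRel facts) U p ∧ x = (d, p.unfold kU.1 d))
    (h.length_ctors_le d) fun kU hkU => ?_)).imp
    fun fs hfs => ⟨hfs.1.trans (by omega), hfs.2⟩).mono (by omega)
  have hQ := h.ctor_size_le (k := kU.1) (Us := kU.2) hkU
  refine flatMapT_rep (c := c₁) (l := b)
    (S := fun U x => ∃ p, TPath (FactRel facts) U p ∧ x = (d, p.unfold kU.1 d)) (by omega)
    fun U hU => Cost.bind (hb (n := Δ.arity d) hg (by omega) hF hf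
      ((hΔ d).2 kU.1 kU.2 hkU U hU) ?_) fun ps hps => ?_
  · have := Ty.size_le_sizes hU; omega
  · refine (mapT_rep (abs := fun f : ℕ × Path => (f.1, f.2.abs))
      (J := fun f => f.1 ∈ ds ∧ f.2.Ok Δ ds Q) (g := fun p => (d, p.abs.unfold kU.1 d)) (c := c₀)
      hps.1 fun p hp => Cost.bind (b' := 0) (insertW_cost.mono (b' := c₀) ?_) fun r hr =>
        Cost.pure ⟨⟨hd, ?_⟩, ?_⟩).imp
      fun fs hfs => ⟨hfs.1, hfs.2.1, fun x => (hfs.2.2 x).trans ⟨?_, ?_⟩⟩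
    · have := hg p (hps.2.1 p hp); simp only [c₀]; omega
    · have hp' := hps.2.1 p hp
      refine ⟨hr.2.1 hp'.nodup, fun a ha => ?_, hp'.data, hp'.param⟩
      rcases (hr.2.2.1 a).1 ha with rfl | ha
      · exact ⟨hd, kU.2, hkU⟩
      · exact hp'.guard a ha
    · simp only [Path.abs, APath.unfold, hr.1]
    · rintro ⟨p, hp, rfl⟩
      exact ⟨p.abs, (hps.2.2 _).1 ⟨p, hp, rfl⟩, rfl⟩
    · rintro ⟨p, hp, rfl⟩
      obtain ⟨q, hq, rfl⟩ := (hps.2.2 _).2 hp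
      exact ⟨q, hq, rfl⟩

-- The finite universe of facts, and the summary of a datatype.

/-- All facts over given datatypes, atoms and parameters. -/
def factsOver (ds : List ℕ) (A : Finset (ℕ × ℕ × Bool)) (Q : ℕ) : Finset (ℕ × APath) :=
  (ds.toFinset ×ˢ (A.powerset ×ˢ ((Finset.univ : Finset Bool) ×ˢ
    (ds.toFinset.image Target.data ∪ (Finset.range Q).image Target.param)))).image
      fun q => (q.1, ⟨q.2.1, q.2.2.1, q.2.2.2⟩)

theorem card_factsOver_le {ds : List ℕ} {A : Finset (ℕ × ℕ × Bool)} {Q s a : ℕ}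
    (hs : ds.length ≤ s) (hA : A.card ≤ a) :
    (factsOver ds A Q).card ≤ s * (2 ^ a * (2 * (s + Q))) := by
  have hd : ds.toFinset.card ≤ s := (List.toFinset_card_le _).trans hs
  refine Finset.card_image_le.trans ?_
  rw [Finset.card_product, Finset.card_product, Finset.card_product, Finset.card_powerset]
  gcongr
  · norm_num
  · simp
  · refine (Finset.card_union_le _ _).trans (Nat.add_le_add (Finset.card_image_le.trans hd) ?_)
    exact Finset.card_image_le.trans (by simp)

theorem mem_factsOver {Δ : DataEnv} {ds : List ℕ} {Q d : ℕ} {p : Path} (hd : d ∈ ds)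
    (h : p.Ok Δ ds Q) : (d, p.abs) ∈ factsOver ds (pathAtoms Δ ds) Q := by
  refine Finset.mem_image.2 ⟨(d, p.abs.guard, p.abs.flip, p.abs.target), ?_, rfl⟩
  simp only [Finset.mem_product, List.mem_toFinset, hd, Finset.mem_powerset, Finset.mem_univ,
    Finset.mem_union, Finset.mem_image, Finset.mem_range, true_and]
  refine ⟨h.guard_subset, ?_⟩
  cases ht : p.target with
  | data d' => exact Or.inl ⟨d', h.data d' ht, ht.symm⟩
  | param i => exact Or.inr ⟨i, h.param i ht, ht.symm⟩

/-- The iteration ends because facts range over the finite set `factsOver`. Its facts are sound by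
the invariant, and they are complete because the slice is closed under unfolding. -/
theorem summaryT_cost (Q K D : ℕ) : ∃ b, ∀ {Δ : DataEnv}, Δ.Wf → Δ.Bounded Q K D → ∀ d,
    Cost (summaryT Δ d) b (fun ps => ps.length ≤ b ∧ ∃ ds : List ℕ, (∀ d' ∈ ds, InSlice Δ d d') ∧
      Rep Path.abs (fun p => p.Ok Δ ds Q ∧ p.guard.length ≤ b) ps (DPath Δ d)) := by
  obtain ⟨D', hs⟩ := sliceT_cost Q K D
  set s := D' + D
  set a := s * (K * 2)
  set M := s * (2 ^ a * (2 * (s + Q)))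
  set N := s + M
  obtain ⟨b₁, h₁⟩ := pathStepT_cost Q K s N a
  set ce := (2 * a + 2) * a + (2 * a + 2) * a + 5 + 1
  refine ⟨D' + (((0 + 1) * s + 1) +
    ((b₁ + (((ce + 1) * (b₁ + N) + 3) * b₁ + 1) + 1) * (M + 1) + ((0 + 1 + 2) * N + 1))) + 1 +
    1 * N + a, fun {Δ} hΔ h d => ?_⟩
  -- `pathStepT_cost` uses a single number for the slices and for the length of `ds`, so the slice
  -- bound is weakened to `s`.
  have h' : Δ.Bounded Q K s := fun d hd => ⟨(h d hd).1, (h d hd).2.1,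
    (h d hd).2.2.trans (by norm_cast; omega)⟩
  refine (Cost.step (Cost.bind (hs h d) fun ds hds => Cost.bind (b' :=
    ((b₁ + (((ce + 1) * (b₁ + N) + 3) * b₁ + 1) + 1) * (M + 1) + ((0 + 1 + 2) * N + 1)))
    ((mapT_cost_eq (c := 0)
    (g := fun d => ((d, ⟨[], false, .data d⟩) : ℕ × Path)) fun d _ => Cost.pure rfl).mono
    (b' := (0 + 1) * s + 1) ?_) fun init hinit => ?_)).mono (by omega)
  · have := hds.1
    gcongr
    omega
  have hlen : ds.length ≤ s := hds.1.trans (by omega)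
  have hg : ∀ p : Path, p.Ok Δ ds Q → p.guard.length ≤ a := fun p hp =>
    hp.length_le h.length_ctors_le hlen
  refine Cost.bind (closureT_cost (key := fun f : ℕ × Path => (f.1, f.2.abs))
    (U := factsOver ds (pathAtoms Δ ds) Q) (M := M) (ce := ce) (cs := b₁) (l := b₁) (L := s)
    (I := fun f => (f.1 ∈ ds ∧ f.2.Ok Δ ds Q) ∧ DPath Δ f.1 f.2.abs)
    (StepRel := fun facts fs => ∀ x, (∃ f ∈ fs, x = (f.1, f.2.abs)) ↔
      ∃ d ∈ ds, ∃ kU ∈ Δ.ctors d, ∃ U ∈ kU.2, ∃ p, TPath (FactRel facts) U p ∧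
          x = (d, p.unfold kU.1 d))
    (fun f hf => mem_factsOver hf.1.1 hf.1.2)
    (card_factsOver_le hlen (card_pathAtoms_le h.length_ctors_le hlen)) (fun f f' hf hf' => ?_)
    (fun facts hfacts hl => ?_) ?_ ?_) fun facts hfacts => ?_
  · by_cases hd : f.1 = f'.1
    · simp only [hd, if_true, Prod.mk.injEq, true_and]
      exact pathEqT_cost (hg _ hf.1.2) (hg _ hf'.1.2)
    · simp only [hd, if_false]
      exact Cost.mono (b := 1) (Cost.step (Cost.pure (by simp [hd]))) (by omega)
  · refine (h₁ hΔ h' hlen hg hl fun f hf => (hfacts f hf).1.2).imp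
      fun fs hfs => ⟨hfs.2.2, hfs.1, fun f hf => ⟨hfs.2.1 f hf, ?_⟩⟩
    obtain ⟨d', hd', kU, hkU, U, hU, p, hp, e⟩ := (hfs.2.2 _).1 ⟨f, hf, rfl⟩
    simp only [Prod.mk.injEq] at e
    rw [e.1, e.2]
    refine (DPath.closed Δ).2 _ _ _ _ _ hkU hU (hp.mono fun d₁ _ x hx => ?_)
    obtain ⟨f', hf', rfl, rfl⟩ := hx
    exact (hfacts f' hf').2
  · rw [hinit]
    refine List.forall_mem_map.2 fun d' hd' => ⟨⟨hd', by simp, by simp, ?_, by simp⟩,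
      (DPath.closed Δ).1 d'⟩
    rintro _ ⟨⟩
    exact hd'
  · rw [hinit]; simpa using hlen
  -- Induction on paths, relative to the slice: the family of facts, extended by everything outside
  -- `ds`, is closed. By `TPath.mono` only the datatypes in the unfolded argument type matter, and
  -- these lie in the slice again.
  · have hfact : ∀ d₁ p, DPath Δ d₁ p → d₁ ∈ ds → FactRel facts d₁ p := by
      intro d₁ p hp
      refine hp (fun d₁ p => d₁ ∈ ds → FactRel facts d₁ p) ⟨fun d₁ hd₁ => ?_,
        fun d₁ k Us U p hk hU hp hd₁ => ?_⟩
      · refine ⟨(d₁, ⟨[], false, .data d₁⟩), hfacts.2.init _ ?_, rfl, rfl⟩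
        rw [hinit]
        exact List.mem_map.2 ⟨d₁, hd₁, rfl⟩
      · obtain ⟨fs, h2, h3⟩ := hfacts.2.closed
        have hp' : TPath (FactRel facts) U p := hp.mono fun d₂ hd₂ q hq =>
          hq ((hds.2 _).2 (.step ((hds.2 _).1 hd₁) hk hU hd₂))
        obtain ⟨f, hf, e⟩ := (h2 _).2 ⟨d₁, hd₁, (k, Us), hk, U, hU, p, hp', rfl⟩
        obtain ⟨f', hf', e'⟩ := List.mem_map.1 (h3 f hf)
        rw [← e', Prod.mk.injEq] at e
        exact ⟨f', hf', e.1.symm, e.2⟩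
    refine (flatMapT_rep (abs := Path.abs) (J := fun p => p.Ok Δ ds Q ∧ p.guard.length ≤ a)
      (c := 0) (l := 1) (S := fun f x => f.1 = d ∧ x = f.2.abs) hfacts.1 fun f hf => ?_).imp
      fun ps hps => ⟨hps.1.trans (by omega), ds, fun d' => (hds.2 d').1,
        fun p hp => ⟨(hps.2.1 p hp).1, (hps.2.1 p hp).2.trans (by omega)⟩,
        fun x => (hps.2.2 x).trans ⟨?_, fun hx => ?_⟩⟩
    · have hok := (hfacts.2.inv f hf).1.2
      by_cases hd : f.1 = d
      · simp only [hd, if_true]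
        exact Cost.pure ⟨by simp, by simpa using ⟨hok, hg _ hok⟩, fun x => by simp⟩
      · simp only [hd, if_false]
        exact Cost.pure ⟨by simp, by simp, fun x => by simp⟩
    · rintro ⟨f, hf, rfl, rfl⟩
      exact (hfacts.2.inv f hf).2
    · exact hfact d x hx ((hds.2 d).2 .refl)

/-! ### Subtype constraints -/

/-- If `lo = hi`, the atoms for the two labels coincide. The union with the empty list removes the
resulting repetitions. -/
theorem pathGuardT_cost {lo hi g : ℕ} {p : Path} (hp : p.guard.length ≤ g) :
    Cost (pathGuardT lo hi p.guard) (((0 + 1) * g + 1) + ((2 * (g + 0) + 3) * g + 1) + 1)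
      (fun φ => φ.toFinset = guardOf lo hi p.abs.guard ∧ φ.Nodup ∧ φ.length ≤ g ∧
        ∀ a ∈ φ, (a.X = lo ∨ a.X = hi) ∧ ∃ x ∈ p.guard, a.k = x.1 ∧ a.d = x.2.1) := by
  refine Cost.step (Cost.bind ((mapT_cost_eq (c := 0) (g := fun a : ℕ × ℕ × Bool =>
    (⟨a.1, if a.2.2 then hi else lo, a.2.1⟩ : Atom)) fun a _ => Cost.pure rfl).mono
      (by gcongr)) fun as has => Cost.bind (b' := 0)
    (unionW_cost.mono (b' := (2 * (g + 0) + 3) * g + 1) ?_) fun r hr => Cost.pure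
      ⟨?_, hr.2.1 (by simp), ?_, fun a ha => ?_⟩)
  · have : as.length ≤ g := by rw [has]; simpa using hp
    simp only [List.length_nil]
    gcongr
  · rw [hr.1, has]
    ext a
    simp [guardOf, Path.abs]
  · have := hr.2.2.2
    rw [has] at this
    simp only [List.length_map, List.length_nil] at this
    omega
  · rcases (hr.2.2.1 a).1 ha with ha | ha
    · rw [has] at ha
      obtain ⟨x, hx, rfl⟩ := List.mem_map.1 ha
      refine ⟨?_, x, hx, rfl, rfl⟩
      by_cases h : x.2.2 = true
      · exact Or.inr (by simp only [h, if_true])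
      · exact Or.inl (by simp only [h]; rfl)
    · simp at ha

/-- The datatype case of `subT`, given the paths and the constraints for the type arguments in both
directions: `Cs` serves the paths of positive polarity and `Cs'` the reversed ones. By
`subGen_data_iff`, summing over all paths gives everything. -/
theorem pathConstrs_cost (s : ℕ) : ∃ b, ∀ {Δ : DataEnv} {Q lo hi d : ℕ} {ds : List ℕ}
    {Ts Ts' : List XTy} {Cs Cs' : List (List RC)} {paths : List Path} {p : ℕ → ℕ → Prop}
    {kss : ℕ → List ℕ → Prop},
    (∀ d' ∈ ds, p lo d' ∧ p hi d') → paths.length ≤ s → Cs.length ≤ s → Cs'.length ≤ s →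
    Ts.length = Ts'.length → Ts.length = Cs.length → Ts.length = Cs'.length →
    (∀ (i : ℕ) T T' C, Ts[i]? = some T → Ts'[i]? = some T' → Cs[i]? = some C →
      CSet p Δ.IsCtor kss s C ∧ absSet C = {c | SubGen Δ T T' c}) →
    (∀ (i : ℕ) T T' C, Ts[i]? = some T → Ts'[i]? = some T' → Cs'[i]? = some C →
      CSet p Δ.IsCtor kss s C ∧ absSet C = {c | SubGen Δ T' T c}) →
    Rep Path.abs (fun q => q.Ok Δ ds Q ∧ q.guard.length ≤ s) paths (DPath Δ d) →
    Cost (flatMapT (fun q : Path => do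
        let φ ← pathGuardT lo hi q.guard
        match q.target with
        | .data d₁ =>
          if q.flip then pure [⟨φ, .sub hi lo d₁⟩] else pure [⟨φ, .sub lo hi d₁⟩]
        | .param i => do
          let Ci ← getT (if q.flip then Cs' else Cs) i
          guardByT φ (Ci.getD [])) paths) b
      (fun C => CSet p Δ.IsCtor kss b C ∧
        absSet C = {c | SubGen Δ (.data lo d Ts) (.data hi d Ts') c}) := by
  obtain ⟨bg, hg⟩ := guardByT_cost s
  set c₀ := ((0 + 1) * s + 1) + ((2 * (s + 0) + 3) * s + 1) + 1
  set c₁ := c₀ + ((s + 1) + bg)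
  refine ⟨(c₁ + (bg + 1) + 2) * s + 1 + (bg + 1) * s + (bg + s),
    fun {Δ Q lo hi d ds Ts Ts' Cs Cs' paths p kss} hds hp hCs hCs' hl hlC hlC' hC hC' hrep => ?_⟩
  refine ((flatMapT_rep (abs := Constr.abs) (J := fun c => c.Ok p Δ.IsCtor kss ∧ c.Small (bg + s))
    (c := c₁) (l := bg + 1) (S := fun q c => Denotes (SubGen Δ) lo hi Ts Ts' q.abs c) hp
    fun q hq => ?_).imp fun C hC => ⟨⟨hC.1.trans (by omega), fun c hc => (hC.2.1 c hc).1,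
      fun c hc => (hC.2.1 c hc).2.mono (by omega)⟩, ?_⟩).mono (by omega)
  · obtain ⟨hq1, hq2⟩ := hrep.1 q hq
    refine Cost.bind (pathGuardT_cost hq2) fun φ hφ => ?_
    have hφ' : ∀ a ∈ φ, p a.X a.d ∧ Δ.IsCtor a.k a.d := fun a ha => by
      obtain ⟨h1, x, hx, h2, h3⟩ := hφ.2.2.2 a ha
      obtain ⟨h4, h5⟩ := hq1.guard x hx
      rw [h2, h3]
      refine ⟨?_, h5⟩
      rcases h1 with h1 | h1 <;> rw [h1]
      · exact (hds _ h4).1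
      · exact (hds _ h4).2
    cases ht : q.target with
    | data d₁ =>
      have hd₁ := hds _ (hq1.data d₁ ht)
      have key : ∀ u v, (u = lo ∧ v = hi ∨ u = hi ∧ v = lo) →
          Body.sub u v d₁ = (if q.flip then Body.sub hi lo d₁ else .sub lo hi d₁ : Body (Finset ℕ)) →
          Cost (pure [⟨φ, .sub u v d₁⟩] : Timed (List RC)) ((s + 1) + bg) (fun ys =>
            ys.length ≤ bg + 1 ∧ Rep Constr.abs (fun c => c.Ok p Δ.IsCtor kss ∧ c.Small (bg + s)) ys
              fun c => Denotes (SubGen Δ) lo hi Ts Ts' q.abs c) := fun u v huv hb => by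
        refine Cost.pure ⟨by simp, ?_, fun c => ?_⟩
        · rw [List.forall_mem_singleton]
          refine ⟨⟨hφ.2.1, hφ', ?_⟩, hφ.2.2.1.trans (by omega), trivial, trivial⟩
          rcases huv with ⟨rfl, rfl⟩ | ⟨rfl, rfl⟩
          · exact hd₁
          · exact hd₁.symm
        · refine Iff.trans ?_ (denotes_data (p := q.abs) (d := d₁) ht).symm
          simp only [List.mem_singleton, exists_eq_left, Constr.abs, Body.map, hφ.1, hb]
          rfl
      simp only
      cases hf : q.flip <;> rw [hf] at key
      · exact key _ _ (by simp) (by simp)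
      · exact key _ _ (by simp) (by simp)
    | param i =>
      simp only
      have key : ∀ E : List (List RC), E.length ≤ s → Ts.length = E.length →
          (∀ (i : ℕ) T T' C, Ts[i]? = some T → Ts'[i]? = some T' → E[i]? = some C →
            CSet p Δ.IsCtor kss s C ∧
            absSet C = {c | if q.flip then SubGen Δ T' T c else SubGen Δ T T' c}) →
          Cost (do
            let Ci ← getT E i
            guardByT φ (Ci.getD [])) ((s + 1) + bg) (fun ys =>
            ys.length ≤ bg + 1 ∧ Rep Constr.abs (fun c => c.Ok p Δ.IsCtor kss ∧ c.Small (bg + s)) ys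
              fun c => Denotes (SubGen Δ) lo hi Ts Ts' q.abs c) := fun E hE hlE hEC => by
        refine Cost.bind (getT_cost.mono (by omega)) fun Ci hCi => ?_
        have hset : CSet p Δ.IsCtor kss s (Ci.getD []) ∧ ∀ c', c' ∈ absSet (Ci.getD []) ↔
            ∃ T T', Ts[i]? = some T ∧ Ts'[i]? = some T' ∧
              if q.flip then SubGen Δ T' T c' else SubGen Δ T T' c' := by
          subst hCi
          by_cases hi : i < Ts.length
          · have h1 : Ts[i]? = some Ts[i] := List.getElem?_eq_getElem hi
            have h2 : Ts'[i]? = some (Ts'[i]'(by omega)) := List.getElem?_eq_getElem (by omega)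
            have h3 : E[i]? = some (E[i]'(by omega)) := List.getElem?_eq_getElem (by omega)
            obtain ⟨h4, h5⟩ := hEC i _ _ _ h1 h2 h3
            rw [h3, Option.getD_some]
            refine ⟨h4, fun c' => ?_⟩
            rw [h5]
            constructor
            · exact fun h => ⟨_, _, h1, h2, h⟩
            · rintro ⟨T, T', h6, h7, h⟩
              rw [h1] at h6
              rw [h2] at h7
              cases h6; cases h7
              exact h
          · have h1 : Ts[i]? = none := List.getElem?_eq_none (by omega)
            have h3 : E[i]? = none := List.getElem?_eq_none (by omega)
            rw [h3, h1]
            refine ⟨CSet.nil, fun c' => ⟨?_, ?_⟩⟩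
            · rintro ⟨_, h, _⟩; simp at h
            · rintro ⟨_, _, h, _⟩; simp at h
        refine (hg hφ.2.2.1 hφ' hset.1).imp fun ys hys => ⟨hys.1.length_le.trans (by omega),
          fun c hc => ⟨hys.1.ok c hc, (hys.1.small c hc).mono (by omega)⟩, fun c => ?_⟩
        have : (∃ y ∈ ys, c = y.abs) ↔ c ∈ absSet ys := Iff.rfl
        rw [this, hys.2]
        refine Iff.trans ?_ (denotes_param (p := q.abs) (i := i) ht).symm
        simp only [guardBy, Set.mem_ofPred_eq]
        constructor
        · rintro ⟨c', h, rfl⟩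
          obtain ⟨T, T', h1, h2, h3⟩ := (hset.2 c').1 h
          exact ⟨T, T', c', h1, h2, h3, by rw [hφ.1]⟩
        · rintro ⟨T, T', c', h1, h2, h3, rfl⟩
          exact ⟨c', (hset.2 c').2 ⟨T, T', h1, h2, h3⟩, by rw [hφ.1]⟩
      cases hf : q.flip <;> rw [hf] at key
      · exact key Cs hCs hlC (by simpa using hC)
      · exact key Cs' hCs' hlC' (by simpa using hC')
  · ext c
    refine (hC.2.2 c).trans ?_
    rw [Set.mem_ofPred_eq, subGen_data_iff]
    constructor
    · rintro ⟨q, hq, h⟩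
      exact ⟨q.abs, (hrep.2 _).1 ⟨q, hq, rfl⟩, h⟩
    · rintro ⟨x, hx, h⟩
      obtain ⟨q, hq, rfl⟩ := (hrep.2 x).2 hx
      exact ⟨q, hq, h⟩

theorem subsT_cost {Δ : DataEnv} {p : Bool} {b : ℕ} {R : XTy → XTy → List RC → Prop} :
    ∀ {ts ts' : List XTy}, ts.map Ty.under = ts'.map Ty.under →
    (∀ t ∈ ts, ∀ t' ∈ ts', t.under = t'.under → Cost (subT Δ p t t') b (R t t')) →
    Cost (subsT Δ p ts ts') ((b + 1) * ts.length + 1) (fun Cs => ts.length = Cs.length ∧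
      ∀ (i : ℕ) t t' C, ts[i]? = some t → ts'[i]? = some t' → Cs[i]? = some C → R t t' C)
  | [], [], _, _ => by
    unfold subsT
    exact Cost.step (Cost.pure (by simp))
  | [], _ :: _, h, _ => by simp at h
  | _ :: _, [], h, _ => by simp at h
  | t :: ts, t' :: ts', h, hc => by
    simp only [List.map_cons, List.cons.injEq] at h
    unfold subsT
    refine (Cost.step (Cost.bind (hc t (by simp) t' (by simp) h.1) fun C hC => Cost.bind (b' := 0)
      (subsT_cost h.2 fun u hu u' hu' => hc u (by simp [hu]) u' (by simp [hu'])) fun Cs hCs =>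
      Cost.pure ⟨by simp [hCs.1], ?_⟩)).mono ?_
    · simp only [List.length_cons, Nat.mul_add]; omega
    · rintro (_ | i) u u' E h1 h2 h3
      · simp only [List.getElem?_cons_zero, Option.some.injEq] at h1 h2 h3
        rwa [← h1, ← h2, ← h3]
      · simp only [List.getElem?_cons_succ] at h1 h2 h3
        exact hCs.2 i u u' E h1 h2 h3

/-- Two closure properties of `p` are enough: it holds of the labels of both types and passes to
slices, which contain all datatypes that unfolding reaches. The flag reverses the inequality without
exchanging the arguments, so bounding the size of the first type controls the recursion in both
directions. -/
theorem subT_cost (Q K D s : ℕ) : ∃ b, ∀ {Δ : DataEnv} {p : ℕ → ℕ → Prop} {kss : ℕ → List ℕ → Prop}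
    (f : Bool) (T₁ T₂ : XTy), Δ.Wf → Δ.Bounded Q K D →
    (∀ X d d', p X d → InSlice Δ d d' → p X d') → T₁.under = T₂.under → T₁.size ≤ s →
    (∀ q ∈ T₁.labels, p q.1 q.2) → (∀ q ∈ T₂.labels, p q.1 q.2) →
    Cost (subT Δ f T₁ T₂) b (fun C => (CSet p Δ.IsCtor kss b C ∧
      absSet C = {c | if f then SubGen Δ T₂ T₁ c else SubGen Δ T₁ T₂ c}) ∧
      (C.map Constr.abs).Nodup) := by
  induction s with
  | zero => exact ⟨0, fun {_ _ _} _ T₁ _ _ _ _ _ h => by have := T₁.size_pos; omega⟩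
  | succ s ih =>
    obtain ⟨b, hb⟩ := ih
    obtain ⟨bu, hu⟩ := unionC_cost b
    obtain ⟨bs, hs⟩ := summaryT_cost Q K D
    obtain ⟨bp, hp⟩ := pathConstrs_cost (s + b + bs)
    obtain ⟨bv, hv⟩ := unionC_cost bp
    refine ⟨1 + (b + (b + bu)) + (((b + 1) * s + 1) + (((b + 1) * s + 1) + (bs + (bp + bv)))),
      fun {Δ p kss} f T₁ T₂ hΔ hB hp' hT hsize h1 h2 => ?_⟩
    cases T₁ with
    | var a =>
      cases T₂ <;> simp only [Ty.under, Ty.relabel, reduceCtorEq, Ty.var.injEq] at hT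
      unfold subT
      simp only [hT, if_true]
      refine Cost.mono (b := 1) (Cost.step (Cost.pure ⟨⟨CSet.nil, ?_⟩, by simp⟩)) (by omega)
      ext c
      simp only [absSet, List.not_mem_nil, false_and, exists_false, Set.mem_ofPred_eq, false_iff]
      intro h
      cases f <;> simp at h <;> cases h
    | base a =>
      cases T₂ <;> simp only [Ty.under, Ty.relabel, reduceCtorEq, Ty.base.injEq] at hT
      unfold subT
      simp only [hT, if_true]
      refine Cost.mono (b := 1) (Cost.step (Cost.pure ⟨⟨CSet.nil, ?_⟩, by simp⟩)) (by omega)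
      ext c
      simp only [absSet, List.not_mem_nil, false_and, exists_false, Set.mem_ofPred_eq, false_iff]
      intro h
      cases f <;> simp at h <;> cases h
    | arr t u =>
      cases T₂ <;> simp only [Ty.under, Ty.relabel, reduceCtorEq, Ty.arr.injEq] at hT
      rename_i t' u'
      simp only [Ty.size] at hsize
      simp only [Ty.labels, List.mem_append] at h1 h2
      unfold subT
      refine (Cost.step (Cost.bind (hb (p := p) (kss := kss) (!f) t t' hΔ hB hp' hT.1 (by omega)
        (fun q hq => h1 q (Or.inl hq)) fun q hq => h2 q (Or.inl hq)) fun C hC => Cost.bind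
        (hb (p := p) (kss := kss) f u u' hΔ hB hp' hT.2 (by omega) (fun q hq => h1 q (Or.inr hq))
          fun q hq => h2 q (Or.inr hq)) fun C' hC' => Cost.bind (b' := 0) (hu hC.1.1 hC'.1.1)
          fun r hr => Cost.pure ⟨⟨hr.1.mono (by omega), ?_⟩, hr.2.2 hC'.2⟩)).mono (by omega)
      rw [hr.2.1, hC.1.2, hC'.1.2]
      ext c
      simp only [Set.mem_union, Set.mem_ofPred_eq]
      cases f with
      | false =>
        simp only [Bool.not_false, if_true, Bool.false_eq_true, if_false]
        constructor
        · rintro (h | h)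
          · exact .arrL h
          · exact .arrR h
        · intro h
          cases h with
          | arrL h => exact Or.inl h
          | arrR h => exact Or.inr h
      | true =>
        simp only [Bool.not_true, if_true, Bool.false_eq_true, if_false]
        constructor
        · rintro (h | h)
          · exact .arrL h
          · exact .arrR h
        · intro h
          cases h with
          | arrL h => exact Or.inl h
          | arrR h => exact Or.inr h
    | data X d ts =>
      cases T₂ <;> simp only [Ty.under, Ty.relabel, reduceCtorEq, Ty.data.injEq, true_and] at hT
      rename_i Y d' ts'
      obtain ⟨rfl, hT⟩ := hT
      rw [Ty.relabels_eq, Ty.relabels_eq] at hT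
      simp only [Ty.size] at hsize
      have hlen := Ty.length_le_sizes ts
      have hll : ts.length = ts'.length := by simpa using congrArg List.length hT
      simp only [Ty.labels, Ty.labelss_eq, List.mem_cons, List.mem_flatMap] at h1 h2
      have hX := h1 (X, d) (Or.inl rfl)
      have hY := h2 (Y, d) (Or.inl rfl)
      have hsub : ∀ g : Bool, Cost (subsT Δ g ts ts') ((b + 1) * s + 1) (fun Cs =>
          ts.length = Cs.length ∧ ∀ (i : ℕ) t t' C, ts[i]? = some t → ts'[i]? = some t' →
            Cs[i]? = some C → (CSet p Δ.IsCtor kss b C ∧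
              absSet C = {c | if g then SubGen Δ t' t c else SubGen Δ t t' c}) ∧
              (C.map Constr.abs).Nodup) := fun g => by
        refine (subsT_cost hT fun t ht t' ht' htt' => hb g t t' hΔ hB hp' htt' ?_
          (fun q hq => h1 q (Or.inr ⟨t, ht, hq⟩)) fun q hq => h2 q (Or.inr ⟨t', ht', hq⟩)).mono ?_
        · have := Ty.size_le_sizes ht; omega
        · gcongr; omega
      unfold subT
      simp only [if_true]
      refine Cost.mono (b := ((b + 1) * s + 1) + (((b + 1) * s + 1) + (bs + (bp + bv))) + 1)
        (Cost.step (Cost.bind (hsub f) fun Cs hCs => Cost.bind (hsub (!f)) fun Cs' hCs' =>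
        Cost.bind (hs hΔ hB d) fun paths hpaths => ?_)) (by omega)
      obtain ⟨hpl, ds, hds, hrep⟩ := hpaths
      have hrep' : Rep Path.abs (fun q => q.Ok Δ ds Q ∧ q.guard.length ≤ s + b + bs) paths
        (DPath Δ d) := ⟨fun q hq => ⟨(hrep.1 q hq).1, (hrep.1 q hq).2.trans (by omega)⟩, hrep.2⟩
      refine Cost.bind (P := fun C => CSet p Δ.IsCtor kss bp C ∧ absSet C = {c | if f then
        SubGen Δ (.data Y d ts') (.data X d ts) c else SubGen Δ (.data X d ts) (.data Y d ts') c})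
        ?_ fun C hC => Cost.bind (b' := 0) (hv hC.1 CSet.nil) fun r hr =>
        Cost.pure ⟨⟨hr.1.mono (by omega), ?_⟩, hr.2.2 (by simp)⟩
      · cases f with
        | false =>
          exact hp (Cs := Cs) (Cs' := Cs')
            (fun d' hd' => ⟨hp' _ _ _ hX (hds d' hd'), hp' _ _ _ hY (hds d' hd')⟩)
            (by omega) (by omega) (by omega) hll hCs.1 hCs'.1
            (fun i T T' C e1 e2 e3 => by
              have := (hCs.2 i T T' C e1 e2 e3).1
              exact ⟨this.1.mono (by omega), by simpa using this.2⟩)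
            (fun i T T' C e1 e2 e3 => by
              have := (hCs'.2 i T T' C e1 e2 e3).1
              exact ⟨this.1.mono (by omega), by simpa using this.2⟩) hrep'
        | true =>
          -- With the flag set, the smaller side is `inj_Y d ts'`; the labels and argument lists
          -- change places, and `Cs`, computed with the same flag, is again the list for positive
          -- polarity.
          exact hp (Cs := Cs) (Cs' := Cs')
            (fun d' hd' => ⟨hp' _ _ _ hY (hds d' hd'), hp' _ _ _ hX (hds d' hd')⟩)
            (by omega) (by omega) (by omega) hll.symm (hll ▸ hCs.1) (hll ▸ hCs'.1)
            (fun i T T' C e1 e2 e3 => by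
              have := (hCs.2 i T' T C e2 e1 e3).1
              exact ⟨this.1.mono (by omega), by simpa using this.2⟩)
            (fun i T T' C e1 e2 e3 => by
              have := (hCs'.2 i T' T C e2 e1 e3).1
              exact ⟨this.1.mono (by omega), by simpa using this.2⟩) hrep'
      · rw [hr.2.1, hC.2]
        have : absSet ([] : List RC) = ∅ := by
          ext; simp [absSet]
        rw [this, Set.union_empty]

/-! ## Inference for expressions -/

/-- Stored sets of constructors of `d`. -/
def CtorSet (Δ : DataEnv) (d : ℕ) (ks : List ℕ) : Prop := ks.Nodup ∧ ∀ k ∈ ks, Δ.IsCtor k d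

theorem absSet_nil : absSet [] = ∅ := by ext; simp [absSet]

theorem absSet_singleton (c : RC) : absSet [c] = {c.abs} := by ext; simp [absSet]

theorem Owns.slice {Δ : DataEnv} {T : XTy} {X d d' : ℕ} (h : Owns Δ T X d)
    (h' : InSlice Δ d d') : Owns Δ T X d' := by
  obtain ⟨d₀, h1, h2⟩ := h
  exact ⟨d₀, h1, h2.trans h'⟩

theorem Scheme.Wf.ok {Δ : DataEnv} {s : Scheme (List RC)} (h : s.Wf Δ) :
    ∀ c ∈ s.cs, c.Ok (Owns Δ s.ty) Δ.IsCtor (CtorSet Δ) := fun c hc => by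
  obtain ⟨h1, h2, h3⟩ := h.2.2.2.2 c hc
  refine ⟨h1, h2, ?_⟩
  cases e : c.body <;> rw [e] at h3 <;> exact h3

/-- Constraints over the refinement variables of a type are bounded in size and in number. -/
theorem exists_cset_bound (Q K D : ℕ) : ∃ b, ∀ {Δ : DataEnv} {T : XTy} {C : List RC},
    Δ.Bounded Q K D → T.size ≤ Q →
    (∀ c ∈ C, c.Ok (Owns Δ T) Δ.IsCtor (CtorSet Δ)) → (C.map Constr.abs).Nodup →
    CSet (Owns Δ T) Δ.IsCtor (CtorSet Δ) b C := by
  classical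
  set p := Q * (D + 1)
  set a := p * K
  refine ⟨2 ^ (p * a) * (p * p + p * 2 ^ a + p * a + 1) + p * a + a,
    fun {Δ T C} hB hT hC hn => ?_⟩
  choose sl hsl hsl' using fun d => hB.exists_slice d
  let P : Finset (ℕ × ℕ) :=
    T.labels.toFinset.biUnion fun q => (sl q.2).image fun d => (q.1, d)
  let A : Finset ℕ := P.biUnion fun q => ((Δ.ctors q.2).map Prod.fst).toFinset
  have hPm : ∀ X d, Owns Δ T X d → (X, d) ∈ P := by
    rintro X d ⟨d₀, h1, h2⟩
    simp only [P, Finset.mem_biUnion, List.mem_toFinset, Finset.mem_image]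
    exact ⟨_, h1, d, (hsl' _ _).2 h2, rfl⟩
  have hP : P.card ≤ p := by
    refine (Finset.card_biUnion_le_card_mul _ _ (D + 1) fun q _ =>
      Finset.card_image_le.trans (hsl _)).trans ?_
    have h1 := List.toFinset_card_le T.labels
    have h2 := T.length_labels_le
    exact Nat.mul_le_mul_right _ (by omega)
  have hA : A.card ≤ a := by
    refine (Finset.card_biUnion_le_card_mul _ _ K fun q _ =>
      (List.toFinset_card_le _).trans ?_).trans (Nat.mul_le_mul_right _ hP)
    simpa using hB.length_ctors_le q.2
  have hAm : ∀ X k d, Owns Δ T X d → Δ.IsCtor k d → k ∈ A := by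
    rintro X k d h1 ⟨Us, h2⟩
    simp only [A, Finset.mem_biUnion, List.mem_toFinset, List.mem_map]
    exact ⟨_, hPm X d h1, (k, Us), h2, rfl⟩
  have hok : ∀ c ∈ C, c.Ok (fun X d => (X, d) ∈ P) (fun k _ => k ∈ A)
      (fun _ ks => ks.toFinset ∈ A.powerset ∧ ks.length ≤ a) := fun c hc => by
    have h := hC c hc
    refine ⟨h.nodup, fun x hx => ⟨hPm _ _ (h.guard x hx).1, hAm _ _ _ (h.guard x hx).1
      (h.guard x hx).2⟩, ?_⟩
    have hb := h.body
    cases e : c.body <;> rw [e] at hb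
    · exact ⟨hPm _ _ hb.1, hPm _ _ hb.2⟩
    · have hsub : List.toFinset _ ⊆ A := fun k hk =>
        hAm _ _ _ hb.1 (hb.2.2 k (List.mem_toFinset.1 hk))
      refine ⟨hPm _ _ hb.1, Finset.mem_powerset.2 hsub, ?_⟩
      rw [← List.toFinset_card_of_nodup hb.2.1]
      exact (Finset.card_le_card hsub).trans hA
    · exact ⟨hPm _ _ hb.1, hAm _ _ _ hb.1 hb.2⟩
    · trivial
  refine ⟨?_, hC, fun c hc => ⟨(length_guard_le hP hA (hok c hc)).trans (by omega),
    (hok c hc).body.imp (fun _ _ _ => trivial) (fun _ _ _ => trivial)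
      fun _ _ h => h.2.trans (by omega)⟩⟩
  -- Without repetitions, the length of the list is the number of represented constraints, which lie
  -- in a universe of bounded cardinality.
  rw [← List.length_map (f := Constr.abs), ← List.toFinset_card_of_nodup hn]
  refine (Finset.card_le_card (t := constrsOver P A A.powerset) fun x hx => ?_).trans
    ((card_constrsOver hP hA (b := 2 ^ a) ?_).trans (by omega))
  · obtain ⟨c, hc, rfl⟩ := List.mem_map.1 (List.mem_toFinset.1 hx)
    exact abs_mem_constrsOver (fun _ _ h => h.1) (hok c hc)
  · rw [Finset.card_powerset]
    exact Nat.pow_le_pow_right (by norm_num) hA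

/-- The assumptions of inference on its context, whose local part is bounded by `g`. The relation
`p X d` bounds the pairs `X(d)` in the constraints; it is arbitrary on fresh variables. -/
structure Ctx (Q K D g : ℕ) (Δ : DataEnv) (cstTy : ℕ → Ty Empty) (G : Array (Scheme (List RC)))
    (p : ℕ → ℕ → Prop) (n : ℕ) (Γ : List XTy) : Prop where
  wf : Δ.Wf
  bounded : Δ.Bounded Q K D
  cst : ∀ a, (cstTy a).size ≤ Q
  scheme : ∀ s ∈ G.toList, s.Wf Δ ∧ s.ty.size ≤ Q
  slice : ∀ X d d', p X d → InSlice Δ d d' → p X d'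
  fresh : ∀ X d, n ≤ X → p X d
  length_le : Γ.length ≤ g
  size_le : ∀ T ∈ Γ, T.size ≤ g
  labels : ∀ T ∈ Γ, ∀ q ∈ T.labels, p q.1 q.2

/-- The underlying schemes of the top-level names. -/
def underEnv (G : Array (Scheme (List RC))) : List (ℕ × UTy) :=
  G.toList.map fun s => (s.nty, s.ty.under)

/-- The result `r` of inference for an expression of type `U` is correct and bounded by `b`. -/
structure InferPost (b : ℕ) (Δ : DataEnv) (cstTy : ℕ → Ty Empty) (G : Array (Scheme (List RC)))
    (p : ℕ → ℕ → Prop) (Γ : List XTy) (e : Exp) (n : ℕ) (U : UTy) (r : XTy × List RC × ℕ) :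
    Prop where
  under : r.1.under = U
  size_le : r.1.size ≤ b
  labels : ∀ q ∈ r.1.labels, p q.1 q.2
  cset : CSet p Δ.IsCtor (CtorSet Δ) b r.2.1
  le : n ≤ r.2.2
  infers : Infers Δ cstTy (G.toList.map Scheme.abs) Γ e n r.1 (absSet r.2.1) r.2.2

/-- Inference for `e` is correct and bounded by `b` in all contexts that are bounded by `g`. -/
def InferBound (Q K D g b : ℕ) (e : Exp) : Prop :=
  ∀ {Δ : DataEnv} {cstTy : ℕ → Ty Empty} {G : Array (Scheme (List RC))} {p : ℕ → ℕ → Prop}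
    {n : ℕ} {Γ : List XTy} {nty : ℕ} {U : UTy}, Ctx Q K D g Δ cstTy G p n Γ →
    HasTy Δ cstTy (underEnv G) nty (Γ.map Ty.under) e U →
    Cost (inferT Δ cstTy G Γ e n) b (InferPost b Δ cstTy G p Γ e n U)

/-- The result `r` of inference for the branches of a match is correct and bounded by `b`. -/
structure BranchesPost (b : ℕ) (Δ : DataEnv) (cstTy : ℕ → Ty Empty)
    (G : Array (Scheme (List RC))) (p : ℕ → ℕ → Prop) (Γ : List XTy) (X d : ℕ) (Ts : List XTy)
    (T : XTy) (bs : Branches) (n : ℕ) (r : List RC × List ℕ × ℕ) : Prop where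
  cset : CSet p Δ.IsCtor (CtorSet Δ) b r.1
  keys : r.2.1.toFinset = bs.keys
  ctors : CtorSet Δ d r.2.1
  length_le : r.2.1.length ≤ b
  le : n ≤ r.2.2
  infers : InfersBranches Δ cstTy (G.toList.map Scheme.abs) Γ X d Ts T bs n (absSet r.1) r.2.2

/-- Inference for `bs` is correct and bounded by `b` in all contexts that are bounded by `g`. -/
def BranchesBound (Q K D g b : ℕ) (bs : Branches) : Prop :=
  ∀ {Δ : DataEnv} {cstTy : ℕ → Ty Empty} {G : Array (Scheme (List RC))} {p : ℕ → ℕ → Prop}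
    {n : ℕ} {Γ : List XTy} {nty X d : ℕ} {Ts : List XTy} {T : XTy},
    Ctx Q K D g Δ cstTy G p n Γ → p X d → Ts.length ≤ g →
    (∀ t ∈ Ts, t.size ≤ g ∧ ∀ q ∈ t.labels, p q.1 q.2) → T.size ≤ g →
    (∀ q ∈ T.labels, p q.1 q.2) →
    BranchesHaveTy Δ cstTy (underEnv G) nty (Γ.map Ty.under) d (Ts.map Ty.under) T.under bs →
    Cost (inferBranchesT Δ cstTy G Γ X d Ts T bs n) b
      (BranchesPost b Δ cstTy G p Γ X d Ts T bs n)

section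

variable {Q K D g b b' : ℕ} {Δ : DataEnv} {cstTy : ℕ → Ty Empty} {G : Array (Scheme (List RC))}
  {p : ℕ → ℕ → Prop} {n n' : ℕ} {Γ : List XTy} {e : Exp} {U : UTy}

theorem Ctx.next (h : Ctx Q K D g Δ cstTy G p n Γ) (hn : n ≤ n') :
    Ctx Q K D g Δ cstTy G p n' Γ :=
  { h with fresh := fun X d hX => h.fresh X d (hn.trans hX) }

theorem Ctx.extend {g' : ℕ} (h : Ctx Q K D g Δ cstTy G p n Γ) {Γ' : List XTy}
    (hl : Γ'.length + g ≤ g') (hs : ∀ T ∈ Γ', T.size ≤ g')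
    (hp : ∀ T ∈ Γ', ∀ q ∈ T.labels, p q.1 q.2) : Ctx Q K D g' Δ cstTy G p n (Γ' ++ Γ) :=
  { h with
    length_le := by have := h.length_le; rw [List.length_append]; omega
    size_le := fun T hT => (List.mem_append.1 hT).elim (hs T)
      fun hT => (h.size_le T hT).trans (by omega)
    labels := fun T hT => (List.mem_append.1 hT).elim (hp T) (h.labels T) }

theorem InferPost.mono {r : XTy × List RC × ℕ} (h : InferPost b Δ cstTy G p Γ e n U r)
    (hb : b ≤ b') : InferPost b' Δ cstTy G p Γ e n U r :=
  { h with size_le := h.size_le.trans hb, cset := h.cset.mono hb }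

theorem InferBound.mono (h : InferBound Q K D g b e) (hb : b ≤ b') : InferBound Q K D g b' e :=
  fun hc ht => ((h hc ht).imp fun _ hr => hr.mono hb).mono hb

theorem BranchesBound.mono {bs : Branches} (h : BranchesBound Q K D g b bs) (hb : b ≤ b') :
    BranchesBound Q K D g b' bs := fun h1 h2 h3 h4 h5 h6 h7 =>
  ((h h1 h2 h3 h4 h5 h6 h7).imp fun _ hr =>
    { hr with cset := hr.cset.mono hb, length_le := hr.length_le.trans hb }).mono hb

end

-- The inference rules, one by one.

/-- The last step of every rule. -/
theorem close_cost (Q K D g z : ℕ) : ∃ b, ∀ {Δ : DataEnv} {cstTy : ℕ → Ty Empty}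
    {G : Array (Scheme (List RC))} {p : ℕ → ℕ → Prop} {n n' : ℕ} {Γ : List XTy} {e : Exp} {T : XTy}
    {C : List RC}, Ctx Q K D g Δ cstTy G p n Γ → T.size ≤ z → (∀ q ∈ T.labels, p q.1 q.2) →
    CSet p Δ.IsCtor (CtorSet Δ) z C → n ≤ n' →
    Infers Δ cstTy (G.toList.map Scheme.abs) Γ e n T (close Γ T (absSet C)) n' →
    Cost (do let C ← closeT Γ T C; pure (T, C, n')) b
      (InferPost b Δ cstTy G p Γ e n T.under) := by
  obtain ⟨b, hb⟩ := closeT_cost (g + z)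
  refine ⟨b + 0 + z, fun {Δ cstTy G p n n' Γ e T C} h hT hl hC hn hi => ?_⟩
  refine (Cost.bind (b' := 0) (hb (h.length_le.trans (by omega))
    (fun U hU => (h.size_le U hU).trans (by omega)) (by omega) (hC.mono (by omega)))
    fun C' hC' => Cost.pure ⟨rfl, hT.trans (by omega), hl, hC'.1.mono (by omega), hn, ?_⟩).mono
    (by omega)
  rw [hC'.2]
  exact hi

theorem infer_cst (Q K D g : ℕ) : ∃ b, ∀ c, InferBound Q K D g b (.cst c) := by
  obtain ⟨b₁, h₁⟩ := relabelT_cost 0 Q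
  obtain ⟨b₂, h₂⟩ := close_cost Q K D g Q
  refine ⟨b₁ + b₂ + 1, fun c Δ cstTy G p n Γ nty U hc ht => ?_⟩
  cases ht
  unfold inferT
  refine Cost.step (Cost.bind (h₁ _ Empty.elim _ (fun l => l.elim) (hc.cst c)) fun T hT => ?_)
  subst hT
  refine (h₂ (e := .cst c) hc ?_ ?_ CSet.nil le_rfl ?_).imp fun r hr => ?_
  · rw [Ty.size_relabel]; exact hc.cst c
  · rw [Ty.labels_relabel]
    rintro q hq
    obtain ⟨⟨l, _⟩, _⟩ := List.mem_map.1 hq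
    exact l.elim
  · rw [absSet_nil]; exact .cst rfl
  · rw [Ty.under_relabel] at hr
    exact hr.mono (by omega)

theorem infer_lvar (Q K D g : ℕ) : ∃ b, ∀ i, InferBound Q K D g b (.lvar i) := by
  obtain ⟨b₂, h₂⟩ := close_cost Q K D g g
  refine ⟨(g + 1) + b₂ + 1, fun i Δ cstTy G p n Γ nty U hc ht => ?_⟩
  cases ht with
  | lvar ht =>
  rw [List.getElem?_map, Option.map_eq_some_iff] at ht
  obtain ⟨T, hT, rfl⟩ := ht
  have hmem := List.mem_of_getElem? hT
  unfold inferT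
  refine Cost.step (Cost.bind (getT_cost.mono (by have := hc.length_le; omega)) fun T' hT' => ?_)
  rw [hT'.trans hT]
  exact (h₂ (e := .lvar i) hc (hc.size_le T hmem) (hc.labels T hmem) CSet.nil le_rfl
    (by rw [absSet_nil]; exact .lvar hT)).imp fun r hr => hr.mono (by omega)

theorem ctors_unique {Δ : DataEnv} (h : Δ.Wf) {d k : ℕ} {Us Vs : List UTy}
    (h1 : (k, Us) ∈ Δ.ctors d) (h2 : (k, Vs) ∈ Δ.ctors d) : Us = Vs := by
  have := List.inj_on_of_nodup_map (h d).1 h1 h2 rfl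
  exact (Prod.mk.injEq _ _ _ _ ▸ this).2

theorem infer_con (Q K D g S : ℕ) : ∃ b, ∀ d k Ts, Ty.sizes Ts ≤ S →
    InferBound Q K D g b (.con d k Ts) := by
  obtain ⟨b₁, h₁⟩ := freshsT_cost' S
  obtain ⟨b₂, h₂⟩ := injT_cost Q
  obtain ⟨b₃, h₃⟩ := substT_cost (Q + S)
  obtain ⟨b₄, h₄⟩ := close_cost Q K D g (Q * (S + 1) + 1)
  refine ⟨K + (b₁ + ((Q + 3) + (b₂ + (b₃ + b₄)))) + 1,
    fun d k Ts hS Δ cstTy G p n Γ nty U hc ht => ?_⟩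
  cases ht with
  | @con _ _ Us _ _ hk hl hwf =>
  unfold inferT
  refine Cost.step (Cost.bind ((lookupCtorT_cost ⟨Us, hk⟩).mono (hc.bounded.length_ctors_le d))
    fun Us' hk' => Cost.bind (h₁ Ts (n + 1) hS) fun r hr => ?_)
  obtain rfl := ctors_unique hc.wf hk hk'
  have hQ := hc.bounded.ctor_size_le hk
  have hsz : (ctorTy Δ d Us).size ≤ Q := by rw [size_ctorTy]; exact hQ
  have hf := Ty.freshs_spec' Ts (n + 1)
  rw [← hr] at hf
  refine Cost.bind (ctorTyT_cost.mono (by omega)) fun U hU => ?_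
  subst hU
  refine Cost.bind (h₂ n _ hsz) fun V hV => ?_
  subst hV
  have hszi : ((ctorTy Δ d Us).inj n).size = (ctorTy Δ d Us).size := Ty.size_relabel _ _
  refine Cost.bind (h₃ r.1 _ ?_ (by omega)) fun T hT => ?_
  · rw [hr, Ty.length_freshs]
    have := Ty.length_le_sizes Ts
    omega
  subst hT
  have hpn : ∀ d, p n d := fun d => hc.fresh n d le_rfl
  refine (h₄ (e := .con d k Ts) hc ?_ ?_ ?_ (by omega) ?_).imp fun r hr => ?_
  · refine (Ty.size_subst_le (M := S) (fun u hu => ?_) _).trans ?_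
    · rw [hr] at hu
      exact (Ty.size_le_sizes hu).trans ((Ty.sizes_freshs Ts (n + 1)).le.trans hS)
    · rw [hszi]
      exact (Nat.mul_le_mul_right _ hsz).trans (by omega)
  · intro q hq
    rcases Ty.mem_labels_subst hq with hq | ⟨u, hu, hq⟩
    · rw [(Ty.mem_labels_inj.1 hq).1]; exact hpn _
    · exact hc.fresh _ _ ((Nat.le_succ n).trans (hf.2.2 u hu q hq))
  · refine ⟨by simp, ?_, ?_⟩
    · rw [List.forall_mem_singleton]
      exact ⟨by simp, by simp, hpn d, Us, hk⟩
    · rw [List.forall_mem_singleton]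
      exact ⟨by simp, trivial, trivial⟩
  · rw [absSet_singleton]
    exact .con hk hr rfl
  · rw [Ty.under_subst, Ty.under_inj, hf.1] at hr
    exact hr.mono (by omega)

/-- The only rule that looks at earlier definitions. The scheme has bounded size by
`exists_cset_bound`, whatever its position in the table, so instantiation takes constant time. -/
theorem infer_gvar (Q K D g S : ℕ) : ∃ b, ∀ x Ts, Ty.sizes Ts ≤ S →
    InferBound Q K D g b (.gvar x Ts) := by
  obtain ⟨b₁, h₁⟩ := freshsT_cost' S
  obtain ⟨b₂, h₂⟩ := relabelT_cost (Q + 2) Q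
  obtain ⟨b₃, h₃⟩ := substT_cost (Q + S)
  obtain ⟨bc, hbc⟩ := exists_cset_bound Q K D
  set b₅ := ((Q + 2 + 1) * bc + 1) + ((Q + 2) + (Q + 2) + 1) + 1
  obtain ⟨b₄, h₄⟩ := close_cost Q K D g (Q * (S + 1) + bc)
  refine ⟨(Q + 1) + (b₁ + (b₂ + (b₃ + (((b₅ + 1) * bc + 1) + b₄)))) + 1,
    fun x Ts hS Δ cstTy G p n Γ nty U hc ht => ?_⟩
  cases ht with
  | @gvar _ _ _ m T hx hl hwf =>
  rw [underEnv, List.getElem?_map, Option.map_eq_some_iff] at hx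
  obtain ⟨s, hx, e⟩ := hx
  simp only [Prod.mk.injEq] at e
  obtain ⟨rfl, rfl⟩ := e
  obtain ⟨hs, hsQ⟩ := hc.scheme s (List.mem_of_getElem? hx)
  have hx' : G[x]? = some s := by rw [← Array.getElem?_toList]; exact hx
  have hC := hbc hc.bounded hsQ hs.ok hs.2.2.2.1
  have hqs : s.qs.length ≤ Q :=
    ((hs.2.1.subperm fun X hX => (hs.2.2.1 X).1 hX).length_le.trans s.ty.length_frv_le).trans hsQ
  unfold inferT
  refine Cost.step ?_
  rw [hx']
  refine Cost.bind (lengthT_cost.mono (by omega)) fun q hq => Cost.bind (h₁ Ts _ hS) fun r hr => ?_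
  subst hq
  have hf := Ty.freshs_spec' Ts (n + s.qs.length)
  rw [← hr] at hf
  set ρ : ℕ → ℕ := fun X => n + s.qs.idxOf X with hρ
  have hren : ∀ X, Cost (renameT n s.qs X) (Q + 2) (fun Y => Y = ρ X) := fun X =>
    (renameT_cost X).mono (by omega)
  refine Cost.bind (h₂ _ ρ s.ty hren hsQ) fun V hV => ?_
  subst hV
  have hszr : (s.ty.relabel ρ).size = s.ty.size := Ty.size_relabel _ _
  refine Cost.bind (h₃ r.1 _ ?_ (by omega)) fun T hT => ?_
  · rw [hr, Ty.length_freshs]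
    have := Ty.length_le_sizes Ts
    omega
  subst hT
  refine Cost.bind ((mapT_cost_eq (c := b₅) (g := renameRC ρ) fun c hcs =>
    renameConstrT_cost hren (hC.small c hcs).1).mono ?_) fun C₀ hC₀ => ?_
  · have := hC.length_le
    gcongr
  subst hC₀
  -- All variables of the constraints are quantified, so the renaming by positions in `s.qs` is
  -- injective on them and yields fresh variables, where `p` holds.
  have hown : ∀ X d, Owns Δ s.ty X d → X ∈ s.qs := fun X d ⟨d₀, h, _⟩ =>
    (hs.2.2.1 X).2 (Ty.mem_frv.2 ⟨d₀, h⟩)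
  refine (h₄ (e := .gvar x Ts) hc ?_ ?_ ((hC.rename (p' := p) (ρ := ρ) ?_ ?_).mono (by omega)) (by omega) ?_).imp
    fun r' hr' => ?_
  · refine (Ty.size_subst_le (M := S) (fun u hu => ?_) _).trans ?_
    · rw [hr] at hu
      exact (Ty.size_le_sizes hu).trans ((Ty.sizes_freshs Ts _).le.trans hS)
    · rw [hszr]
      exact (Nat.mul_le_mul_right _ hsQ).trans (by omega)
  · intro q hq
    rcases Ty.mem_labels_subst hq with hq | ⟨u, hu, hq⟩
    · rw [Ty.labels_relabel] at hq
      obtain ⟨q', _, rfl⟩ := List.mem_map.1 hq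
      exact hc.fresh _ _ (Nat.le_add_right _ _)
    · exact hc.fresh _ _ ((Nat.le_add_right _ _).trans (hf.2.2 u hu q hq))
  · intro X d Y d' hX hY e
    exact (List.idxOf_inj (hown X d hX)).1 (Nat.add_left_cancel e)
  · exact fun X d _ => hc.fresh _ _ (Nat.le_add_right _ _)
  · rw [absSet_rename]
    have hG : (G.toList.map Scheme.abs)[x]? = some s.abs := by simp [hx]
    exact .gvar hG rfl hr rfl
  · rw [Ty.under_subst, Ty.under_relabel, hf.1] at hr'
    exact hr'.mono (by omega)

theorem sub_cost (Q K D s : ℕ) : ∃ b, ∀ {Δ : DataEnv} {p : ℕ → ℕ → Prop}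
    {kss : ℕ → List ℕ → Prop} {T₁ T₂ : XTy}, Δ.Wf → Δ.Bounded Q K D →
    (∀ X d d', p X d → InSlice Δ d d' → p X d') → T₁.under = T₂.under → T₁.size ≤ s →
    (∀ q ∈ T₁.labels, p q.1 q.2) → (∀ q ∈ T₂.labels, p q.1 q.2) →
    Cost (subT Δ false T₁ T₂) b (fun C => CSet p Δ.IsCtor kss b C ∧
      SubInfers Δ T₁ T₂ (absSet C) ∧ (C.map Constr.abs).Nodup) := by
  obtain ⟨b, hb⟩ := subT_cost Q K D s
  refine ⟨b, fun h1 h2 h3 h4 h5 h6 h7 => (hb false _ _ h1 h2 h3 h4 h5 h6 h7).imp fun C hC =>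
    ⟨hC.1.1, ⟨h4, ?_⟩, hC.2⟩⟩
  simpa using hC.1.2

theorem infer_lam (Q K D g b₀ s : ℕ) : ∃ b, ∀ T e, T.size ≤ s →
    InferBound Q K D (g + s + 1) b₀ e → InferBound Q K D g b (.lam T e) := by
  obtain ⟨b₁, h₁⟩ := freshT_cost s
  obtain ⟨b₂, h₂⟩ := close_cost Q K D g (1 + s + b₀)
  refine ⟨b₁ + (b₀ + b₂) + 1, fun T e hs he Δ cstTy G p n Γ nty U hc ht => ?_⟩
  cases ht with
  | @lam _ _ _ T₂ hwf ht =>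
  unfold inferT
  refine Cost.step (Cost.bind (h₁ T n hs) fun f hf => ?_)
  obtain ⟨hu, hn, _, hX⟩ := Ty.fresh_spec T n
  have hsz := Ty.size_fresh T n
  rw [← hf] at hu hn hX hsz
  have hl : ∀ q ∈ f.1.labels, p q.1 q.2 := fun q hq =>
    hc.fresh _ _ (hX q.1 (Ty.mem_frv.2 ⟨_, hq⟩)).1
  have hc' : Ctx Q K D (g + s + 1) Δ cstTy G p f.2 (f.1 :: Γ) :=
    (hc.next hn).extend (Γ' := [f.1]) (by simp; omega) (by simp; omega) (by simpa using hl)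
  refine Cost.bind (he hc' (by rw [List.map_cons, hu]; exact ht)) fun r hr => ?_
  refine (h₂ (e := .lam T e) hc ?_ ?_ (hr.cset.mono (by omega)) (hn.trans hr.le)
    (.lam hf hr.infers)).imp fun r' hr' => ?_
  · have := hr.size_le
    simp only [Ty.size]; omega
  · intro q hq
    simp only [Ty.labels, List.mem_append] at hq
    exact hq.elim (hl q) (hr.labels q)
  · have e : (Ty.arr f.1 r.1).under = .arr f.1.under r.1.under := rfl
    rw [e, hu, hr.under] at hr'
    exact hr'.mono (by omega)

theorem infer_app (Q K D g b₀ : ℕ) : ∃ b, ∀ e₁ e₂, InferBound Q K D g b₀ e₁ →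
    InferBound Q K D g b₀ e₂ → InferBound Q K D g b (.app e₁ e₂) := by
  obtain ⟨b₁, h₁⟩ := sub_cost Q K D b₀
  obtain ⟨b₂, h₂⟩ := unionC_cost b₀
  obtain ⟨b₃, h₃⟩ := unionC_cost (b₁ + b₂)
  obtain ⟨b₄, h₄⟩ := close_cost Q K D g (b₀ + b₃)
  refine ⟨b₀ + (b₀ + (b₁ + (b₂ + (b₃ + b₄)))) + 1,
    fun e₁ e₂ he₁ he₂ Δ cstTy G p n Γ nty U hc ht => ?_⟩
  cases ht with
  | @app _ _ _ T₁ T₂ ht₁ ht₂ =>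
  unfold inferT
  refine Cost.step (Cost.bind (he₁ hc ht₁) fun r₁ hr₁ =>
    Cost.bind (he₂ (hc.next hr₁.le) ht₂) fun r₂ hr₂ => ?_)
  obtain ⟨T, C₁, n₁⟩ := r₁
  have hu := hr₁.under
  cases T with
  | var | base | data => cases hu
  | arr T₁' T₂' =>
  obtain ⟨rfl, rfl⟩ := Ty.arr.inj hu
  have hs := hr₁.size_le
  have hl := hr₁.labels
  simp only [Ty.size] at hs
  simp only [Ty.labels, List.mem_append] at hl
  refine Cost.bind (h₁ hc.wf hc.bounded hc.slice hr₂.under hr₂.size_le hr₂.labels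
    fun q hq => hl q (.inl hq)) fun C₃ hC₃ => Cost.bind (h₂ hr₁.cset hr₂.cset) fun u hu =>
    Cost.bind (h₃ (hC₃.1.mono (by omega)) (hu.1.mono (by omega))) fun v hv => ?_
  refine (h₄ (e := .app e₁ e₂) hc (by omega) (fun q hq => hl q (.inr hq))
    (hv.1.mono (by omega)) (hr₁.le.trans hr₂.le) ?_).imp fun r' hr' => hr'.mono (by omega)
  -- The algorithm adds the subtype constraints on the left, the rule has them on the right.
  rw [hv.2.1, hu.2.1, Set.union_comm]
  exact .app hr₁.infers hr₂.infers hC₃.2.1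

/-- The branches are bounded by `g + b₀ + s` because, besides the context, they use the type
arguments of the scrutinee, which come from its inference with bound `b₀`, and the fresh type of the
match. -/
theorem infer_case (Q K D g b₀ b₁ s : ℕ) : ∃ b, ∀ e T bs, T.size ≤ s →
    InferBound Q K D g b₀ e → BranchesBound Q K D (g + b₀ + s) b₁ bs →
    InferBound Q K D g b (.case e T bs) := by
  obtain ⟨b₂, h₂⟩ := freshT_cost s
  obtain ⟨b₃, h₃⟩ := unionC_cost (b₀ + b₁)
  obtain ⟨b₄, h₄⟩ := insertC_cost (b₁ + b₃)
  obtain ⟨b₅, h₅⟩ := close_cost Q K D g (s + b₄)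
  refine ⟨b₀ + (b₂ + (b₁ + (b₃ + (b₄ + b₅)))) + 1,
    fun e T bs hs he hbs Δ cstTy G p n Γ nty U hc ht => ?_⟩
  cases ht with
  | @case _ Ts _ d _ _ hwf hte htb =>
  unfold inferT
  refine Cost.step (Cost.bind (he hc hte) fun r hr => ?_)
  obtain ⟨T₀, C₀, n₀⟩ := r
  have hu := hr.under
  cases T₀ with
  | var | base | arr => cases hu
  | data X d' Ts' =>
  simp only [Ty.under, Ty.relabel, Ty.relabels_eq, Ty.data.injEq, true_and] at hu
  obtain ⟨rfl, rfl⟩ := hu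
  have hsz := hr.size_le
  have hl := hr.labels
  simp only [Ty.size] at hsz
  simp only [Ty.labels, Ty.labelss_eq, List.mem_cons, List.mem_flatMap] at hl
  refine Cost.bind (h₂ T n₀ hs) fun f hf => ?_
  obtain ⟨hu, hn, _, hX⟩ := Ty.fresh_spec T n₀
  have hsf := Ty.size_fresh T n₀
  rw [← hf] at hu hn hX hsf
  have hn₀ : n ≤ n₀ := hr.le
  have hlf : ∀ q ∈ f.1.labels, p q.1 q.2 := fun q hq =>
    hc.fresh _ _ (hn₀.trans (hX q.1 (Ty.mem_frv.2 ⟨_, hq⟩)).1)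
  have hc' : Ctx Q K D (g + b₀ + s) Δ cstTy G p f.2 Γ :=
    (hc.next (hn₀.trans hn)).extend (Γ' := []) (by simp; omega) (by simp) (by simp)
  have hp : p X d' := hl (X, d') (.inl rfl)
  refine Cost.bind (hbs (X := X) (d := d') (Ts := Ts') (T := f.1) hc' hp ?_ (fun t ht => ⟨?_, ?_⟩)
    (by omega) hlf (by rw [hu]; exact htb)) fun b hb => ?_
  · have := Ty.length_le_sizes Ts'; omega
  · have := Ty.size_le_sizes ht; omega
  · exact fun q hq => hl q (.inr ⟨t, ht, hq⟩)
  refine Cost.bind (h₃ (hr.cset.mono (by omega)) (hb.cset.mono (by omega))) fun u hu' =>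
    Cost.bind (h₄ (c := ⟨[], .subset X d' b.2.1⟩) ⟨by simp, by simp, hp, hb.ctors⟩
      ⟨by simp, trivial, hb.length_le.trans (by omega)⟩ (hu'.1.mono (by omega))) fun v hv => ?_
  refine (h₅ (e := .case e T bs) hc (by omega) hlf (hv.1.mono (by omega))
    ((hn₀.trans hn).trans hb.le) ?_).imp fun r' hr' => ?_
  · rw [hv.2, hu'.2.1, Set.union_right_comm]
    have e : (⟨[], .subset X d' b.2.1⟩ : RC).abs = ⟨∅, .subset X d' bs.keys⟩ := by
      rw [← hb.keys]; rfl
    rw [e]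
    exact .case hr.infers hf hb.infers
  · rw [hu] at hr'
    exact hr'.mono (by omega)

theorem branches_nil (Q K D g : ℕ) : BranchesBound Q K D g 1 .nil := by
  intro Δ cstTy G p n Γ nty X d Ts T hc _ _ _ _ _ _
  unfold inferBranchesT
  refine Cost.mono (b := 1) (Cost.step (Cost.pure ⟨CSet.nil, rfl, ⟨by simp, by simp⟩, by simp,
    le_rfl, ?_⟩)) le_rfl
  rw [absSet_nil]
  exact .nil

/-- A branch binds at most `Q` variables, whose types have size at most `Q * (g + 1)` by
`Ty.size_subst_le`; the context bound `g + Q * (g + 2)` covers both. Their new labels `X(d')` are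
allowed since `d'` lies in the slice of the scrutinee's datatype. -/
theorem branches_cons (Q K D g b₀ b₁ : ℕ) : ∃ b, ∀ k e bs,
    InferBound Q K D (g + Q * (g + 2)) b₀ e → BranchesBound Q K D g b₁ bs →
    BranchesBound Q K D g b (.cons k e bs) := by
  obtain ⟨b₂, h₂⟩ := injT_cost Q
  obtain ⟨b₃, h₃⟩ := substT_cost (Q + g)
  obtain ⟨b₄, h₄⟩ := sub_cost Q K D b₀
  obtain ⟨b₅, h₅⟩ := unionC_cost (b₀ + b₄)
  obtain ⟨b₆, h₆⟩ := guardByT_cost (b₅ + 1)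
  obtain ⟨b₇, h₇⟩ := unionC_cost (b₆ + b₁)
  refine ⟨K + (((b₂ + b₃ + 1) * Q + 1) + ((Q + 1) + (b₀ + (b₄ + (b₅ + (b₆ + (b₁ + (b₇ +
    ((2 * b₁ + 2) + 0))))))))) + 1,
    fun k e bs he hbs Δ cstTy G p n Γ nty X d Ts T hc hp hTl hTs hTg hTp ht => ?_⟩
  cases ht with
  | @cons _ _ Us _ _ _ _ _ hk hte htb =>
  have hQ := hc.bounded.ctor_size_le hk
  unfold inferBranchesT
  refine Cost.step (Cost.bind ((lookupCtorT_cost ⟨Us, hk⟩).mono (hc.bounded.length_ctors_le d))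
    fun Us' hk' => ?_)
  obtain rfl := ctors_unique hc.wf hk hk'
  have hUs : ∀ U ∈ Us, U.size ≤ Q := fun U hU => by
    have := Ty.size_le_sizes hU; omega
  refine Cost.bind ((mapT_cost_eq (c := b₂ + b₃) (g := fun U : UTy => (U.inj X).subst Ts)
    fun U hU => Cost.bind (h₂ X U (hUs U hU)) fun V hV => ?_).mono ?_) fun As hAs => ?_
  · subst hV
    exact h₃ Ts _ (by omega) ((Ty.size_relabel _ _).le.trans ((hUs U hU).trans (by omega)))
  · have : Us.length ≤ Q := by omega
    gcongr
  subst hAs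
  refine Cost.bind (appendT_cost.mono
    (b' := Q + 1) (by rw [List.length_map]; omega)) fun Γ' hΓ' => ?_
  subst hΓ'
  have hc' : Ctx Q K D (g + Q * (g + 2)) Δ cstTy G p n
      (Us.map (fun U => (U.inj X).subst Ts) ++ Γ) := by
    refine hc.extend ?_ ?_ ?_
    · rw [List.length_map, Nat.mul_add]; omega
    · rw [List.forall_mem_map]
      refine fun U hU => (Ty.size_subst_le (M := g) (fun u hu => (hTs u hu).1) _).trans ?_
      refine (Nat.mul_le_mul_right _ ((Ty.size_relabel _ _).le.trans (hUs U hU))).trans ?_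
      exact (Nat.mul_le_mul_left Q (Nat.le_succ (g + 1))).trans (Nat.le_add_left _ _)
    · rw [List.forall_mem_map]
      intro U hU q hq
      rcases Ty.mem_labels_subst hq with hq | ⟨u, hu, hq⟩
      · obtain ⟨h1, h2⟩ := Ty.mem_labels_inj.1 hq
        rw [h1]
        exact hc.slice _ _ _ hp (.step .refl hk hU h2)
      · exact (hTs u hu).2 q hq
  refine Cost.bind (he (nty := nty) (U := T.under) hc' ?_) fun r hr => ?_
  · have e' : (Us.map fun U => (U.inj X).subst Ts).map Ty.under =
        Ty.substs (Ts.map Ty.under) Us := by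
      rw [Ty.substs_eq, List.map_map]
      exact List.map_congr_left fun U _ => (Ty.under_subst _ _).trans (by rw [Ty.under_inj])
    rw [List.map_append, e']
    exact hte
  refine Cost.bind (h₄ hc.wf hc.bounded hc.slice hr.under hr.size_le hr.labels hTp) fun C' hC' =>
    Cost.bind (h₅ (hr.cset.mono (by omega)) (hC'.1.mono (by omega))) fun u hu =>
    Cost.bind (h₆ (φ := [⟨k, X, d⟩]) (by simp) ?_ (hu.1.mono (by omega))) fun C hC =>
    Cost.bind (hbs (hc.next hr.le) hp hTl hTs hTg hTp htb) fun b hb =>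
    Cost.bind (h₇ (hC.1.mono (by omega)) (hb.cset.mono (by omega))) fun v hv =>
    Cost.bind (insertW_cost.mono ?_) fun ks hks => Cost.pure ?_
  · rw [List.forall_mem_singleton]
    exact ⟨hp, Us, hk⟩
  · have := hb.length_le; omega
  · obtain ⟨hk1, hk2, hk3, hk4⟩ := hks
    refine ⟨hv.1.mono (by omega), ?_, ⟨hk2 hb.ctors.1, fun k' hk' => ?_⟩, ?_, hr.le.trans hb.le, ?_⟩
    · rw [hk1, hb.keys]; rfl
    · rcases (hk3 k').1 hk' with rfl | h
      · exact ⟨Us, hk⟩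
      · exact hb.ctors.2 k' h
    · exact hk4.trans (by have := hb.length_le; omega)
    · rw [hv.2.1, hC.2, hu.2.1]
      exact .cons hk hr.infers hC'.2.1 hb.infers

-- Uniform bounds for expressions of bounded size.

/-- Since `s` bounds the nesting of binders and matches, the context bound grows only boundedly
often; it is quantified inside the induction so that it may grow. The constant precedes the
expression, so one constant serves all expressions of size at most `s`. -/
theorem exists_inferBound (Q K D s : ℕ) :
    (∀ g, ∃ b, ∀ e, e.size ≤ s → InferBound Q K D g b e) ∧
    ∀ g, ∃ b, ∀ bs, bs.size ≤ s → BranchesBound Q K D g b bs := by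
  induction s with
  | zero =>
    refine ⟨fun g => ⟨0, fun e he => ?_⟩, fun g => ⟨1, fun bs hbs => ?_⟩⟩
    · cases e <;> simp only [Exp.size] at he <;> omega
    · cases bs with
      | nil => exact branches_nil Q K D g
      | cons => simp only [Branches.size] at hbs; omega
  | succ s ih =>
    obtain ⟨ihe, ihb⟩ := ih
    constructor
    · intro g
      obtain ⟨b₁, h₁⟩ := infer_cst Q K D g
      obtain ⟨b₂, h₂⟩ := infer_lvar Q K D g
      obtain ⟨b₃, h₃⟩ := infer_con Q K D g s
      obtain ⟨b₄, h₄⟩ := infer_gvar Q K D g s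
      obtain ⟨c₁, hc₁⟩ := ihe g
      obtain ⟨c₂, hc₂⟩ := ihe (g + s + 1)
      -- The context bound for the branches depends on the constant `c₁` already found for the
      -- scrutinee.
      obtain ⟨c₃, hc₃⟩ := ihb (g + c₁ + s)
      obtain ⟨b₅, h₅⟩ := infer_app Q K D g c₁
      obtain ⟨b₆, h₆⟩ := infer_lam Q K D g c₂ s
      obtain ⟨b₇, h₇⟩ := infer_case Q K D g c₁ c₃ s
      refine ⟨b₁ + b₂ + b₃ + b₄ + b₅ + b₆ + b₇, fun e he => ?_⟩
      cases e with
      | cst c => exact InferBound.mono (h₁ c) (by omega)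
      | lvar i => exact InferBound.mono (h₂ i) (by omega)
      | con d k Ts =>
        simp only [Exp.size] at he
        exact InferBound.mono (h₃ d k Ts (by omega)) (by omega)
      | gvar x Ts =>
        simp only [Exp.size] at he
        exact InferBound.mono (h₄ x Ts (by omega)) (by omega)
      | app e₁ e₂ =>
        simp only [Exp.size] at he
        exact InferBound.mono (h₅ e₁ e₂ (hc₁ _ (by omega)) (hc₁ _ (by omega))) (by omega)
      | lam T e =>
        simp only [Exp.size] at he
        exact InferBound.mono (h₆ T e (by omega) (hc₂ _ (by omega))) (by omega)
      | case e T bs =>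
        simp only [Exp.size] at he
        exact InferBound.mono (h₇ e T bs (by omega) (hc₁ _ (by omega)) (hc₃ _ (by omega))) (by omega)
    · intro g
      obtain ⟨c₁, hc₁⟩ := ihe (g + Q * (g + 2))
      obtain ⟨c₂, hc₂⟩ := ihb g
      obtain ⟨b, hb⟩ := branches_cons Q K D g c₁ c₂
      refine ⟨1 + b, fun bs hbs => ?_⟩
      cases bs with
      | nil => exact BranchesBound.mono (branches_nil Q K D g) (by omega)
      | cons k e bs =>
        simp only [Branches.size] at hbs
        exact BranchesBound.mono (hb k e bs (hc₁ _ (by omega)) (hc₂ _ (by omega))) (by omega)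

/-! ## Inference for modules -/

/-- One definition costs a constant and produces a scheme that satisfies the invariant of the table.
The remaining module appears as a continuation `k`, so that the lemma fits the recursive call of
`inferModT` directly. -/
theorem defn_cost (Q K D S : ℕ) : ∃ b, ∀ {Δ : DataEnv} {cstTy : ℕ → Ty Empty}
    {G : Array (Scheme (List RC))} {f : Defn} {n : ℕ} {α : Type} {P : α → Prop} {b' : ℕ}
    {k : Scheme (List RC) → ℕ → Timed α}, Δ.Wf → Δ.Bounded Q K D →
    (∀ a, (cstTy a).size ≤ Q) → (∀ s ∈ G.toList, s.Wf Δ ∧ s.ty.size ≤ Q) →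
    f.ty.Wf Δ f.nty → HasTy Δ cstTy (underEnv G) f.nty [f.ty] f.body f.ty → f.ty.size ≤ Q →
    f.body.size ≤ S →
    (∀ T n₁ T' C₁ n₂ C₂ C, (T, n₁) = f.ty.fresh n →
      Infers Δ cstTy (G.toList.map Scheme.abs) [T] f.body n₁ T' C₁ n₂ → SubInfers Δ T' T C₂ →
      absSet C = restrict (Sat (C₁ ∪ C₂)) {X | X ∈ T.frv} →
      Scheme.Wf Δ ⟨f.nty, T.frv, C, T⟩ → T.size ≤ Q → T.under = f.ty →
      Cost (k ⟨f.nty, T.frv, C, T⟩ n₂) b' P) →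
    Cost (do
      let t ← freshT f.ty n
      let r ← inferT Δ cstTy G [t.1] f.body t.2
      let C₂ ← subT Δ false r.1 t.1
      let u ← unionT constrEqT r.2.1 C₂
      let S ← saturateT u.1
      let X ← frvT t.1
      let C ← restrictT S X
      k ⟨f.nty, X, C, t.1⟩ r.2.2) (b + b') P := by
  obtain ⟨b₁, h₁⟩ := freshT_cost Q
  -- The local context of a body consists of the defined name alone, hence has length one and a type
  -- of size at most `Q`.
  obtain ⟨b₂, h₂⟩ := (exists_inferBound Q K D S).1 (Q + 1)
  obtain ⟨b₃, h₃⟩ := sub_cost Q K D b₂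
  obtain ⟨b₄, h₄⟩ := unionC_cost (b₂ + b₃)
  obtain ⟨b₅, h₅⟩ := saturateT_cost b₄
  obtain ⟨b₆, h₆⟩ := frvT_cost Q
  obtain ⟨b₇, h₇⟩ := restrictT_cost (b₅ + Q)
  refine ⟨b₁ + b₂ + b₃ + b₄ + b₅ + b₆ + b₇,
    fun {Δ cstTy G f n α P b' k} hΔ hB hc hG hwf ht hQ hS hk => ?_⟩
  refine Cost.mono (b := b₁ + (b₂ + (b₃ + (b₄ + (b₅ + (b₆ + (b₇ + b'))))))) ?_ (by omega)
  refine Cost.bind (h₁ f.ty n hQ) fun t ht' => ?_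
  obtain ⟨hu, hn, hnd, hX⟩ := Ty.fresh_spec f.ty n
  have hsz := Ty.size_fresh f.ty n
  rw [← ht'] at hu hn hnd hX hsz
  -- The relation on pairs permits anything for variables created later, and for the variables of
  -- the declared type only what is meaningful there.
  have hctx : Ctx Q K D (Q + 1) Δ cstTy G (fun X d => t.2 ≤ X ∨ Owns Δ t.1 X d) t.2 [t.1] :=
    { wf := hΔ
      bounded := hB
      cst := hc
      scheme := hG
      slice := fun X d d' h h' => h.imp_right fun h => h.slice h'
      fresh := fun X d h => .inl h
      length_le := by simp
      size_le := by simp; omega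
      labels := by
        rw [List.forall_mem_singleton]
        exact fun q hq => .inr ⟨q.2, hq, .refl⟩ }
  refine Cost.bind (h₂ _ hS hctx (by simpa [hu] using ht)) fun r hr => ?_
  refine Cost.bind (h₃ hΔ hB hctx.slice (hr.under.trans hu.symm) hr.size_le hr.labels
    (hctx.labels t.1 (by simp))) fun C₂ hC₂ =>
    Cost.bind (h₄ (hr.cset.mono (by omega)) (hC₂.1.mono (by omega))) fun u hu' =>
    Cost.bind (h₅ hu'.1) fun D hD => Cost.bind (h₆ t.1 (by omega)) fun X hXf => ?_
  subst hXf
  refine Cost.bind (h₇ (hD.1.mono (by omega)) (t.1.length_frv_le.trans (by omega)))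
    fun C hC => ?_
  -- The variables of the declared type lie below `t.2`. So restriction to them excludes the first
  -- alternative and leaves exactly the well-formed pairs.
  have hown : ∀ X d, (t.2 ≤ X ∨ Owns Δ t.1 X d) → X ∈ t.1.frv → Owns Δ t.1 X d :=
    fun X d h hX' => h.resolve_left fun h => by have := (hX X hX').2; omega
  refine hk t.1 t.2 r.1 _ r.2.2 _ C ht' hr.infers hC₂.2.1 ?_ ⟨?_, hnd, fun X => Iff.rfl, ?_, ?_⟩
    (by omega) hu
  · rw [hC.2.1, hD.2.1, hu'.2.1]
  · rw [← hu] at hwf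
    exact (Ty.wf_relabel _ _).1 hwf
  · exact hC.2.2.2 (hD.2.2 (hu'.2.2 hC₂.2.2))
  · intro c hcC
    have hok := hC.1.ok c hcC
    have hfr : ∀ X, X ∈ c.abs.frv → X ∈ t.1.frv := fun X h => hC.2.2.1 c hcC h
    refine ⟨hok.nodup, fun a ha => ⟨hown _ _ (hok.guard a ha).1 (hfr _ (.inl ⟨a, ?_, rfl⟩)),
      (hok.guard a ha).2⟩, ?_⟩
    · exact List.mem_toFinset.2 ha
    · have hb := hok.body
      have hfr' : ∀ X, X ∈ c.body.frv → X ∈ t.1.frv := fun X h => hfr X (.inr (by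
        have e : (c.abs.body).frv = c.body.frv := by
          unfold Constr.abs; cases c.body <;> rfl
        rw [e]; exact h))
      cases e : c.body <;> rw [e] at hb hfr'
      · exact ⟨hown _ _ hb.1 (hfr' _ (by simp [Body.frv, Body.pairs])),
          hown _ _ hb.2 (hfr' _ (by simp [Body.frv, Body.pairs]))⟩
      · exact ⟨hown _ _ hb.1 (hfr' _ (by simp [Body.frv, Body.pairs])), hb.2⟩
      · exact ⟨hown _ _ hb.1 (hfr' _ (by simp [Body.frv, Body.pairs])), hb.2⟩
      · trivial

/-- The invariant on schemes does not mention the length of the table and is restored by each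
definition, so the same constant applies at every step. The additional `1` pays for the final call
on the empty module. -/
theorem inferModT_cost (Q K D S : ℕ) : ∃ b, ∀ {Δ : DataEnv} {cstTy : ℕ → Ty Empty},
    Δ.Wf → Δ.Bounded Q K D → (∀ a, (cstTy a).size ≤ Q) →
    ∀ (m : List Defn) (G : Array (Scheme (List RC))) (n : ℕ),
    (∀ s ∈ G.toList, s.Wf Δ ∧ s.ty.size ≤ Q) → ModTyped Δ cstTy (underEnv G) m →
    (∀ f ∈ m, f.ty.size ≤ Q ∧ f.body.size ≤ S) →
    Cost (inferModT Δ cstTy G m n) (b * m.length + 1) (fun G' => ∃ nf,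
      ModInfers Δ cstTy (G.toList.map Scheme.abs) n m (G'.toList.map Scheme.abs) nf) := by
  obtain ⟨b, hb⟩ := defn_cost Q K D S
  refine ⟨b + 1, fun {Δ cstTy} hΔ hB hc m => ?_⟩
  induction m with
  | nil =>
    intro G n _ _ _
    unfold inferModT
    exact Cost.mono (b := 1) (Cost.step (Cost.pure ⟨n, .nil⟩)) (by simp)
  | cons f m ih =>
    intro G n hG ht hm
    obtain ⟨hwf, ht, htm⟩ := ht
    unfold inferModT
    refine Cost.mono (b := b + ((b + 1) * m.length + 1) + 1) (Cost.step
      (hb (k := fun s n => inferModT Δ cstTy (G.push s) m n) hΔ hB hc hG hwf ht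
        (hm f (by simp)).1 (hm f (by simp)).2
        fun T n₁ T' C₁ n₂ C₂ C h1 h2 h3 h4 h5 h6 h7 => ?_)) ?_
    · refine (ih (G.push ⟨f.nty, T.frv, C, T⟩) n₂ ?_ ?_ fun f hf => hm f (by simp [hf])).imp
        fun G' hG' => ?_
      · intro s hs
        rw [Array.toList_push, List.mem_append, List.mem_singleton] at hs
        rcases hs with hs | rfl
        · exact hG s hs
        · exact ⟨h5, h6⟩
      · have e : underEnv (G.push ⟨f.nty, T.frv, C, T⟩) = underEnv G ++ [(f.nty, f.ty)] := by
          simp [underEnv, h7]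
        rw [e]
        exact htm
      · obtain ⟨nf, h⟩ := hG'
        refine ⟨nf, .cons h1 h2 h3 ?_⟩
        rw [← h4]
        rw [Array.toList_push, List.map_append] at h
        exact h
    · rw [List.length_cons, Nat.mul_add]; omega

end Refinement

-- The main theorem.

theorem mainTheorem3 (Q K D S : ℕ) :
    ∃ c : ℕ, ∀ (Δ : DataEnv) (cstTy : ℕ → Ty Empty) (G : Array (Scheme (List RC)))
      (m : List Defn),
      Δ.Wf → Δ.Bounded Q K D → (∀ a, (cstTy a).size ≤ Q) →
      (∀ s ∈ G.toList, s.Wf Δ ∧ s.ty.size ≤ Q) →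
      ModTyped Δ cstTy (G.toList.map fun s => (s.nty, s.ty.under)) m →
      (∀ f ∈ m, f.ty.size ≤ Q ∧ f.body.size ≤ S) →
      ∃ (G' : Array (Scheme (List RC))) (t n : ℕ),
        (inferModT Δ cstTy G m 0).run 0 = some (G', t) ∧
        ModInfers Δ cstTy (G.toList.map Scheme.abs) 0 m (G'.toList.map Scheme.abs) n ∧
        (m ≠ [] → t ≤ c * m.length) := by
  obtain ⟨b, hb⟩ := inferModT_cost Q K D S
  refine ⟨b + 1, fun Δ cstTy G m hΔ hB hc hG ht hm => ?_⟩
  obtain ⟨G', t, h1, h2, n, h3⟩ := hb hΔ hB hc m G 0 hG ht hm 0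
  refine ⟨G', t, n, h1, h3, fun hne => ?_⟩
  -- For a nonempty module, the additive `1` is absorbed by passing from `b` to `b + 1`.
  have := List.length_pos_of_ne_nil hne
  rw [Nat.add_mul]
  omega
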